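/- Let $g=(g_1,\dots,g_n):\mathbb R^d\to\mathbb R^n$ be locally Lipschitz and let $h:\mathbb R^d\to\mathbb R^m$, $G,H:\mathbb R^d\to\mathbb R^p$ be continuously differentiable. Let $\mathcal F_S$ be the solution set of the switching system $$g(x)\le 0,\qquad h(x)=0,\qquad G_i(x)H_i(x)=0,\quad i=1,\dots,p,$$ and let $\bar x\in\mathcal F_S$. Put $\Omega_S=\{(y,z)\in\mathbb R^2: yz=0\}=C_1\cup C_2$ with $C_1=\mathbb R\times\{0\}$, $C_2=\{0\}\times\mathbb R$; $\bar I_g=\{i:g_i(\bar x)=0\}$, $I^G=\{i:G_i(\bar x)=0\ne H_i(\bar x)\}$, $I^H=\{i:G_i(\bar x)\neq 0=H_i(\bar x)\}$, $I^{GH}=\{i:G_i(\bar x)=H_i(\bar x)=0\}$. Write $\widehat{\mathcal N}$, $\mathcal N$ for the Fréchet and the limiting normal cone and $\widehat\partial$, $\partial$ for the Fréchet and the limiting subdifferential. Linear (in)dependence, bases and ranks below are those of indexed families of vectors. *MPSC-RCPLD* holds at $\bar x$ if (i) the family $\{\nabla h_i(x)\}_{i=1}^m\cup\{\nabla G_i(x)\}_{i\in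 I^G}\cup\{\nabla H_i(x)\}_{i\in I^H}$ has constant rank for $x$ in a neighbourhood of $\bar x$; (ii) whenever $\mathcal I_1\subseteq\{1,\dots,m\}$, $\mathcal I_2\subseteq I^G$, $\mathcal I_3\subseteq I^H$ are such that $\{\nabla h_i(\bar x)\}_{\mathcal I_1}\cup\{\nabla G_i(\bar x)\}_{\mathcal I_2}\cup\{\nabla H_i(\bar x)\}_{\mathcal I_3}$ is a basis of the span of the family in (i) at $\bar x$, and $\mathcal I_4\subseteq\bar I_g$, multipliers $\lambda^g,\lambda^h,\lambda^G,\lambda^H$, sets $\mathcal I_5\subseteq\{i\in I^{GH}:\lambda^G_i\ne0\}$, $\mathcal I_6\subseteq\{i\in I^{GH}:\lambda^H_i\neq0\}$ and $v_i\in\partial g_i(\bar x)$ $(i\in\mathcal I_4)$ satisfy $\lambda^g_i\ge0$ $(i\in\mathcal I_4)$, $\lambda_i^G\lambda_i^H=0$ $(i\in I^{GH})$ and $$0=\sum_{\mathcal I_4}\lambda_i^gv_i+\sum_{\mathcal I_1}\lambda_i^h\nabla h_i(\bar x)+\sum_{\mathcal I_2\cup\mathcal I_5}\lambda_i^G\nabla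 G_i(\bar x)+\sum_{\mathcal I_3\cup\mathcal I_6}\lambda_i^H\nabla H_i(\bar x),$$ where the multipliers occurring in this sum are not all zero, then for all sequences $x^k\to\bar x$ with $x^k\neq\bar x$ and $v_i^k\in\partial g_i(x^k)$ with $v_i^k\to v_i$ $(i\in\mathcal I_4)$ the family $\{v_i^k\}_{\mathcal I_4}\cup\{\nabla h_i(x^k)\}_{\mathcal I_1}\cup\{\nabla G_i(x^k)\}_{\mathcal I_2\cup\mathcal I_5}\cup\{\nabla H_i(x^k)\}_{\mathcal I_3\cup\mathcal I_6}$ is linearly dependent for all sufficiently large $k$. Next consider systems $g\le0$, $e=0$, $(G_i,H_i)\in\Gamma_i$ $(i\in I^{GH})$, where $e$ collects $h$, $G_i$ $(i\in I^G)$ and $H_i$ $(i\in I^H)$. *RCPLD with cones $N_i\subseteq\mathbb R^2$* $(i\in I^{GH})$ holds at $\bar x$ if the gradients of $e$ have constant rank near $\bar x$ and the following holds: whenever $\{\nabla e_j(\bar x)\}_{j\in J}$ is a basis of the span of all $\nabla e_j(\bar x)$, $I\subseteq \bar I_g$, $\lambda^g_i\ge 0$, $v_i\in\partial g_i(\bar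 x)$ $(i\in I)$, $\lambda^e_j\in\mathbb R$ $(j\in J)$ and $(\eta^1_i,\eta^2_i)\in N_i$ $(i\in I^{GH})$ are not all zero multipliers with $$0=\sum_{I}\lambda^g_iv_i+\sum_{J}\lambda^e_j\nabla e_j(\bar x)+\sum_{i\in I^{GH}}\bigl(\eta^1_i\nabla G_i(\bar x)+\eta^2_i\nabla H_i(\bar x)\bigr),$$ then for all sequences $x^k$, $v^k_i$ as above the family $\{v^k_i\}_{I}\cup\{\nabla e_j(x^k)\}_{J}\cup\{\nabla G_i(x^k)\}_{\eta^1_i\ne0}\cup\{\nabla H_i(x^k)\}_{\eta^2_i\neq0}$ is linearly dependent for all large $k$. *RCPLD of the system* is the case $N_i=\mathcal N_{\Gamma_i}(G_i(\bar x),H_i(\bar x))$. *MPSC piecewise RCPLD* holds at $\bar x$ if for every partition of $I^{GH}$ into $P$ and $Q$ RCPLD holds at $\bar x$ for the system with $\Gamma_i=C_1$ $(i\in P)$ and $\Gamma_i=C_2$ $(i\in Q)$. Then: 1. $\mathcal N_{\Omega_S}(0,0)=\bigcup_{y\in\mathbb R^2}\widehat{\mathcal N}_{\Omega_S}(y)=\{(\eta_1,\eta_2):\eta_1\eta_2=0\}=\widehat{\mathcal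 N}_{C_1}(0,0)\cup\widehat{\mathcal N}_{C_2}(0,0)$. 2. The following are equivalent: MPSC-RCPLD holds at $\bar x$; RCPLD holds at $\bar x$ for the system with $\Gamma_i=\Omega_S$ for all $i\in I^{GH}$; MPSC piecewise RCPLD holds at $\bar x$; RCPLD with cones $N_i=\widehat{\mathcal N}_{C_1}(0,0)\cup\widehat{\mathcal N}_{C_2}(0,0)$ holds at $\bar x$. 3. If MPSC-RCPLD holds at $\bar x$, then for every $f:\mathbb R^d\to\mathbb R$ that is Lipschitz continuous near $\bar x$ and for which $\bar x$ is a local minimizer over $\mathcal F_S$, the point $\bar x$ is M-stationary: there are $\lambda^g_i\ge0$ $(i\in\bar I_g)$, $\lambda^h\in\mathbb R^m$ and $(\eta_i^1,\eta_i^2)\in\mathcal N_{\Omega_S}(G_i(\bar x),H_i(\bar x))$ $(i=1,\dots,p)$ with $$0\in\partial f(\bar x)+\sum_{i\in\bar I_g}\lambda^g_i\partial g_i(\bar x)+\sum_{i=1}^m\lambda^h_i\nabla h_i(\bar x)+\sum_{i=1}^p\bigl(\eta_i^1\nabla G_i(\bar x)+\eta_i^2\nabla H_i(\bar x)\bigr).$$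 4. If MPSC-RCPLD holds at $\bar x$ and every $g_i$ is subdifferentially regular around $\bar x$ (that is, $\partial g_i(x)=\widehat\partial g_i(x)$ for all $x$ near $\bar x$), then the local error bound holds at $\bar x$: there are $\alpha\ge0$ and $\varepsilon>0$ such that, with $g^+=\max\{0,g\}$ componentwise, $$d_{\mathcal F_S}(x)\le\alpha\Bigl(\|g^+(x)\|+\|h(x)\|+\sum_{i=1}^pd_{\Omega_S}(G_i(x),H_i(x))\Bigr)\quad\text{for all }x\text{ with }\|x-\bar x\|<\varepsilon.$$ -/

import Mathlib

open Filter Topology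

noncomputable section

section VariationalAnalysis

variable {E : Type*} [NormedAddCommGroup E] [InnerProductSpace ℝ E]

/-- The Fréchet (regular) normal cone to `C` at `x`; it is empty when `x ∉ C`. -/
def regularNormalCone (C : Set E) (x : E) : Set E :=
  {v | x ∈ C ∧ ∀ ε > (0 : ℝ), ∀ᶠ y in 𝓝[C] x, inner ℝ v (y - x) ≤ ε * ‖y - x‖}

/-- The limiting (Mordukhovich) normal cone to `C` at `x`. -/
def limitingNormalCone (C : Set E) (x : E) : Set E :=
  {v | ∃ (y : ℕ → E) (w : ℕ → E), (∀ k, y k ∈ C) ∧ (∀ k, w k ∈ regularNormalCone C (y k)) ∧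
    Tendsto y atTop (𝓝 x) ∧ Tendsto w atTop (𝓝 v)}

/-- The Fréchet (regular) subdifferential of `f` at `x`. -/
def regularSubdiff (f : E → ℝ) (x : E) : Set E :=
  {ξ | ∀ ε > (0 : ℝ), ∀ᶠ y in 𝓝 x, -(ε * ‖y - x‖) ≤ f y - f x - inner ℝ ξ (y - x)}

/-- The limiting (Mordukhovich) subdifferential of `f` at `x`. -/
def limitingSubdiff (f : E → ℝ) (x : E) : Set E :=
  {ξ | ∃ (y : ℕ → E) (w : ℕ → E), (∀ k, w k ∈ regularSubdiff f (y k)) ∧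
    Tendsto y atTop (𝓝 x) ∧ Tendsto (fun k => f (y k)) atTop (𝓝 (f x)) ∧
    Tendsto w atTop (𝓝 ξ)}

/-- Subdifferential (Clarke) regularity at `x` of a function that is Lipschitz near `x`. -/
def SubdiffRegularAt (f : E → ℝ) (x : E) : Prop :=
  limitingSubdiff f x = regularSubdiff f x

/-- The subfamily `(u i)`, `i ∈ J`, is a basis of the span of the whole family `u`. -/
def IsBasisOfSpan {κ : Type*} (u : κ → E) (J : Finset κ) : Prop :=
  LinearIndependent ℝ (fun i : J => u i) ∧
    Submodule.span ℝ (Set.range fun i : J => u i) = Submodule.span ℝ (Set.range u)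

end VariationalAnalysis

/-- The switching set `{(y, z) : y z = 0}` in the plane. -/
def switchingSet : Set (EuclideanSpace ℝ (Fin 2)) := {y | y 0 * y 1 = 0}

/-- The axis `ℝ × {0}`. -/
def axisOne : Set (EuclideanSpace ℝ (Fin 2)) := {y | y 1 = 0}

/-- The axis `{0} × ℝ`. -/
def axisTwo : Set (EuclideanSpace ℝ (Fin 2)) := {y | y 0 = 0}

/-- RCPLD at `x` for a system `g ≤ 0`, `e = 0`, `(G i, H i) ∈ Γ i`, where `N i` is the cone from
which the multiplier pair of the `i`-th disjunctive constraint is taken; RCPLD of the system itself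
is the case in which `N i` is the limiting normal cone of `Γ i` at `(G i x, H i x)`.
Linear dependence is that of indexed families, and the multipliers required not to vanish
simultaneously are those that occur in the sum. -/
def OrthoRCPLD {d n : ℕ} {κ ι : Type*} [Fintype ι]
    (g : Fin n → EuclideanSpace ℝ (Fin d) → ℝ) (e : κ → EuclideanSpace ℝ (Fin d) → ℝ)
    (G H : ι → EuclideanSpace ℝ (Fin d) → ℝ) (N : ι → Set (EuclideanSpace ℝ (Fin 2)))
    (x : EuclideanSpace ℝ (Fin d)) : Prop :=
  (∀ᶠ y in 𝓝 x, Set.finrank ℝ (Set.range fun i => gradient (e i) y) =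
      Set.finrank ℝ (Set.range fun i => gradient (e i) x)) ∧
  ∀ J : Finset κ, IsBasisOfSpan (fun i => gradient (e i) x) J →
  ∀ (I : Finset (Fin n)) (lamg : Fin n → ℝ) (lame : κ → ℝ)
    (η : ι → EuclideanSpace ℝ (Fin 2)) (v : Fin n → EuclideanSpace ℝ (Fin d)),
    (∀ i ∈ I, g i x = 0 ∧ 0 ≤ lamg i ∧ v i ∈ limitingSubdiff (g i) x) →
    (∀ i, η i ∈ N i) →
    ((∃ i ∈ I, lamg i ≠ 0) ∨ (∃ i ∈ J, lame i ≠ 0) ∨ ∃ i, η i ≠ 0) →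
    ∑ i ∈ I, lamg i • v i + ∑ i ∈ J, lame i • gradient (e i) x +
      ∑ i, (η i 0 • gradient (G i) x + η i 1 • gradient (H i) x) = 0 →
  ∀ (xs : ℕ → EuclideanSpace ℝ (Fin d)) (vs : ℕ → Fin n → EuclideanSpace ℝ (Fin d)),
    Tendsto xs atTop (𝓝 x) → (∀ k, xs k ≠ x) →
    (∀ i ∈ I, (∀ k, vs k i ∈ limitingSubdiff (g i) (xs k)) ∧
      Tendsto (fun k => vs k i) atTop (𝓝 (v i))) →
    ∀ᶠ k in atTop, ¬ LinearIndependent ℝ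
      (Sum.elim (fun i : I => vs k i)
        (Sum.elim (fun i : J => gradient (e i) (xs k))
          (Sum.elim (fun i : {i : ι // η i 0 ≠ 0} => gradient (G i) (xs k))
            (fun i : {i : ι // η i 1 ≠ 0} => gradient (H i) (xs k)))))

/-- The data of the switching system
`g(x) ≤ 0`, `h(x) = 0`, `G_i(x) H_i(x) = 0` for `i = 1, …, p`. -/
structure SwitchingSystem (d n m p : ℕ) where
  g : Fin n → EuclideanSpace ℝ (Fin d) → ℝ
  h : Fin m → EuclideanSpace ℝ (Fin d) → ℝ
  G : Fin p → EuclideanSpace ℝ (Fin d) → ℝ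
  H : Fin p → EuclideanSpace ℝ (Fin d) → ℝ

namespace SwitchingSystem

variable {d n m p : ℕ} (S : SwitchingSystem d n m p) (x : EuclideanSpace ℝ (Fin d))

/-- The feasible set. -/
def feasible : Set (EuclideanSpace ℝ (Fin d)) :=
  {x | (∀ i, S.g i x ≤ 0) ∧ (∀ i, S.h i x = 0) ∧ ∀ i, S.G i x * S.H i x = 0}

/-- The point `(G_i(x), H_i(x))` of the plane. -/
def pair (i : Fin p) : EuclideanSpace ℝ (Fin 2) := !₂[S.G i x, S.H i x]

/-- Indices with `G_i(x) = 0` and `H_i(x) ≠ 0`. -/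
def indexG : Finset (Fin p) := Finset.univ.filter fun i => S.G i x = 0 ∧ S.H i x ≠ 0

/-- Indices with `G_i(x) ≠ 0` and `H_i(x) = 0`. -/
def indexH : Finset (Fin p) := Finset.univ.filter fun i => S.G i x ≠ 0 ∧ S.H i x = 0

/-- Indices with `G_i(x) = 0` and `H_i(x) = 0`. -/
def indexGH : Finset (Fin p) := Finset.univ.filter fun i => S.G i x = 0 ∧ S.H i x = 0

/-- The equality constraints of the local reformulation of the system around `x`:
`h_i`, `i = 1, …, m`; `G_i`, `i ∈ I^G`; `H_i`, `i ∈ I^H`. -/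
def eqFun : Fin m ⊕ S.indexG x ⊕ S.indexH x → EuclideanSpace ℝ (Fin d) → ℝ :=
  Sum.elim S.h (Sum.elim (fun i => S.G i) (fun i => S.H i))

/-- MPSC-RCPLD at `x`. -/
def RCPLD : Prop :=
  (∀ᶠ y in 𝓝 x, Set.finrank ℝ (Set.range fun i => gradient (S.eqFun x i) y) =
      Set.finrank ℝ (Set.range fun i => gradient (S.eqFun x i) x)) ∧
  ∀ (I₁ : Finset (Fin m)) (I₂ I₃ : Finset (Fin p)), I₂ ⊆ S.indexG x → I₃ ⊆ S.indexH x →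
    LinearIndependent ℝ
      (Sum.elim (fun i : I₁ => gradient (S.h i) x)
        (Sum.elim (fun i : I₂ => gradient (S.G i) x) (fun i : I₃ => gradient (S.H i) x))) →
    Submodule.span ℝ (Set.range
      (Sum.elim (fun i : I₁ => gradient (S.h i) x)
        (Sum.elim (fun i : I₂ => gradient (S.G i) x) (fun i : I₃ => gradient (S.H i) x)))) =
      Submodule.span ℝ (Set.range fun i => gradient (S.eqFun x i) x) →
  ∀ (I₄ : Finset (Fin n)) (I₅ I₆ : Finset (Fin p)) (lamg : Fin n → ℝ) (lamh : Fin m → ℝ)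
    (lamG lamH : Fin p → ℝ) (v : Fin n → EuclideanSpace ℝ (Fin d)),
    (∀ i ∈ I₄, S.g i x = 0 ∧ 0 ≤ lamg i ∧ v i ∈ limitingSubdiff (S.g i) x) →
    (∀ i ∈ I₅, i ∈ S.indexGH x ∧ lamG i ≠ 0) →
    (∀ i ∈ I₆, i ∈ S.indexGH x ∧ lamH i ≠ 0) →
    (∀ i ∈ S.indexGH x, lamG i * lamH i = 0) →
    ((∃ i ∈ I₄, lamg i ≠ 0) ∨ (∃ i ∈ I₁, lamh i ≠ 0) ∨
      (∃ i ∈ I₂ ∪ I₅, lamG i ≠ 0) ∨ ∃ i ∈ I₃ ∪ I₆, lamH i ≠ 0) →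
    ∑ i ∈ I₄, lamg i • v i + ∑ i ∈ I₁, lamh i • gradient (S.h i) x +
      ∑ i ∈ I₂ ∪ I₅, lamG i • gradient (S.G i) x +
      ∑ i ∈ I₃ ∪ I₆, lamH i • gradient (S.H i) x = 0 →
  ∀ (xs : ℕ → EuclideanSpace ℝ (Fin d)) (vs : ℕ → Fin n → EuclideanSpace ℝ (Fin d)),
    Tendsto xs atTop (𝓝 x) → (∀ k, xs k ≠ x) →
    (∀ i ∈ I₄, (∀ k, vs k i ∈ limitingSubdiff (S.g i) (xs k)) ∧
      Tendsto (fun k => vs k i) atTop (𝓝 (v i))) →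
    ∀ᶠ k in atTop, ¬ LinearIndependent ℝ
      (Sum.elim (fun i : I₄ => vs k i)
        (Sum.elim (fun i : I₁ => gradient (S.h i) (xs k))
          (Sum.elim (fun i : ↥(I₂ ∪ I₅) => gradient (S.G i) (xs k))
            (fun i : ↥(I₃ ∪ I₆) => gradient (S.H i) (xs k)))))

/-- RCPLD for ortho-disjunctive systems, applied to the local reformulation
`g ≤ 0`, `h = 0`, `G_i = 0` (`i ∈ I^G`), `H_i = 0` (`i ∈ I^H`),
`(G_i, H_i) ∈ switchingSet` (`i ∈ I^{GH}`), with multiplier cones `N i` for `i ∈ I^{GH}`. -/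
def LocalRCPLD (N : S.indexGH x → Set (EuclideanSpace ℝ (Fin 2))) : Prop :=
  OrthoRCPLD S.g (S.eqFun x) (fun i : S.indexGH x => S.G i) (fun i : S.indexGH x => S.H i) N x

/-- MPSC piecewise RCPLD at `x`: for every partition of `I^{GH}` into `P` and its complement whose
subsystem `g ≤ 0`, `h = 0`, `G_i = 0` (`i ∈ I^G`), `H_i = 0` (`i ∈ I^H`),
`(G_i, H_i) ∈ ℝ × {0}` (`i ∈ P`), `(G_i, H_i) ∈ {0} × ℝ` (`i ∉ P`) is satisfied by `x`,
RCPLD holds at `x` for that subsystem. -/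
def PiecewiseRCPLD : Prop :=
  ∀ C : S.indexGH x → Set (EuclideanSpace ℝ (Fin 2)),
    (∀ i, C i = axisOne ∨ C i = axisTwo) → (∀ i : S.indexGH x, S.pair x i ∈ C i) →
    S.LocalRCPLD x fun i => limitingNormalCone (C i) (S.pair x i)

/-- `x` is an M-stationary point of the problem of minimizing `f` over the feasible set. -/
def MStationary (f : EuclideanSpace ℝ (Fin d) → ℝ) : Prop :=
  x ∈ S.feasible ∧
  ∃ ξ ∈ limitingSubdiff f x, ∃ (lamg : Fin n → ℝ) (lamh : Fin m → ℝ)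
    (η : Fin p → EuclideanSpace ℝ (Fin 2)) (v : Fin n → EuclideanSpace ℝ (Fin d)),
    (∀ i, S.g i x = 0 → 0 ≤ lamg i ∧ v i ∈ limitingSubdiff (S.g i) x) ∧
    (∀ i, η i ∈ limitingNormalCone switchingSet (S.pair x i)) ∧
    ξ + ∑ i with S.g i x = 0, lamg i • v i + ∑ i, lamh i • gradient (S.h i) x +
      ∑ i, (η i 0 • gradient (S.G i) x + η i 1 • gradient (S.H i) x) = 0

/-- The local error bound property of the switching system at `x`. -/
def ErrorBound : Prop :=
  ∃ α ≥ (0 : ℝ), ∃ ε > (0 : ℝ), ∀ y ∈ Metric.ball x ε,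
    Metric.infDist y S.feasible ≤
      α * (‖WithLp.toLp 2 (fun i => max 0 (S.g i y))‖ + ‖WithLp.toLp 2 (fun i => S.h i y)‖ +
        ∑ i, Metric.infDist (S.pair y i) switchingSet)

end SwitchingSystem

end

/-! Away from the origin the cross {yz = 0} is locally a line, so its limiting normals at the origin
are the vectors with a vanishing entry. Such a vector is normal to one of the two axes. A multiplier
relation for the switching system is therefore a relation for one of its pieces, with the piece
chosen according to the multipliers. The four forms of RCPLD thus agree up to reindexing.

For the other two claims each biactive index i is assigned one of the equations G_i = 0, H_i = 0,
which gives finitely many branches. Only equality constraints whose gradients form a basis at the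
reference point are kept. By constant rank the dropped ones vanish automatically nearby
(`eventually_forall_eq_zero_of_constant_rank`), so points of a branch close to the reference point
are feasible. The biactive equations are written as pairs of inequalities. Every branch then has
active Lipschitz inequalities φ ≤ 0 and smooth equations e = 0 with independent gradients, and it
satisfies `RelaxedCPLD` (`LocalRCPLD.relaxedCPLD`).

M-stationarity follows from one branch by quadratic penalization on e = 0. Carathéodory's theorem,
modulo the gradients of e, makes the penalty multipliers reduced. If they are bounded, they converge
to the required multipliers. If not, their normalized limit is a nontrivial relation at x, and
`RelaxedCPLD` contradicts reducedness.

For the error bound, failure yields points z_n → x on e = 0 at which the violation is nearly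
stationary. Their multipliers live on the violated constraints and give a positive relation at x.
Pass to a minimal index set I carrying such a relation. Minimality, `RelaxedCPLD`, convexity of
regular subdifferentials and connectedness of a punctured neighbourhood (a half-line in dimension
one) show that all selections of subgradients near x carry a positive relation on I
(`IsMinimalRel.eventually_forall_isPosRel`). Then the constraints in I cannot all be positive at
nearby points of e = 0 (`IsMinimalRel.eventually_not_forall_pos`). Otherwise there are points y at
which y - x is a combination of subgradients and gradients of e. A mean value inequality and the
positive relations make the limiting direction orthogonal to all of these vectors, hence to itself.
This contradicts the choice of the z_n. At a point y the branch is selected by the smaller of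
|G_i(y)| and |H_i(y)|, which the distance to the cross controls. -/

set_option linter.unusedSectionVars false

/-! ### Elementary calculus of regular and limiting subdifferentials -/

section Subdifferentials

variable {E : Type*} [NormedAddCommGroup E] [InnerProductSpace ℝ E]

theorem tendsto_of_dist_lt_one_div {X : Type*} [PseudoMetricSpace X] {s : ℕ → X} {a : X}
    (hs : ∀ k, dist (s k) a < 1 / ((k : ℝ) + 1)) : Tendsto s atTop (𝓝 a) :=
  tendsto_iff_dist_tendsto_zero.2 (squeeze_zero (fun _ => dist_nonneg)
    (fun k => (hs k).le) tendsto_one_div_add_atTop_nhds_zero_nat)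

/-- `f` is Lipschitz on a neighbourhood of `x`. -/
def LipNear (f : E → ℝ) (x : E) : Prop := ∃ K, ∃ U ∈ 𝓝 x, LipschitzOnWith K f U

theorem LipNear.eventually {f : E → ℝ} {x : E} (hf : LipNear f x) :
    ∀ᶠ y in 𝓝 x, LipNear f y := by
  obtain ⟨K, U, hU, hK⟩ := hf
  filter_upwards [eventually_mem_nhds_iff.2 hU] with y hy
  exact ⟨K, U, hy, hK⟩

theorem LipNear.continuousAt {f : E → ℝ} {x : E} (hf : LipNear f x) : ContinuousAt f x := by
  obtain ⟨K, U, hU, hK⟩ := hf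
  exact hK.continuousOn.continuousAt hU

theorem LocallyLipschitz.lipNear {f : E → ℝ} (hf : LocallyLipschitz f) (x : E) : LipNear f x :=
  hf x

theorem LipNear.const_mul {f : E → ℝ} {x : E} (hf : LipNear f x) (c : ℝ) :
    LipNear (fun y => c * f y) x := by
  obtain ⟨K, U, hU, hK⟩ := hf
  refine ⟨‖c‖₊ * K, U, hU, ?_⟩
  refine LipschitzOnWith.of_dist_le_mul fun y hy z hz => ?_
  have := hK.dist_le_mul y hy z hz
  rw [Real.dist_eq] at this ⊢
  rw [← mul_sub, abs_mul]
  push_cast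
  rw [mul_assoc]
  exact mul_le_mul_of_nonneg_left this (abs_nonneg c)

theorem LipNear.neg {f : E → ℝ} {x : E} (hf : LipNear f x) : LipNear (fun y => -f y) x := by
  simpa using hf.const_mul (-1)

theorem tendsto_add_smul_nhdsGT (x w : E) :
    Tendsto (fun t : ℝ => x + t • w) (𝓝[>] 0) (𝓝 x) := by
  have : Tendsto (fun t : ℝ => x + t • w) (𝓝 0) (𝓝 (x + (0 : ℝ) • w)) :=
    Continuous.tendsto (by fun_prop) 0
  simp only [zero_smul, add_zero] at this
  exact this.mono_left nhdsWithin_le_nhds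

/-- Testing the subgradient inequality along the direction ξ itself gives t‖ξ‖² ≤ t‖ξ‖(K + ε) for
some t > 0. -/
theorem norm_le_of_mem_regularSubdiff {f : E → ℝ} {x ξ : E} {K : NNReal} {U : Set E}
    (hU : U ∈ 𝓝 x) (hK : LipschitzOnWith K f U) (hξ : ξ ∈ regularSubdiff f x) : ‖ξ‖ ≤ K := by
  by_cases h0 : ξ = 0
  · simp [h0]
  have hpos : 0 < ‖ξ‖ := norm_pos_iff.2 h0
  refine le_of_forall_pos_le_add fun ε hε => ?_
  have h1 := (tendsto_add_smul_nhdsGT x ξ).eventually ((hξ ε hε).and hU)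
  obtain ⟨t, ⟨ht1, ht2⟩, ht0⟩ := (h1.and self_mem_nhdsWithin).exists
  have ht0 : 0 < t := ht0
  have h2 := hK.dist_le_mul _ ht2 x (mem_of_mem_nhds hU)
  rw [Real.dist_eq, dist_eq_norm] at h2
  have h3 := le_of_abs_le h2
  simp only [add_sub_cancel_left, norm_smul, inner_smul_right, real_inner_self_eq_norm_sq,
    Real.norm_eq_abs, abs_of_pos ht0] at ht1 h3
  have : t * ‖ξ‖ * ‖ξ‖ ≤ t * ‖ξ‖ * (K + ε) := by nlinarith
  exact le_of_mul_le_mul_left this (by positivity)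

theorem regularSubdiff_of_quadratic {f : E → ℝ} {x ξ : E} (C : ℝ)
    (h : ∀ᶠ y in 𝓝 x, inner ℝ ξ (y - x) - C * ‖y - x‖ ^ 2 ≤ f y - f x) :
    ξ ∈ regularSubdiff f x := by
  intro ε hε
  have hc : Tendsto (fun y => C * ‖y - x‖) (𝓝 x) (𝓝 0) := by
    have : Continuous fun y : E => C * ‖y - x‖ := by fun_prop
    simpa using this.tendsto x
  filter_upwards [h, hc.eventually (gt_mem_nhds hε)] with y hy1 hy2
  have h2 : C * ‖y - x‖ ^ 2 ≤ ε * ‖y - x‖ := by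
    rw [pow_two, ← mul_assoc]
    exact mul_le_mul_of_nonneg_right hy2.le (norm_nonneg _)
  linarith

theorem regularSubdiff_add {f g : E → ℝ} {x ξ ζ : E} (hf : ξ ∈ regularSubdiff f x)
    (hg : ζ ∈ regularSubdiff g x) : ξ + ζ ∈ regularSubdiff (fun y => f y + g y) x := by
  intro ε hε
  filter_upwards [hf (ε / 2) (by positivity), hg (ε / 2) (by positivity)] with y h1 h2
  rw [inner_add_left]
  linarith

theorem regularSubdiff_const_mul {f : E → ℝ} {x ξ : E} {c : ℝ} (hc : 0 < c)
    (h : ξ ∈ regularSubdiff f x) : c • ξ ∈ regularSubdiff (fun y => c * f y) x := by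
  intro ε hε
  filter_upwards [h (ε / c) (by positivity)] with y hy
  rw [real_inner_smul_left]
  have := mul_le_mul_of_nonneg_left hy hc.le
  have h2 : c * -(ε / c * ‖y - x‖) = -(ε * ‖y - x‖) := by field_simp
  linarith

theorem eq_zero_of_mem_regularSubdiff_const {a : ℝ} {x ξ : E}
    (h : ξ ∈ regularSubdiff (fun _ => a) x) : ξ = 0 := by
  have := norm_le_of_mem_regularSubdiff (K := 0) univ_mem
    (LipschitzWith.const a).lipschitzOnWith h
  simpa using this

/-- The sum of the two is a regular subgradient of the zero function. -/
theorem regularSubdiff_neg_unique {f : E → ℝ} {x ξ ζ : E} (hf : ξ ∈ regularSubdiff f x)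
    (hg : ζ ∈ regularSubdiff (fun y => -f y) x) : ζ = -ξ := by
  have := regularSubdiff_add hf hg
  simp only [add_neg_cancel] at this
  exact eq_neg_of_add_eq_zero_right (eq_zero_of_mem_regularSubdiff_const this)

theorem convex_regularSubdiff (f : E → ℝ) (x : E) : Convex ℝ (regularSubdiff f x) := by
  intro ξ hξ ζ hζ a b ha hb hab ε hε
  filter_upwards [hξ ε hε, hζ ε hε] with y h1 h2
  rw [inner_add_left, real_inner_smul_left, real_inner_smul_left]
  have h3 := mul_le_mul_of_nonneg_left h1 ha
  have h4 := mul_le_mul_of_nonneg_left h2 hb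
  have hb' : b = 1 - a := by linarith
  subst hb'
  nlinarith

theorem mem_limitingSubdiff_iff {f : E → ℝ} {x ξ : E} :
    ξ ∈ limitingSubdiff f x ↔ ∀ ε > 0, ∃ y w, w ∈ regularSubdiff f y ∧ dist y x < ε ∧
      dist (f y) (f x) < ε ∧ dist w ξ < ε := by
  constructor
  · rintro ⟨y, w, h1, h2, h3, h4⟩ ε hε
    obtain ⟨k, hk1, hk2, hk3⟩ := ((Metric.tendsto_nhds.1 h2 ε hε).and
      ((Metric.tendsto_nhds.1 h3 ε hε).and (Metric.tendsto_nhds.1 h4 ε hε))).exists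
    exact ⟨y k, w k, h1 k, hk1, hk2, hk3⟩
  · intro h
    choose y w h1 h2 h3 h4 using fun k : ℕ => h (1 / ((k : ℝ) + 1)) (by positivity)
    exact ⟨y, w, h1, tendsto_of_dist_lt_one_div h2, tendsto_of_dist_lt_one_div h3,
      tendsto_of_dist_lt_one_div h4⟩

theorem regularSubdiff_subset_limitingSubdiff (f : E → ℝ) (x : E) :
    regularSubdiff f x ⊆ limitingSubdiff f x := fun ξ hξ =>
  mem_limitingSubdiff_iff.2 fun ε hε => ⟨x, ξ, hξ, by simpa, by simpa, by simpa⟩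

/-- A diagonal argument. Arbitrary filters are allowed because later limits run along ultrafilters.
-/
theorem limitingSubdiff_closed {ι : Type*} {F : Filter ι} [F.NeBot] {f : E → ℝ} {x ξ : E}
    {y w : ι → E} (hw : ∀ᶠ t in F, w t ∈ limitingSubdiff f (y t)) (hy : Tendsto y F (𝓝 x))
    (hξ : Tendsto w F (𝓝 ξ)) (hf : ContinuousAt f x) : ξ ∈ limitingSubdiff f x := by
  refine mem_limitingSubdiff_iff.2 fun ε hε => ?_
  obtain ⟨t, h1, h2, h3, h4⟩ := (hw.and ((Metric.tendsto_nhds.1 hy (ε / 2) (by positivity)).and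
    ((Metric.tendsto_nhds.1 hξ (ε / 2) (by positivity)).and
      (Metric.tendsto_nhds.1 (hf.tendsto.comp hy) (ε / 2) (by positivity))))).exists
  obtain ⟨y', w', k1, k2, k3, k4⟩ := mem_limitingSubdiff_iff.1 h1 (ε / 2) (by positivity)
  refine ⟨y', w', k1, ?_, ?_, ?_⟩
  · linarith [dist_triangle y' (y t) x]
  · have := dist_triangle (f y') (f (y t)) (f x)
    simp only [Function.comp] at h4
    linarith
  · linarith [dist_triangle w' (w t) ξ]

theorem norm_le_of_mem_limitingSubdiff {f : E → ℝ} {x ξ : E} {K : NNReal} {U : Set E}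
    (hU : U ∈ 𝓝 x) (hK : LipschitzOnWith K f U) (hξ : ξ ∈ limitingSubdiff f x) : ‖ξ‖ ≤ K := by
  obtain ⟨y, w, h1, h2, -, h4⟩ := hξ
  refine le_of_tendsto h4.norm ?_
  filter_upwards [h2.eventually (eventually_mem_nhds_iff.2 hU)] with k hk
  exact norm_le_of_mem_regularSubdiff hk hK (h1 k)

theorem LipNear.exists_bound {f : E → ℝ} {x : E} (hf : LipNear f x) :
    ∃ K : ℝ, ∀ᶠ y in 𝓝 x, ∀ ξ ∈ limitingSubdiff f y, ‖ξ‖ ≤ K := by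
  obtain ⟨K, U, hU, hK⟩ := hf
  refine ⟨K, ?_⟩
  filter_upwards [eventually_mem_nhds_iff.2 hU] with y hy ξ hξ
  exact norm_le_of_mem_limitingSubdiff hy hK hξ

/-- The subgradient inequality divided by ‖y t - x‖: regular subgradients stay below limits of
difference quotients even when y t approaches x along a curve. -/
theorem inner_le_of_mem_regularSubdiff {ι : Type*} {F : Filter ι} [F.NeBot] {f : E → ℝ}
    {x v u : E} {D : ℝ} {y : ι → E} (hv : v ∈ regularSubdiff f x) (hy : Tendsto y F (𝓝 x))
    (hne : ∀ᶠ t in F, y t ≠ x)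
    (hu : Tendsto (fun t => ‖y t - x‖⁻¹ • (y t - x)) F (𝓝 u))
    (hD : Tendsto (fun t => (f (y t) - f x) / ‖y t - x‖) F (𝓝 D)) : inner ℝ v u ≤ D := by
  refine le_of_forall_pos_le_add fun ε hε => ?_
  have h1 : Tendsto (fun t => inner ℝ v (‖y t - x‖⁻¹ • (y t - x))) F (𝓝 (inner ℝ v u)) :=
    tendsto_const_nhds.inner hu
  refine le_of_tendsto_of_tendsto h1 (hD.add_const ε) ?_
  filter_upwards [hy.eventually (hv ε hε), hne] with t ht hne
  have hpos : 0 < ‖y t - x‖ := norm_pos_iff.2 (sub_ne_zero.2 hne)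
  rw [inner_smul_right, inv_mul_eq_div, div_add' _ _ _ hpos.ne']
  gcongr
  linarith

section Gradient

variable [CompleteSpace E]

theorem HasGradientAt.mem_regularSubdiff {f : E → ℝ} {x ξ : E} (h : HasGradientAt f ξ x) :
    ξ ∈ regularSubdiff f x := by
  intro ε hε
  have := (hasGradientAt_iff_hasFDerivAt.1 h).isLittleO.def hε
  filter_upwards [this] with y hy
  have := neg_le_of_abs_le hy
  simpa using this

theorem HasGradientAt.neg' {f : E → ℝ} {x ξ : E} (h : HasGradientAt f ξ x) :
    HasGradientAt (fun y => -f y) (-ξ) x := by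
  rw [hasGradientAt_iff_hasFDerivAt] at h ⊢
  have := h.fun_neg
  simpa using this

theorem regularSubdiff_eq_of_hasGradientAt {f : E → ℝ} {x ξ : E} (h : HasGradientAt f ξ x) :
    regularSubdiff f x = {ξ} := by
  refine Set.Subset.antisymm (fun ζ hζ => ?_) (by simpa using h.mem_regularSubdiff)
  have := regularSubdiff_neg_unique hζ h.neg'.mem_regularSubdiff
  simpa using this.symm

theorem ContDiff.hasGradientAt {f : E → ℝ} (h : ContDiff ℝ 1 f) (x : E) :
    HasGradientAt f (gradient f x) x :=
  ((h.differentiable (by simp)) x).hasGradientAt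

theorem ContDiff.continuous_gradient {f : E → ℝ} (h : ContDiff ℝ 1 f) :
    Continuous (gradient f) :=
  (InnerProductSpace.toDual ℝ E).symm.continuous.comp (h.continuous_fderiv (by simp))

theorem ContDiff.regularSubdiff_eq {f : E → ℝ} (h : ContDiff ℝ 1 f) (x : E) :
    regularSubdiff f x = {gradient f x} :=
  regularSubdiff_eq_of_hasGradientAt (h.hasGradientAt x)

theorem ContDiff.limitingSubdiff_eq {f : E → ℝ} (h : ContDiff ℝ 1 f) (x : E) :
    limitingSubdiff f x = {gradient f x} := by
  refine Set.Subset.antisymm ?_ ?_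
  · rintro ξ ⟨y, w, h1, h2, -, h4⟩
    have : w = fun k => gradient f (y k) := by
      funext k
      have := h1 k
      rw [h.regularSubdiff_eq] at this
      exact this
    subst this
    exact tendsto_nhds_unique h4 ((h.continuous_gradient.tendsto x).comp h2)
  · rw [← h.regularSubdiff_eq]
    exact regularSubdiff_subset_limitingSubdiff f x

theorem ContDiff.subdiffRegularAt {f : E → ℝ} (h : ContDiff ℝ 1 f) (x : E) :
    SubdiffRegularAt f x := by
  rw [SubdiffRegularAt, h.limitingSubdiff_eq, h.regularSubdiff_eq]

theorem gradient_neg' {f : E → ℝ} (h : ContDiff ℝ 1 f) (x : E) :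
    gradient (fun y => -f y) x = -gradient f x :=
  (h.hasGradientAt x).neg'.gradient

theorem ContDiff.lipNear {f : E → ℝ} (h : ContDiff ℝ 1 f) (x : E) : LipNear f x :=
  h.locallyLipschitz.lipNear x

end Gradient

end Subdifferentials

/-! ### Limits along ultrafilters -/

section UltrafilterLimits

/-- This replaces the extraction of subsequences: along an ultrafilter every bounded family in a
proper space converges, so several limits can be taken at once. -/
theorem Ultrafilter.exists_tendsto_of_bounded {ι X : Type*} [PseudoMetricSpace X] [ProperSpace X]
    (U : Ultrafilter ι) {s : ι → X} {a : X} {R : ℝ} (h : ∀ᶠ t in U, dist (s t) a ≤ R) :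
    ∃ l, Tendsto s U (𝓝 l) := by
  obtain ⟨l, -, hl⟩ := (isCompact_closedBall a R).ultrafilter_le_nhds (U.map s) (by
    rw [Filter.le_principal_iff]
    exact h)
  exact ⟨l, hl⟩

theorem Ultrafilter.exists_eventually_eq {ι α : Type*} [Finite α] (U : Ultrafilter ι)
    (s : ι → α) : ∃ a, ∀ᶠ t in U, s t = a := by
  have : (⋃ a : α, {t | s t = a}) ∈ U := by
    have : (⋃ a : α, {t | s t = a}) = Set.univ := by ext t; simp
    rw [this]
    exact Filter.univ_mem
  have h2 := (Ultrafilter.finite_biUnion_mem_iff (f := U) (is := Set.univ)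
    (s := fun a : α => {t | s t = a}) Set.finite_univ).1 (by simpa using this)
  obtain ⟨a, -, ha⟩ := h2
  exact ⟨a, ha⟩

end UltrafilterLimits

/-! ### Stability of linear independence and closedness of moving spans -/

section LinearAlgebra

variable {E : Type*} [NormedAddCommGroup E] [InnerProductSpace ℝ E]
  {κ : Type*} [Fintype κ]

/-- An injective linear map on a finite-dimensional space is bounded below, here by 1 / K. Moving
the vectors by less than 1 / (2K) in total costs at most half of this constant. -/
theorem LinearIndependent.exists_lower_bound {w : κ → E} (hw : LinearIndependent ℝ w) :
    ∃ c > (0 : ℝ), ∀ᶠ w' in 𝓝 w, ∀ β : κ → ℝ, c * ‖β‖ ≤ ‖∑ i, β i • w' i‖ := by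
  classical
  let T : (κ → ℝ) →ₗ[ℝ] E := Fintype.linearCombination ℝ w
  have hT : LinearMap.ker T = ⊥ := by
    rw [LinearMap.ker_eq_bot]
    exact hw.fintypeLinearCombination_injective
  obtain ⟨K, hK, hTK⟩ := T.exists_antilipschitzWith hT
  have hKpos : (0 : ℝ) < K := hK
  have hlow : ∀ β : κ → ℝ, ‖β‖ ≤ K * ‖∑ i, β i • w i‖ := fun β => by
    have := hTK.le_mul_dist β 0
    simpa [T, Fintype.linearCombination_apply] using this
  refine ⟨1 / (2 * K), by positivity, ?_⟩
  have hcont : Tendsto (fun w' : κ → E => ∑ i, ‖w' i - w i‖) (𝓝 w) (𝓝 0) := by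
    have : Continuous fun w' : κ → E => ∑ i, ‖w' i - w i‖ := by fun_prop
    simpa using this.tendsto w
  filter_upwards [hcont.eventually (gt_mem_nhds (show (0 : ℝ) < 1 / (2 * K) by positivity))]
    with w' hw' β
  have h1 : ‖∑ i, β i • w i‖ ≤ ‖∑ i, β i • w' i‖ + ‖β‖ * (1 / (2 * K)) := by
    have h2 : ∑ i, β i • w i = ∑ i, β i • w' i - ∑ i, β i • (w' i - w i) := by
      rw [← Finset.sum_sub_distrib]
      exact Finset.sum_congr rfl fun i _ => by rw [← smul_sub]; congr 1; abel
    have h3 : ‖∑ i, β i • (w' i - w i)‖ ≤ ‖β‖ * (1 / (2 * K)) := by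
      refine (norm_sum_le _ _).trans ?_
      refine le_trans ?_ (mul_le_mul_of_nonneg_left hw'.le (norm_nonneg β))
      rw [Finset.mul_sum]
      refine Finset.sum_le_sum fun i _ => ?_
      rw [norm_smul]
      exact mul_le_mul_of_nonneg_right (norm_le_pi_norm β i) (norm_nonneg _)
    rw [h2]
    exact (norm_sub_le _ _).trans (by linarith)
  have h4 := hlow β
  have h5 : K * ‖∑ i, β i • w i‖ ≤ K * (‖∑ i, β i • w' i‖ + ‖β‖ * (1 / (2 * K))) :=
    mul_le_mul_of_nonneg_left h1 hKpos.le
  have h6 : (K : ℝ) * (‖β‖ * (1 / (2 * K))) = ‖β‖ / 2 := by field_simp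
  rw [div_mul_eq_mul_div, one_mul, div_le_iff₀ (by positivity)]
  nlinarith

/-- Coefficients of a convergent combination of vectors with linearly independent limits
converge. -/
theorem LinearIndependent.exists_tendsto_coeff {ι : Type*} (U : Ultrafilter ι) {w : κ → E}
    (hw : LinearIndependent ℝ w) {w' : ι → κ → E} (hw' : Tendsto w' U (𝓝 w))
    {β : ι → κ → ℝ} {R : ℝ} (hR : ∀ᶠ t in U, ‖∑ i, β t i • w' t i‖ ≤ R) :
    ∃ b : κ → ℝ, Tendsto β U (𝓝 b) := by
  obtain ⟨c, hc, h⟩ := hw.exists_lower_bound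
  refine U.exists_tendsto_of_bounded (a := 0) (R := R / c) ?_
  filter_upwards [hw'.eventually h, hR] with t h1 h2
  rw [dist_zero_right, le_div_iff₀ hc, mul_comm]
  exact (h1 _).trans h2

theorem tendsto_sum_smul {ι : Type*} {F : Filter ι} {w : κ → E} {w' : ι → κ → E}
    (hw' : Tendsto w' F (𝓝 w)) {β : ι → κ → ℝ} {b : κ → ℝ} (hβ : Tendsto β F (𝓝 b)) :
    Tendsto (fun t => ∑ i, β t i • w' t i) F (𝓝 (∑ i, b i • w i)) :=
  tendsto_finsetSum _ fun i _ => (tendsto_pi_nhds.1 hβ i).smul (tendsto_pi_nhds.1 hw' i)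

theorem mem_span_range_iff_exists_fintype_sum {w : κ → E} {x : E} :
    x ∈ Submodule.span ℝ (Set.range w) ↔ ∃ β : κ → ℝ, ∑ i, β i • w i = x :=
  Submodule.mem_span_range_iff_exists_fun ℝ

/-- Independence of the limit vectors keeps the coefficients bounded. Without it a limit of elements
of the moving spans could leave the span of the limits. -/
theorem LinearIndependent.mem_span_of_tendsto {ι : Type*} (U : Ultrafilter ι) {w : κ → E}
    (hw : LinearIndependent ℝ w) {w' : ι → κ → E} (hw' : Tendsto w' U (𝓝 w))
    {s : ι → E} {a : E} (hs : Tendsto s U (𝓝 a))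
    (h : ∀ᶠ t in U, s t ∈ Submodule.span ℝ (Set.range (w' t))) :
    a ∈ Submodule.span ℝ (Set.range w) := by
  classical
  have h' : ∀ t, ∃ β : κ → ℝ, s t ∈ Submodule.span ℝ (Set.range (w' t)) →
      ∑ i, β i • w' t i = s t := fun t => by
    by_cases ht : s t ∈ Submodule.span ℝ (Set.range (w' t))
    · obtain ⟨β, hβ⟩ := mem_span_range_iff_exists_fintype_sum.1 ht
      exact ⟨β, fun _ => hβ⟩
    · exact ⟨0, fun h => absurd h ht⟩
  choose β hβ using h'
  have hev : ∀ᶠ t in U, ∑ i, β t i • w' t i = s t := h.mono fun t => hβ t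
  have hbd : ∀ᶠ t in U, ‖∑ i, β t i • w' t i‖ ≤ ‖a‖ + 1 := by
    filter_upwards [hev, hs.norm.eventually (gt_mem_nhds (lt_add_one ‖a‖))] with t h1 h2
    rw [h1]
    exact h2.le
  obtain ⟨b, hb⟩ := hw.exists_tendsto_coeff U hw' hbd
  refine mem_span_range_iff_exists_fintype_sum.2 ⟨b, ?_⟩
  exact tendsto_nhds_unique ((tendsto_sum_smul hw' hb).congr' hev) hs

end LinearAlgebra

/-! ### A multiplier rule by decoupling and penalization -/

section MultiplierRule

variable {E : Type*} [NormedAddCommGroup E] [InnerProductSpace ℝ E]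

/-- Expanding ‖y - w‖² about u turns minimality into a lower bound on f y - f u with a quadratic
error. -/
theorem mem_regularSubdiff_of_isLocalMin_add_sq {f : E → ℝ} {u w : E} {N : ℝ}
    (h : ∀ᶠ y in 𝓝 u, f u + N * ‖u - w‖ ^ 2 ≤ f y + N * ‖y - w‖ ^ 2) :
    -((2 * N) • (u - w)) ∈ regularSubdiff f u := by
  refine regularSubdiff_of_quadratic N ?_
  filter_upwards [h] with y hy
  have : ‖y - w‖ ^ 2 = ‖u - w‖ ^ 2 + 2 * inner ℝ (u - w) (y - u) + ‖y - u‖ ^ 2 := by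
    rw [← norm_add_sq_real]
    congr 2
    abel
  rw [inner_neg_left, real_inner_smul_left]
  rw [this] at hy
  linarith

variable [CompleteSpace E] {B J : Type*} [Fintype B] [Fintype J]

theorem sum_gradient_eq_zero_of_isLocalMin {u : B → E} {e : J → E → ℝ} {w z ζ : E} {K N : ℝ}
    (he : ∀ j, ContDiff ℝ 1 (e j))
    (h : IsLocalMin (fun y => inner ℝ ζ y + K * ‖y - z‖ ^ 2 + N * ∑ b, ‖u b - y‖ ^ 2 +
      N * ∑ j, e j y ^ 2) w) :
    ∑ b, -((2 * N) • (u b - w)) + (ζ + (2 * K) • (w - z)) +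
      ∑ j, (2 * N * e j w) • gradient (e j) w = 0 := by
  have h1 : HasFDerivAt (fun y : E => inner ℝ ζ y) (innerSL ℝ ζ) w :=
    (innerSL ℝ ζ).hasFDerivAt
  have h2 := (((hasFDerivAt_id w).sub_const z).norm_sq).const_mul K
  have h3 : ∀ b, HasFDerivAt (fun y => ‖u b - y‖ ^ 2) _ w := fun b =>
    ((hasFDerivAt_id w).const_sub (u b)).norm_sq
  have h3' := (HasFDerivAt.fun_sum (u := Finset.univ) fun b _ => h3 b).const_mul N
  have h4 : ∀ j, HasFDerivAt (fun y => e j y ^ 2) _ w := fun j =>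
    ((hasGradientAt_iff_hasFDerivAt.1 ((he j).hasGradientAt w)).pow 2)
  have h4' := (HasFDerivAt.fun_sum (u := Finset.univ) fun j _ => h4 j).const_mul N
  have h5 := h.hasFDerivAt_eq_zero (((h1.fun_add h2).fun_add h3').fun_add h4')
  refine ext_inner_right ℝ fun v => ?_
  have h6 := congrArg (fun L => L v) h5
  simp only [add_apply, smul_apply,
    sum_apply, ContinuousLinearMap.comp_apply,
    innerSL_apply_apply, id, smul_eq_mul, nsmul_eq_mul,
    neg_apply, ContinuousLinearMap.id_apply,
    InnerProductSpace.toDual_apply_apply, inner_neg_right, zero_apply] at h6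
  simp only [inner_add_left, sum_inner, real_inner_smul_left, inner_neg_left, inner_zero_left]
  rw [← h6]
  simp only [Finset.mul_sum]
  congr 1
  · rw [add_comm, add_assoc, add_assoc]
    congr 1
    congr 1
    · ring
    · refine Finset.sum_congr rfl fun b _ => ?_
      push_cast
      ring
  · refine Finset.sum_congr rfl fun j _ => ?_
    push_cast
    ring

/-- The terms of the other blocks are unchanged and cancel. -/
theorem sum_update_le {u : B → E} [DecidableEq B] {ψ : B → E → ℝ} {w : E} {N : ℝ} (b : B) (y : E)
    (h : ∑ b, ψ b (u b) + N * ∑ b, ‖u b - w‖ ^ 2 ≤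
      ∑ b', ψ b' (Function.update u b y b') + N * ∑ b', ‖Function.update u b y b' - w‖ ^ 2) :
    ψ b (u b) + N * ‖u b - w‖ ^ 2 ≤ ψ b y + N * ‖y - w‖ ^ 2 := by
  have key : ∀ F : B → E → ℝ, ∑ b', F b' (Function.update u b y b') =
      F b y + ∑ b' ∈ Finset.univ.erase b, F b' (u b') := fun F => by
    rw [← Finset.add_sum_erase _ _ (Finset.mem_univ b)]
    congr 1
    · simp
    · exact Finset.sum_congr rfl fun b' hb' => by
        rw [Function.update_of_ne (Finset.ne_of_mem_erase hb')]
  rw [key ψ, key fun _ v => ‖v - w‖ ^ 2, ← Finset.add_sum_erase _ _ (Finset.mem_univ b),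
    ← Finset.add_sum_erase _ (fun b => ‖u b - w‖ ^ 2) (Finset.mem_univ b)] at h
  linarith

variable [FiniteDimensional ℝ E]

/-- The penalized decoupled problem has minimizers that converge to `z`. -/
theorem exists_decoupled_minimizers {ψ : B → E → ℝ} {e : J → E → ℝ} {z ζ : E} {K δ : ℝ}
    (hδ : 0 ≤ δ)
    (hψ : ∀ b, ContinuousOn (ψ b) (Metric.closedBall z δ)) (he : ∀ j, Continuous (e j))
    (hez : ∀ j, e j z = 0)
    (hmin : ∀ y ∈ Metric.closedBall z δ, (∀ j, e j y = 0) → ∑ b, ψ b z + inner ℝ ζ z ≤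
      ∑ b, ψ b y + inner ℝ ζ y + K * ‖y - z‖ ^ 2) :
    ∃ (u : ℕ → B → E) (w : ℕ → E), Tendsto u (hyperfilter ℕ) (𝓝 fun _ => z) ∧
      Tendsto w (hyperfilter ℕ) (𝓝 z) ∧ ∀ N : ℕ,
      IsMinOn (fun p : (B → E) × E => ∑ b, ψ b (p.1 b) + inner ℝ ζ p.2 + (K + 1) * ‖p.2 - z‖ ^ 2 +
        N * ∑ b, ‖p.1 b - p.2‖ ^ 2 + N * ∑ j, e j p.2 ^ 2)
        ((Set.univ.pi fun _ => Metric.closedBall z δ) ×ˢ Metric.closedBall z δ) (u N, w N) := by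
  set C : Set ((B → E) × E) :=
    (Set.univ.pi fun _ => Metric.closedBall z δ) ×ˢ Metric.closedBall z δ with hC
  have hCc : IsCompact C :=
    (isCompact_univ_pi fun _ => isCompact_closedBall z δ).prod (isCompact_closedBall z δ)
  have hzC : ((fun _ => z, z) : (B → E) × E) ∈ C := by simp [hC, hδ]
  have hS : ContinuousOn (fun p : (B → E) × E => ∑ b, ψ b (p.1 b)) C :=
    continuousOn_finsetSum _ fun b _ => (hψ b).comp (by fun_prop) fun p hp => by
      exact hp.1 b (Set.mem_univ b)
  have hA : ContinuousOn (fun p : (B → E) × E =>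
      ∑ b, ψ b (p.1 b) + inner ℝ ζ p.2 + (K + 1) * ‖p.2 - z‖ ^ 2) C :=
    (hS.add (Continuous.continuousOn (by fun_prop))).add (Continuous.continuousOn (by fun_prop))
  have hQ : Continuous fun p : (B → E) × E => ∑ b, ‖p.1 b - p.2‖ ^ 2 + ∑ j, e j p.2 ^ 2 := by
    have : ∀ j, Continuous fun p : (B → E) × E => e j p.2 := fun j => (he j).comp continuous_snd
    fun_prop
  have hex : ∀ N : ℕ, ∃ p ∈ C, IsMinOn (fun p : (B → E) × E =>
      ∑ b, ψ b (p.1 b) + inner ℝ ζ p.2 + (K + 1) * ‖p.2 - z‖ ^ 2 +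
        N * ∑ b, ‖p.1 b - p.2‖ ^ 2 + N * ∑ j, e j p.2 ^ 2) C p := fun N => by
    refine hCc.exists_isMinOn ⟨_, hzC⟩ ?_
    have := hA.add ((continuous_const (y := (N : ℝ))).mul hQ).continuousOn
    refine this.congr fun p _ => ?_
    simp only [Pi.add_apply, Pi.mul_apply]
    ring
  choose p hpC hp using hex
  obtain ⟨q, hqC, hq⟩ := hCc.ultrafilter_le_nhds ((hyperfilter ℕ).map p) (by
    rw [Filter.le_principal_iff]
    exact Filter.Eventually.of_forall (f := (hyperfilter ℕ : Filter ℕ)) hpC)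
  have hq : Tendsto p (hyperfilter ℕ) (𝓝 q) := hq
  have hqin : Tendsto p (hyperfilter ℕ) (𝓝[C] q) :=
    tendsto_nhdsWithin_iff.2 ⟨hq, Filter.Eventually.of_forall hpC⟩
  have hlimA := (hA q hqC).tendsto.comp hqin
  have hlimQ := (hQ.tendsto q).comp hq
  have hle : ∀ N : ℕ, (∑ b, ψ b ((p N).1 b) + inner ℝ ζ (p N).2 + (K + 1) * ‖(p N).2 - z‖ ^ 2) +
      N * (∑ b, ‖(p N).1 b - (p N).2‖ ^ 2 + ∑ j, e j (p N).2 ^ 2) ≤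
      ∑ b, ψ b z + inner ℝ ζ z := fun N => by
    have := hp N hzC
    simp [hez] at this
    linarith
  have hQnn : ∀ p : (B → E) × E, 0 ≤ ∑ b, ‖p.1 b - p.2‖ ^ 2 + ∑ j, e j p.2 ^ 2 := fun p => by
    positivity
  -- Comparison with the feasible point whose components all equal z, where the penalty vanishes.
  have hAq : ∑ b, ψ b (q.1 b) + inner ℝ ζ q.2 + (K + 1) * ‖q.2 - z‖ ^ 2 ≤
      ∑ b, ψ b z + inner ℝ ζ z := by
    refine le_of_tendsto hlimA (Filter.Eventually.of_forall fun N => ?_)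
    have := mul_nonneg (Nat.cast_nonneg (α := ℝ) N) (hQnn (p N))
    simp only [Function.comp]
    linarith [hle N]
  -- By `hle` the penalty at p N is at most 1 / N times a convergent quantity.
  have hQq : ∑ b, ‖q.1 b - q.2‖ ^ 2 + ∑ j, e j q.2 ^ 2 = 0 := by
    refine le_antisymm ?_ (hQnn q)
    have hN : Tendsto (fun N : ℕ => (N : ℝ)⁻¹) (hyperfilter ℕ) (𝓝 0) :=
      (tendsto_inv_atTop_nhds_zero_nat (𝕜 := ℝ)).mono_left Nat.hyperfilter_le_atTop
    have := hN.mul ((tendsto_const_nhds (x := ∑ b, ψ b z + inner ℝ ζ z)).sub hlimA)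
    rw [zero_mul] at this
    refine le_of_tendsto_of_tendsto hlimQ this ?_
    filter_upwards [(eventually_gt_atTop 0).filter_mono Nat.hyperfilter_le_atTop] with N hN
    have hN' : (0 : ℝ) < N := by exact_mod_cast hN
    simp only [Function.comp]
    rw [inv_mul_eq_div, le_div_iff₀ hN']
    linarith [hle N]
  have hsplit := (add_eq_zero_iff_of_nonneg (by positivity) (by positivity)).1 hQq
  have hu : ∀ b, q.1 b = q.2 := fun b => by
    have := (Finset.sum_eq_zero_iff_of_nonneg fun b _ => by positivity).1 hsplit.1 b
      (Finset.mem_univ b)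
    simpa [sub_eq_zero] using this
  have he0 : ∀ j, e j q.2 = 0 := fun j => by
    have := (Finset.sum_eq_zero_iff_of_nonneg fun j _ => by positivity).1 hsplit.2 j
      (Finset.mem_univ j)
    simpa using this
  -- The limit has equal components and satisfies e = 0, so `hmin` applies. The surplus 1 in K + 1
  -- leaves ‖q.2 - z‖² ≤ 0.
  have hqz : q.2 = z := by
    have h1 := hmin q.2 hqC.2 he0
    simp only [hu] at hAq
    have h2 : ‖q.2 - z‖ ^ 2 ≤ 0 := by linarith
    have h3 : ‖q.2 - z‖ = 0 := by nlinarith [norm_nonneg (q.2 - z)]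
    exact sub_eq_zero.1 (norm_eq_zero.1 h3)
  have hq' : q = (fun _ => z, z) := Prod.ext (funext fun b => (hu b).trans hqz) hqz
  rw [hq'] at hq
  exact ⟨fun N => (p N).1, fun N => (p N).2, (continuous_fst.tendsto _).comp hq,
    (continuous_snd.tendsto _).comp hq, fun N => hp N⟩

/-- A Lagrange multiplier rule: minimization of a sum of locally Lipschitz functions and a
quadratic term under smooth equality constraints with linearly independent gradients. -/
theorem exists_multipliers_of_isLocalMinOn {ψ : B → E → ℝ} {e : J → E → ℝ} {z ζ : E} {K : ℝ}
    (hψ : ∀ b, LipNear (ψ b) z) (he : ∀ j, ContDiff ℝ 1 (e j)) (hez : ∀ j, e j z = 0)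
    (hli : LinearIndependent ℝ fun j => gradient (e j) z)
    (hmin : ∀ᶠ y in 𝓝 z, (∀ j, e j y = 0) → ∑ b, ψ b z + inner ℝ ζ z ≤
      ∑ b, ψ b y + inner ℝ ζ y + K * ‖y - z‖ ^ 2) :
    ∃ ξ : B → E, (∀ b, ξ b ∈ limitingSubdiff (ψ b) z) ∧
      ∑ b, ξ b + ζ ∈ Submodule.span ℝ (Set.range fun j => gradient (e j) z) := by
  classical
  have hcont : ∀ᶠ y in 𝓝 z, ∀ b, ContinuousAt (ψ b) y := eventually_all.2 fun b =>
    (hψ b).eventually.mono fun y hy => hy.continuousAt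
  obtain ⟨δ, hδ, hδball⟩ := Metric.nhds_basis_closedBall.eventually_iff.1 (hmin.and hcont)
  obtain ⟨u, w, hu, hw, huw⟩ := exists_decoupled_minimizers hδ.le
    (fun b y hy => ((hδball hy).2 b).continuousWithinAt) (fun j => (he j).continuous) hez
    (fun y hy => (hδball hy).1)
  have hu' : ∀ b, Tendsto (fun N => u N b) (hyperfilter ℕ) (𝓝 z) := tendsto_pi_nhds.1 hu
  have hin : ∀ᶠ N in hyperfilter ℕ, w N ∈ Metric.ball z δ ∧ ∀ b, u N b ∈ Metric.ball z δ :=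
    (hw.eventually (Metric.ball_mem_nhds z hδ)).and
      (eventually_all.2 fun b => (hu' b).eventually (Metric.ball_mem_nhds z hδ))
  -- Partial minimality in the block u b alone; partial minimality in w is used in `hstat`.
  have hsub : ∀ᶠ N in hyperfilter ℕ, ∀ b,
      -((2 * (N : ℝ)) • (u N b - w N)) ∈ regularSubdiff (ψ b) (u N b) := by
    filter_upwards [hin] with N hN b
    refine mem_regularSubdiff_of_isLocalMin_add_sq ?_
    filter_upwards [Metric.isOpen_ball.mem_nhds (hN.2 b)] with y hy
    refine sum_update_le b y ?_
    have hmem : ((Function.update (u N) b y, w N) : (B → E) × E) ∈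
        ((Set.univ.pi fun _ => Metric.closedBall z δ) ×ˢ Metric.closedBall z δ) := by
      refine ⟨fun b' _ => ?_, Metric.ball_subset_closedBall hN.1⟩
      by_cases hb : b' = b
      · subst hb
        simpa using Metric.ball_subset_closedBall hy
      · simpa [Function.update_of_ne hb] using (Metric.ball_subset_closedBall (hN.2 b'))
    have := huw N hmem
    simp only [Set.mem_ofPred_eq] at this
    linarith
  have hstat : ∀ᶠ N : ℕ in hyperfilter ℕ, ∑ b, -((2 * (N : ℝ)) • (u N b - w N)) +
      (ζ + (2 * (K + 1)) • (w N - z)) +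
      ∑ j, (2 * N * e j (w N)) • gradient (e j) (w N) = 0 := by
    filter_upwards [hin] with N hN
    refine sum_gradient_eq_zero_of_isLocalMin he ?_
    filter_upwards [Metric.isOpen_ball.mem_nhds hN.1] with y hy
    have hmem : ((u N, y) : (B → E) × E) ∈
        ((Set.univ.pi fun _ => Metric.closedBall z δ) ×ˢ Metric.closedBall z δ) :=
      ⟨fun b' _ => Metric.ball_subset_closedBall (hN.2 b'), Metric.ball_subset_closedBall hy⟩
    have := huw N hmem
    simp only [Set.mem_ofPred_eq] at this
    linarith
  -- The factor 2N is unbounded, but these vectors are subgradients of a function that is Lipschitz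
  -- near z.
  have hlim : ∀ b, ∃ ξ, Tendsto (fun N : ℕ => -((2 * (N : ℝ)) • (u N b - w N)))
      (hyperfilter ℕ) (𝓝 ξ) := fun b => by
    obtain ⟨R, hR⟩ := (hψ b).exists_bound
    refine (hyperfilter ℕ).exists_tendsto_of_bounded (a := 0) (R := R) ?_
    filter_upwards [hsub, (hu' b).eventually hR] with N h1 h2
    rw [dist_zero_right]
    exact h2 _ (regularSubdiff_subset_limitingSubdiff _ _ (h1 b))
  choose ξ hξ using hlim
  refine ⟨ξ, fun b => limitingSubdiff_closed (hsub.mono fun N h =>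
    regularSubdiff_subset_limitingSubdiff _ _ (h b)) (hu' b) (hξ b) (hψ b).continuousAt, ?_⟩
  have hgrad : Tendsto (fun N => fun j => gradient (e j) (w N)) (hyperfilter ℕ)
      (𝓝 fun j => gradient (e j) z) :=
    tendsto_pi_nhds.2 fun j => ((he j).continuous_gradient.tendsto z).comp hw
  -- The multipliers 2N e_j(w N) need no bound of their own: by `hstat` the vector lies in the
  -- moving span of gradients, and such spans are closed under limits.
  refine hli.mem_span_of_tendsto (hyperfilter ℕ) hgrad
    (s := fun N => ∑ b, -((2 * (N : ℝ)) • (u N b - w N)) + (ζ + (2 * (K + 1)) • (w N - z))) ?_ ?_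
  · refine (tendsto_finsetSum _ fun b _ => hξ b).add ?_
    have : Continuous fun y : E => ζ + (2 * (K + 1)) • (y - z) := by fun_prop
    simpa [Function.comp_def] using (this.tendsto z).comp hw
  · filter_upwards [hstat] with N hN
    rw [add_eq_zero_iff_eq_neg.1 hN]
    exact Submodule.neg_mem _ (Submodule.sum_mem _ fun j _ => Submodule.smul_mem _ _
      (Submodule.subset_span (Set.mem_range_self j)))

end MultiplierRule

/-! ### Stationarity of penalty functions and of the constraint violation -/

section Stationarity

variable {E : Type*} [NormedAddCommGroup E] [InnerProductSpace ℝ E] [CompleteSpace E]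
  [FiniteDimensional ℝ E] {A B J : Type*} [Fintype A] [Fintype B] [Fintype J]

theorem exists_subgradients_of_isLocalMin {ψ : B → E → ℝ} {z ζ : E} {K : ℝ}
    (hψ : ∀ b, LipNear (ψ b) z)
    (hmin : ∀ᶠ y in 𝓝 z, ∑ b, ψ b z + inner ℝ ζ z ≤
      ∑ b, ψ b y + inner ℝ ζ y + K * ‖y - z‖ ^ 2) :
    ∃ ξ : B → E, (∀ b, ξ b ∈ limitingSubdiff (ψ b) z) ∧ ∑ b, ξ b + ζ = 0 := by
  obtain ⟨ξ, h1, h2⟩ := exists_multipliers_of_isLocalMinOn (J := PEmpty.{1})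
    (e := fun j _ => j.elim) (K := K) hψ (fun j => j.elim) (fun j => j.elim)
    linearIndependent_empty_type (hmin.mono fun y hy _ => hy)
  refine ⟨ξ, h1, ?_⟩
  simpa [Set.range_eq_empty] using h2

/-- The function f + (-f) is constant, so every point minimizes it and the sum rule produces a
subgradient of each summand. -/
theorem LipNear.nonempty_limitingSubdiff {f : E → ℝ} {x : E} (hf : LipNear f x) :
    (limitingSubdiff f x).Nonempty := by
  obtain ⟨ξ, h1, -⟩ := exists_subgradients_of_isLocalMin (B := Fin 2) (ζ := 0) (K := 0) (z := x)
    (ψ := ![f, fun y => -f y]) (fun b => by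
      fin_cases b
      · exact hf
      · exact hf.neg) (Eventually.of_forall fun y => by simp)
  exact ⟨ξ 0, h1 0⟩

/-- For c > 0 this is scaling. For c = 0 it needs that f has some subgradient, hence the Lipschitz
hypothesis. -/
theorem exists_smul_of_mem_limitingSubdiff_const_mul {f : E → ℝ} {x ξ : E} {c : ℝ}
    (hf : LipNear f x) (hc : 0 ≤ c) (h : ξ ∈ limitingSubdiff (fun y => c * f y) x) :
    ∃ v ∈ limitingSubdiff f x, ξ = c • v := by
  rcases hc.eq_or_lt with rfl | hc
  · obtain ⟨v, hv⟩ := hf.nonempty_limitingSubdiff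
    refine ⟨v, hv, ?_⟩
    obtain ⟨y, w, h1, -, -, h4⟩ := h
    have : w = fun _ => 0 := by
      funext k
      have := h1 k
      simp only [zero_mul] at this
      exact eq_zero_of_mem_regularSubdiff_const this
    rw [this] at h4
    rw [zero_smul]
    exact tendsto_nhds_unique h4 tendsto_const_nhds
  · refine ⟨c⁻¹ • ξ, ?_, by rw [smul_inv_smul₀ hc.ne']⟩
    obtain ⟨y, w, h1, h2, h3, h4⟩ := h
    refine limitingSubdiff_closed (F := atTop) (w := fun k => c⁻¹ • w k)
      (Eventually.of_forall fun k => ?_) h2 (h4.const_smul _) hf.continuousAt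
    refine regularSubdiff_subset_limitingSubdiff _ _ ?_
    have := regularSubdiff_const_mul (inv_pos.2 hc) (h1 k)
    simpa [inv_mul_cancel_left₀ hc.ne'] using this

/-- Near a point around which `f` is subdifferentially regular, subgradients of `-f` are
negatives of subgradients of `f`. -/
theorem neg_mem_limitingSubdiff_of_regular {f : E → ℝ} {x ξ : E} (hf : LipNear f x)
    (hreg : ∀ᶠ y in 𝓝 x, SubdiffRegularAt f y) (h : ξ ∈ limitingSubdiff (fun y => -f y) x) :
    -ξ ∈ limitingSubdiff f x := by
  obtain ⟨y, w, h1, h2, -, h4⟩ := h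
  refine limitingSubdiff_closed (F := atTop) (w := fun k => -w k) ?_ h2 h4.neg hf.continuousAt
  filter_upwards [h2.eventually hreg, h2.eventually hf.eventually] with k h5 h6
  -- By regularity v is a regular subgradient of f at y k. Since -f has the regular subgradient w k
  -- there, w k = -v.
  obtain ⟨v, hv⟩ := h6.nonempty_limitingSubdiff
  rw [h5] at hv
  have := regularSubdiff_neg_unique hv (h1 k)
  rw [this, neg_neg]
  exact regularSubdiff_subset_limitingSubdiff _ _ hv

/-- The function max(s, 0)² has derivative 2 max(s, 0), which is Lipschitz with constant 2; this is
the resulting quadratic upper bound. -/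
theorem sq_posPart_le (s t : ℝ) :
    max t 0 ^ 2 ≤ max s 0 ^ 2 + 2 * max s 0 * (t - s) + (t - s) ^ 2 := by
  rcases max_cases t 0 with ⟨h1, h1'⟩ | ⟨h1, h1'⟩ <;>
    rcases max_cases s 0 with ⟨h2, h2'⟩ | ⟨h2, h2'⟩ <;>
    rw [h1, h2] <;> nlinarith

theorem LipNear.exists_sq_bound {f : E → ℝ} {x : E} (hf : LipNear f x) :
    ∃ L : ℝ, ∀ᶠ y in 𝓝 x, (f y - f x) ^ 2 ≤ L * ‖y - x‖ ^ 2 := by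
  obtain ⟨K, U, hU, hK⟩ := hf
  refine ⟨K ^ 2, ?_⟩
  filter_upwards [hU] with y hy
  have := hK.dist_le_mul y hy x (mem_of_mem_nhds hU)
  rw [Real.dist_eq, dist_eq_norm] at this
  rw [← sq_abs, ← mul_pow]
  exact pow_le_pow_left₀ (abs_nonneg _) this 2

/-- Multiplier rule for a sum of one Lipschitz function and weighted Lipschitz functions. -/
theorem exists_weighted_multipliers {f : E → ℝ} {φ : A → E → ℝ} {e : J → E → ℝ} {z ζ : E}
    {K : ℝ} {c : A → ℝ} (hc : ∀ a, 0 ≤ c a)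
    (hf : LipNear f z) (hφ : ∀ a, LipNear (φ a) z) (he : ∀ j, ContDiff ℝ 1 (e j))
    (hez : ∀ j, e j z = 0) (hli : LinearIndependent ℝ fun j => gradient (e j) z)
    (hmin : ∀ᶠ y in 𝓝 z, (∀ j, e j y = 0) → f z + ∑ a, c a * φ a z + inner ℝ ζ z ≤
      f y + ∑ a, c a * φ a y + inner ℝ ζ y + K * ‖y - z‖ ^ 2) :
    ∃ ξ ∈ limitingSubdiff f z, ∃ v : A → E, (∀ a, v a ∈ limitingSubdiff (φ a) z) ∧
      ξ + ∑ a, c a • v a + ζ ∈ Submodule.span ℝ (Set.range fun j => gradient (e j) z) := by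
  obtain ⟨ξ, h1, h2⟩ := exists_multipliers_of_isLocalMinOn (B := Option A) (K := K) (ζ := ζ)
    (ψ := fun b => b.elim f fun a y => c a * φ a y) (z := z) (e := e)
    (fun b => by cases b with
      | none => exact hf
      | some a => exact (hφ a).const_mul _) he hez hli
    (hmin.mono fun y hy hy' => by
      simp only [Fintype.sum_option]
      exact hy hy')
  choose v hv1 hv2 using fun a =>
    exists_smul_of_mem_limitingSubdiff_const_mul (hφ a) (hc a) (h1 (some a))
  refine ⟨ξ none, h1 none, v, hv1, ?_⟩
  simpa only [Fintype.sum_option, hv2] using h2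

/-- Squared positive parts are replaced by the φ a with weights frozen at z. The quadratic error is
harmless in the multiplier rule, and no subdifferential chain rule is needed. -/
theorem sum_weighted_majorization {φ : A → E → ℝ} {z : E} (hφ : ∀ a, LipNear (φ a) z)
    (s : A → ℝ) :
    ∃ L : ℝ, ∀ᶠ y in 𝓝 z, ∑ a, max (φ a y + s a) 0 ^ 2 ≤ ∑ a, max (φ a z + s a) 0 ^ 2 +
      2 * ∑ a, max (φ a z + s a) 0 * (φ a y - φ a z) + L * ‖y - z‖ ^ 2 := by
  choose L hL using fun a => (hφ a).exists_sq_bound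
  refine ⟨∑ a, L a, ?_⟩
  filter_upwards [eventually_all.2 hL] with y hy
  rw [Finset.mul_sum, Finset.sum_mul, ← Finset.sum_add_distrib, ← Finset.sum_add_distrib]
  refine Finset.sum_le_sum fun a _ => ?_
  have h1 := sq_posPart_le (φ a z + s a) (φ a y + s a)
  have h2 := hy a
  have h3 : φ a y + s a - (φ a z + s a) = φ a y - φ a z := by ring
  rw [h3] at h1
  linarith

/-- Stationarity of minimizers of a quadratic penalty function. -/
theorem exists_multipliers_of_penalty {f : E → ℝ} {φ : A → E → ℝ} {e : J → E → ℝ} {x z : E}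
    {N : ℝ} {s : A → ℝ} (hN : 0 ≤ N)
    (hf : LipNear f z) (hφ : ∀ a, LipNear (φ a) z) (he : ∀ j, ContDiff ℝ 1 (e j))
    (hez : ∀ j, e j z = 0) (hli : LinearIndependent ℝ fun j => gradient (e j) z)
    (hmin : ∀ᶠ y in 𝓝 z, (∀ j, e j y = 0) →
      f z + ‖z - x‖ ^ 2 + N * ∑ a, max (φ a z + s a) 0 ^ 2 ≤
      f y + ‖y - x‖ ^ 2 + N * ∑ a, max (φ a y + s a) 0 ^ 2) :
    ∃ ξ ∈ limitingSubdiff f z, ∃ v : A → E, (∀ a, v a ∈ limitingSubdiff (φ a) z) ∧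
      ξ + ∑ a, (2 * N * max (φ a z + s a) 0) • v a + (2 : ℝ) • (z - x) ∈
        Submodule.span ℝ (Set.range fun j => gradient (e j) z) := by
  obtain ⟨L, hL⟩ := sum_weighted_majorization hφ s
  refine exists_weighted_multipliers (K := 1 + N * L) (fun a => by positivity) hf hφ he hez hli ?_
  filter_upwards [hmin, hL] with y h1 h2 h3
  have h4 := h1 h3
  have h5 := mul_le_mul_of_nonneg_left h2 hN
  have h6 : ‖y - x‖ ^ 2 = ‖z - x‖ ^ 2 + 2 * inner ℝ (z - x) (y - z) + ‖y - z‖ ^ 2 := by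
    rw [← norm_add_sq_real]
    congr 2
    abel
  have h7 : 2 * N * ∑ a, max (φ a z + s a) 0 * (φ a y - φ a z) =
      ∑ a, 2 * N * max (φ a z + s a) 0 * φ a y - ∑ a, 2 * N * max (φ a z + s a) 0 * φ a z := by
    rw [Finset.mul_sum, ← Finset.sum_sub_distrib]
    exact Finset.sum_congr rfl fun a _ => by ring
  rw [real_inner_smul_left, real_inner_smul_left]
  rw [inner_sub_right] at h6
  nlinarith

/-- The Euclidean norm of the vector of positive parts. -/
noncomputable def violation (φ : A → E → ℝ) (y : E) : ℝ := √(∑ a, max (φ a y) 0 ^ 2)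

theorem violation_nonneg (φ : A → E → ℝ) (y : E) : 0 ≤ violation φ y := Real.sqrt_nonneg _

theorem violation_eq_zero_iff {φ : A → E → ℝ} {y : E} :
    violation φ y = 0 ↔ ∀ a, φ a y ≤ 0 := by
  rw [violation, Real.sqrt_eq_zero (by positivity),
    Finset.sum_eq_zero_iff_of_nonneg fun a _ => by positivity]
  simp

theorem norm_le_of_mem_limitingSubdiff_mul_norm {y z ξ : E} {ε : ℝ} (hε : 0 ≤ ε)
    (h : ξ ∈ limitingSubdiff (fun u => ε * ‖u - y‖) z) : ‖ξ‖ ≤ ε := by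
  refine norm_le_of_mem_limitingSubdiff (K := ⟨ε, hε⟩) univ_mem
    (LipschitzOnWith.of_dist_le_mul fun u _ v _ => ?_) h
  rw [Real.dist_eq, dist_eq_norm, ← mul_sub, abs_mul, abs_of_nonneg hε]
  refine mul_le_mul_of_nonneg_left ((abs_norm_sub_norm_le _ _).trans (le_of_eq ?_)) hε
  congr 1
  abel

/-- The violation is a Euclidean norm, so linearizing it where it is positive gives weights forming
a unit vector supported on the violated constraints. The distance term contributes only ξ. -/
theorem exists_multipliers_of_violation {φ : A → E → ℝ} {e : J → E → ℝ} {y₀ z : E}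
    {ε : ℝ} (hε : 0 ≤ ε) (hφ : ∀ a, LipNear (φ a) z) (he : ∀ j, ContDiff ℝ 1 (e j))
    (hez : ∀ j, e j z = 0) (hli : LinearIndependent ℝ fun j => gradient (e j) z)
    (hpos : 0 < violation φ z)
    (hmin : ∀ᶠ y in 𝓝 z, (∀ j, e j y = 0) →
      violation φ z + ε * ‖z - y₀‖ ≤ violation φ y + ε * ‖y - y₀‖) :
    ∃ (c : A → ℝ) (v : A → E) (ξ : E), (∀ a, 0 ≤ c a) ∧ ∑ a, c a ^ 2 = 1 ∧
      (∀ a, c a ≠ 0 ↔ 0 < φ a z) ∧ (∀ a, v a ∈ limitingSubdiff (φ a) z) ∧ ‖ξ‖ ≤ ε ∧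
      ξ + ∑ a, c a • v a ∈ Submodule.span ℝ (Set.range fun j => gradient (e j) z) := by
  set R := violation φ z with hR
  have hR2 : R ^ 2 = ∑ a, max (φ a z) 0 ^ 2 := Real.sq_sqrt (by positivity)
  obtain ⟨L, hL⟩ := sum_weighted_majorization hφ 0
  simp only [Pi.zero_apply, add_zero] at hL
  have hlip : LipNear (fun u => ε * ‖u - y₀‖) z := by
    refine ⟨⟨ε, hε⟩, Set.univ, univ_mem, LipschitzOnWith.of_dist_le_mul fun u _ v _ => ?_⟩
    rw [Real.dist_eq, dist_eq_norm, ← mul_sub, abs_mul, abs_of_nonneg hε]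
    refine mul_le_mul_of_nonneg_left ((abs_norm_sub_norm_le _ _).trans (le_of_eq ?_)) hε
    congr 1
    abel
  obtain ⟨ξ, hξ, v, hv, h⟩ := exists_weighted_multipliers (c := fun a => max (φ a z) 0 / R)
    (K := L / (2 * R)) (ζ := 0) (fun a => by positivity) hlip hφ he hez hli (by
      filter_upwards [hmin, hL] with y h1 h2 h3
      have h4 := h1 h3
      have h5 : violation φ y ≤ R + ∑ a, max (φ a z) 0 / R * (φ a y - φ a z) +
          L / (2 * R) * ‖y - z‖ ^ 2 := by
        have h6 : violation φ y ^ 2 = ∑ a, max (φ a y) 0 ^ 2 := Real.sq_sqrt (by positivity)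
        -- The square root lies below its tangent at R², which requires R > 0.
        have h7 : 2 * R * violation φ y ≤ R ^ 2 + violation φ y ^ 2 := by
          nlinarith [sq_nonneg (R - violation φ y)]
        have h8 : ∑ a, max (φ a z) 0 / R * (φ a y - φ a z) =
            (∑ a, max (φ a z) 0 * (φ a y - φ a z)) / R := by
          rw [Finset.sum_div]
          exact Finset.sum_congr rfl fun a _ => by ring
        have h9 : R + (∑ a, max (φ a z) 0 * (φ a y - φ a z)) / R + L / (2 * R) * ‖y - z‖ ^ 2 =
            (2 * R ^ 2 + 2 * (∑ a, max (φ a z) 0 * (φ a y - φ a z)) + L * ‖y - z‖ ^ 2) /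
              (2 * R) := by
          field_simp
        rw [h8, h9, le_div_iff₀ (by positivity)]
        rw [h6, hR2] at h7
        linarith [hR2]
      have h10 : ∑ a, max (φ a z) 0 / R * (φ a y - φ a z) =
          ∑ a, max (φ a z) 0 / R * φ a y - ∑ a, max (φ a z) 0 / R * φ a z := by
        rw [← Finset.sum_sub_distrib]
        exact Finset.sum_congr rfl fun a _ => by ring
      simp only [inner_zero_left]
      linarith)
  refine ⟨fun a => max (φ a z) 0 / R, v, ξ, fun a => by positivity, ?_, fun a => ?_, hv,
    norm_le_of_mem_limitingSubdiff_mul_norm hε hξ, by simpa using h⟩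
  · simp only [div_pow]
    rw [← Finset.sum_div, ← hR2, div_self (by positivity)]
  · rw [div_ne_zero_iff]
    constructor
    · rintro ⟨h, -⟩
      by_contra h'
      exact h (max_eq_right (not_lt.1 h'))
    · intro h
      exact ⟨(lt_max_of_lt_left h).ne', hpos.ne'⟩

/-- A local error bound on the manifold `e = 0` follows if no point near `x` that violates
`φ ≤ 0` is nearly stationary for the violation. -/
theorem eventually_error_bound_of_not_stationary {φ : A → E → ℝ} {e : J → E → ℝ} {x : E}
    {ε r : ℝ} (hε : 0 < ε) (hr : 0 < r) (hφc : ∀ a, Continuous (φ a))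
    (hφ : ∀ z a, LipNear (φ a) z) (hφx : ∀ a, φ a x = 0)
    (he : ∀ j, ContDiff ℝ 1 (e j))
    (hns : ∀ z ∈ Metric.ball x r, (∀ j, e j z = 0) → z ≠ x →
      LinearIndependent ℝ (fun j => gradient (e j) z) ∧
      ¬ ∃ (c : A → ℝ) (v : A → E) (ξ : E), (∀ a, 0 ≤ c a) ∧ ∑ a, c a ^ 2 = 1 ∧
      (∀ a, c a ≠ 0 ↔ 0 < φ a z) ∧ (∀ a, v a ∈ limitingSubdiff (φ a) z) ∧ ‖ξ‖ ≤ ε ∧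
      ξ + ∑ a, c a • v a ∈ Submodule.span ℝ (Set.range fun j => gradient (e j) z)) :
    ∀ᶠ y₀ in 𝓝 x, (∀ j, e j y₀ = 0) → ∃ z, (∀ j, e j z = 0) ∧ (∀ a, φ a z ≤ 0) ∧
      ‖z - y₀‖ ≤ ε⁻¹ * violation φ y₀ := by
  have hvc : Continuous (violation φ) := by
    unfold violation
    fun_prop
  have hvx : violation φ x = 0 := violation_eq_zero_iff.2 fun a => (hφx a).le
  have h1 : ∀ᶠ y₀ in 𝓝 x, ε⁻¹ * violation φ y₀ < r / 4 := by
    have : Tendsto (fun y => ε⁻¹ * violation φ y) (𝓝 x) (𝓝 (ε⁻¹ * violation φ x)) :=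
      (continuous_const.mul hvc).tendsto x
    rw [hvx, mul_zero] at this
    exact this.eventually (gt_mem_nhds (by positivity))
  filter_upwards [h1, Metric.ball_mem_nhds x (show 0 < r / 4 by positivity)] with y₀ hv hb hey
  have hcomp : IsCompact (Metric.closedBall x (r / 2) ∩ {y | ∀ j, e j y = 0}) := by
    refine (isCompact_closedBall x (r / 2)).inter_right ?_
    rw [Set.ofPred_forall]
    exact isClosed_iInter fun j => isClosed_eq (he j).continuous continuous_const
  rw [Metric.mem_ball] at hb
  have hy₀ : y₀ ∈ Metric.closedBall x (r / 2) ∩ {y | ∀ j, e j y = 0} :=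
    ⟨by rw [Metric.mem_closedBall]; linarith, hey⟩
  -- Compactness supplies an exact minimizer where Ekeland's principle would give an approximate
  -- one. Comparison with y₀ bounds ‖z - y₀‖ by less than r / 4, so z is interior to the ball;
  -- positive violation at z would make z nearly stationary.
  obtain ⟨z, hz, hzmin⟩ := hcomp.exists_isMinOn ⟨y₀, hy₀⟩
    (f := fun y => violation φ y + ε * ‖y - y₀‖) (Continuous.continuousOn (by fun_prop))
  have h2 : violation φ z + ε * ‖z - y₀‖ ≤ violation φ y₀ := by
    have := hzmin hy₀
    simpa using this
  have h3 : ‖z - y₀‖ ≤ ε⁻¹ * violation φ y₀ := by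
    rw [inv_mul_eq_div, le_div_iff₀ hε]
    linarith [violation_nonneg φ z]
  refine ⟨z, hz.2, ?_, h3⟩
  by_contra hcon
  have hpos : 0 < violation φ z := lt_of_le_of_ne (violation_nonneg φ z)
    fun h => hcon (violation_eq_zero_iff.1 h.symm)
  have hzx : dist z x < r / 2 := by
    have := dist_triangle z y₀ x
    rw [dist_eq_norm z y₀] at this
    linarith
  obtain ⟨hli, hno⟩ := hns z (by rw [Metric.mem_ball]; linarith) hz.2 (fun h => by
    rw [h, hvx] at hpos
    exact lt_irrefl _ hpos)
  refine hno (exists_multipliers_of_violation hε.le (hφ z) he hz.2 hli hpos (y₀ := y₀) ?_)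
  filter_upwards [Metric.isOpen_ball.mem_nhds (Metric.mem_ball.2 hzx)] with y hy hey
  exact hzmin ⟨Metric.ball_subset_closedBall hy, hey⟩

end Stationarity

/-! ### Ratio test and Carathéodory reduction -/

section PositiveCombinations

variable {A : Type*} [Fintype A]

/-- Moving a nonnegative vector along a direction supported in its support until a further
coordinate vanishes. -/
theorem exists_sub_smul_nonneg_vanishing {lam α : A → ℝ} (hlam : ∀ a, 0 ≤ lam a) (hα : α ≠ 0)
    (hsupp : ∀ a, lam a = 0 → α a = 0) :
    ∃ t : ℝ, (∀ a, 0 ≤ lam a - t * α a) ∧ ∃ a, lam a ≠ 0 ∧ lam a - t * α a = 0 := by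
  classical
  wlog hpos : ∃ a, 0 < α a generalizing α
  · obtain ⟨a, ha⟩ := Function.ne_iff.1 hα
    have ha' : 0 < (-α) a := by
      have h1 : ¬ 0 < α a := fun h => hpos ⟨a, h⟩
      have h2 : α a ≠ 0 := ha
      simp only [Pi.neg_apply]
      exact neg_pos.2 (lt_of_le_of_ne (not_lt.1 h1) h2)
    obtain ⟨t, h1, b, h2, h3⟩ := this (α := -α) (neg_ne_zero.2 hα)
      (fun a h => by simp [hsupp a h]) ⟨a, ha'⟩
    refine ⟨-t, fun a => ?_, b, h2, ?_⟩
    · have := h1 a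
      simp only [Pi.neg_apply] at this
      linarith
    · simp only [Pi.neg_apply] at h3
      linarith
  obtain ⟨a₁, ha₁⟩ := hpos
  -- The ratio test: the smallest quotient over α a > 0 belongs to the first coordinate that reaches
  -- zero.
  obtain ⟨a₀, ha₀, hmin⟩ := (Finset.univ.filter fun a => 0 < α a).exists_min_image
    (fun a => lam a / α a) ⟨a₁, by simpa using ha₁⟩
  have hα₀ : 0 < α a₀ := by simpa using ha₀
  have ht : 0 ≤ lam a₀ / α a₀ := div_nonneg (hlam a₀) hα₀.le
  refine ⟨lam a₀ / α a₀, fun a => ?_, a₀, fun h => ?_, ?_⟩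
  · rcases lt_or_ge 0 (α a) with h | h
    · have := hmin a (by simpa using h)
      have := (le_div_iff₀ h).1 this
      linarith
    · have := mul_nonpos_of_nonneg_of_nonpos ht h
      have := hlam a
      linarith
  · have := hsupp a₀ h
    linarith
  · field_simp
    ring

variable {E : Type*} [AddCommGroup E] [Module ℝ E]

/-- Carathéodory's theorem for nonnegative combinations modulo a subspace. -/
theorem exists_reduced_combination (W : Submodule ℝ E) (v : A → E) {lam : A → ℝ}
    (hlam : ∀ a, 0 ≤ lam a) :
    ∃ lam' : A → ℝ, (∀ a, 0 ≤ lam' a) ∧ ∑ a, lam' a • v a - ∑ a, lam a • v a ∈ W ∧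
      ∀ α : A → ℝ, (∀ a, lam' a = 0 → α a = 0) → ∑ a, α a • v a ∈ W → α = 0 := by
  classical
  induction hn : (Finset.univ.filter fun a => lam a ≠ 0).card using Nat.strong_induction_on
    generalizing lam with
  | _ n ih =>
    by_cases h : ∀ α : A → ℝ, (∀ a, lam a = 0 → α a = 0) → ∑ a, α a • v a ∈ W → α = 0
    · exact ⟨lam, hlam, by simp, h⟩
    push Not at h
    obtain ⟨α, h1, h2, h3⟩ := h
    -- A relation modulo W within the support of lam lets one more coordinate vanish without
    -- changing the combination modulo W.
    obtain ⟨t, h4, a₀, h5, h6⟩ := exists_sub_smul_nonneg_vanishing hlam h3 h1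
    have hlt : (Finset.univ.filter fun a => lam a - t * α a ≠ 0).card < n := by
      rw [← hn]
      refine Finset.card_lt_card ⟨fun a ha => ?_, fun hs => ?_⟩
      · simp only [Finset.mem_filter, Finset.mem_univ, true_and] at ha ⊢
        intro h0
        exact ha (by rw [h0, h1 a h0]; simp)
      · have := hs (show a₀ ∈ _ by simpa using h5)
        simp only [Finset.mem_filter, Finset.mem_univ, true_and] at this
        exact this h6
    obtain ⟨lam', k1, k2, k3⟩ := ih _ hlt h4 rfl
    refine ⟨lam', k1, ?_, k3⟩
    have : ∑ a, lam' a • v a - ∑ a, lam a • v a =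
        (∑ a, lam' a • v a - ∑ a, (lam a - t * α a) • v a) - t • ∑ a, α a • v a := by
      simp only [sub_smul, Finset.sum_sub_distrib, Finset.smul_sum, smul_smul]
      abel
    rw [this]
    exact W.sub_mem k2 (W.smul_mem t h2)

end PositiveCombinations

/-! ### The abstract constraint qualification and limiting multipliers -/

section RelaxedCPLD

variable {E : Type*} [NormedAddCommGroup E] [InnerProductSpace ℝ E] [CompleteSpace E]
  {A J : Type*} [Fintype A] [Fintype J]

/-- The span of the gradients of the equality constraints at `y`. -/
noncomputable def gradSpan (e : J → E → ℝ) (y : E) : Submodule ℝ E :=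
  Submodule.span ℝ (Set.range fun j => gradient (e j) y)

/-- Every nontrivial nonnegative relation between subgradients at `x`, modulo the gradients of the
equality constraints, leads to linear dependence of nearby subgradients of the same functions. -/
def RelaxedCPLD (φ : A → E → ℝ) (e : J → E → ℝ) (x : E) : Prop :=
  ∀ (lam : A → ℝ) (v : A → E), (∀ a, 0 ≤ lam a) → lam ≠ 0 →
    (∀ a, v a ∈ limitingSubdiff (φ a) x) → ∑ a, lam a • v a ∈ gradSpan e x →
    ∀ᶠ q : E × (A → E) in 𝓝 (x, v), q.1 ≠ x → (∀ a, q.2 a ∈ limitingSubdiff (φ a) q.1) →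
      ∃ α : A → ℝ, α ≠ 0 ∧ (∀ a, lam a = 0 → α a = 0) ∧ ∑ a, α a • q.2 a ∈ gradSpan e q.1

theorem LinearIndependent.eventually_nhds {w : J → E} (hw : LinearIndependent ℝ w) :
    ∀ᶠ w' in 𝓝 w, LinearIndependent ℝ w' := by
  obtain ⟨c, hc, h⟩ := hw.exists_lower_bound
  filter_upwards [h] with w' hw'
  refine Fintype.linearIndependent_iff.2 fun β hβ => ?_
  have := hw' β
  rw [hβ, norm_zero] at this
  have h0 : ‖β‖ = 0 := le_antisymm (by nlinarith) (norm_nonneg _)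
  exact fun i => congrFun (norm_eq_zero.1 h0) i

theorem tendsto_gradients {e : J → E → ℝ} (he : ∀ j, ContDiff ℝ 1 (e j)) (x : E) :
    Tendsto (fun y => fun j => gradient (e j) y) (𝓝 x) (𝓝 fun j => gradient (e j) x) :=
  tendsto_pi_nhds.2 fun j => (he j).continuous_gradient.tendsto x

theorem eventually_linearIndependent_gradients {e : J → E → ℝ} {x : E}
    (he : ∀ j, ContDiff ℝ 1 (e j)) (hli : LinearIndependent ℝ fun j => gradient (e j) x) :
    ∀ᶠ y in 𝓝 x, LinearIndependent ℝ fun j => gradient (e j) y :=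
  (tendsto_gradients he x).eventually hli.eventually_nhds

theorem mem_gradSpan_of_tendsto {ι : Type*} (U : Ultrafilter ι) {e : J → E → ℝ} {x : E}
    (he : ∀ j, ContDiff ℝ 1 (e j)) (hli : LinearIndependent ℝ fun j => gradient (e j) x)
    {y s : ι → E} {a : E} (hy : Tendsto y U (𝓝 x)) (hs : Tendsto s U (𝓝 a))
    (h : ∀ᶠ t in U, s t ∈ gradSpan e (y t)) : a ∈ gradSpan e x :=
  hli.mem_span_of_tendsto U ((tendsto_gradients he x).comp hy) hs h

variable [FiniteDimensional ℝ E]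

/-- Subgradients of Lipschitz functions are bounded, so they converge along the ultrafilter, and the
limits are again subgradients. -/
theorem exists_tendsto_selection {ι : Type*} (U : Ultrafilter ι) {φ : A → E → ℝ} {x : E}
    (hφ : ∀ a, LipNear (φ a) x) {y : ι → E} {v : ι → A → E} (hy : Tendsto y U (𝓝 x))
    (hv : ∀ᶠ t in U, ∀ a, v t a ∈ limitingSubdiff (φ a) (y t)) :
    ∃ w : A → E, Tendsto v U (𝓝 w) ∧ ∀ a, w a ∈ limitingSubdiff (φ a) x := by
  have h : ∀ a, ∃ w, Tendsto (fun t => v t a) U (𝓝 w) := fun a => by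
    obtain ⟨R, hR⟩ := (hφ a).exists_bound
    refine U.exists_tendsto_of_bounded (a := 0) (R := R) ?_
    filter_upwards [hv, hy.eventually hR] with t h1 h2
    rw [dist_zero_right]
    exact h2 _ (h1 a)
  choose w hw using h
  exact ⟨w, tendsto_pi_nhds.2 hw, fun a =>
    limitingSubdiff_closed (hv.mono fun t h => h a) hy (hw a) (hφ a).continuousAt⟩

/-- Limits of approximate multiplier relations under the relaxed constant positive linear
dependence condition. -/
theorem RelaxedCPLD.exists_multipliers_of_tendsto {ι : Type*} (U : Ultrafilter ι)
    {φ : A → E → ℝ} {e : J → E → ℝ} {f : E → ℝ} {x : E} (hRC : RelaxedCPLD φ e x)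
    (hφ : ∀ a, LipNear (φ a) x) (he : ∀ j, ContDiff ℝ 1 (e j))
    (hli : LinearIndependent ℝ fun j => gradient (e j) x) (hf : LipNear f x)
    {z : ι → E} (hz : Tendsto z U (𝓝 x)) (hzx : ∀ᶠ t in U, z t ≠ x)
    (h : ∀ᶠ t in U, ∃ ξ ∈ limitingSubdiff f (z t), ∃ (lam : A → ℝ) (v : A → E),
      (∀ a, 0 ≤ lam a) ∧ (∀ a, v a ∈ limitingSubdiff (φ a) (z t)) ∧
      ξ + ∑ a, lam a • v a + (2 : ℝ) • (z t - x) ∈ gradSpan e (z t)) :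
    ∃ ξ ∈ limitingSubdiff f x, ∃ (lam : A → ℝ) (v : A → E), (∀ a, 0 ≤ lam a) ∧
      (∀ a, v a ∈ limitingSubdiff (φ a) x) ∧ ξ + ∑ a, lam a • v a ∈ gradSpan e x := by
  have h' : ∀ t, ∃ (ξ : E) (lam : A → ℝ) (v : A → E),
      (∃ ξ ∈ limitingSubdiff f (z t), ∃ (lam : A → ℝ) (v : A → E),
      (∀ a, 0 ≤ lam a) ∧ (∀ a, v a ∈ limitingSubdiff (φ a) (z t)) ∧
      ξ + ∑ a, lam a • v a + (2 : ℝ) • (z t - x) ∈ gradSpan e (z t)) →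
      ξ ∈ limitingSubdiff f (z t) ∧ (∀ a, 0 ≤ lam a) ∧
      (∀ a, v a ∈ limitingSubdiff (φ a) (z t)) ∧
      ξ + ∑ a, lam a • v a + (2 : ℝ) • (z t - x) ∈ gradSpan e (z t) ∧
      ∀ α : A → ℝ, (∀ a, lam a = 0 → α a = 0) → ∑ a, α a • v a ∈ gradSpan e (z t) → α = 0 := by
    intro t
    by_cases ht : ∃ ξ ∈ limitingSubdiff f (z t), ∃ (lam : A → ℝ) (v : A → E),
      (∀ a, 0 ≤ lam a) ∧ (∀ a, v a ∈ limitingSubdiff (φ a) (z t)) ∧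
      ξ + ∑ a, lam a • v a + (2 : ℝ) • (z t - x) ∈ gradSpan e (z t)
    · obtain ⟨ξ, h1, lam, v, h2, h3, h4⟩ := ht
      -- After the reduction the subgradients in the support of lam' are independent modulo the
      -- gradients of e.
      obtain ⟨lam', k1, k2, k3⟩ := exists_reduced_combination (gradSpan e (z t)) v h2
      refine ⟨ξ, lam', v, fun _ => ⟨h1, k1, h3, ?_, k3⟩⟩
      have := (gradSpan e (z t)).add_mem k2 h4
      convert this using 1
      abel
    · exact ⟨0, 0, 0, fun h => absurd h ht⟩
  choose ξ lam v hall using h'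
  have hall := h.mono fun t ht => hall t ht
  obtain ⟨w, hw, hwx⟩ := exists_tendsto_selection U hφ hz (hall.mono fun t h => h.2.2.1)
  obtain ⟨Ξ, hΞ, hΞx⟩ := exists_tendsto_selection (A := Unit) U (φ := fun _ => f)
    (v := fun t _ => ξ t) (fun _ => hf) hz (hall.mono fun t h _ => h.1)
  have hΞ : Tendsto ξ U (𝓝 (Ξ ())) := tendsto_pi_nhds.1 hΞ ()
  have hshift : Tendsto (fun t => (2 : ℝ) • (z t - x)) U (𝓝 0) := by
    have : Continuous fun y : E => (2 : ℝ) • (y - x) := by fun_prop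
    simpa [Function.comp_def] using (this.tendsto x).comp hz
  by_cases hbd : ∃ R : ℝ, ∀ᶠ t in U, ‖lam t‖ ≤ R
  · obtain ⟨R, hR⟩ := hbd
    obtain ⟨l, hl⟩ := U.exists_tendsto_of_bounded (s := lam) (a := 0) (R := R)
      (by simpa only [dist_zero_right] using hR)
    refine ⟨Ξ (), hΞx (), l, w, fun a => ?_, hwx, ?_⟩
    · exact ge_of_tendsto (tendsto_pi_nhds.1 hl a) (hall.mono fun t h => h.2.1 a)
    · refine mem_gradSpan_of_tendsto U he hli hz ?_ (hall.mono fun t h => h.2.2.2.1)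
      simpa using (hΞ.add (tendsto_sum_smul hw hl)).add hshift
  -- Unbounded multipliers: divided by their norms they converge to a nontrivial nonnegative
  -- relation at x. `RelaxedCPLD` then yields relations at z t, which reducedness forbids.
  · exfalso
    push Not at hbd
    have hlarge : ∀ R : ℝ, ∀ᶠ t in U, R < ‖lam t‖ := hbd
    have hinv : Tendsto (fun t => ‖lam t‖⁻¹) U (𝓝 0) :=
      tendsto_inv_atTop_zero.comp (tendsto_atTop.2 fun R => (hlarge R).mono fun t h => h.le)
    have hpos := hlarge 0
    obtain ⟨l, hl⟩ := U.exists_tendsto_of_bounded (s := fun t => ‖lam t‖⁻¹ • lam t) (a := 0)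
      (R := 1) (by
        filter_upwards [hpos] with t ht
        rw [dist_zero_right, norm_smul, norm_inv, norm_norm, inv_mul_cancel₀ ht.ne'])
    have hl1 : ‖l‖ = 1 := by
      refine tendsto_nhds_unique hl.norm (tendsto_const_nhds.congr' ?_)
      filter_upwards [hpos] with t ht
      rw [norm_smul, norm_inv, norm_norm, inv_mul_cancel₀ ht.ne']
    have hl0 : l ≠ 0 := fun h => by simp [h] at hl1
    have hrel : ∑ a, l a • w a ∈ gradSpan e x := by
      refine mem_gradSpan_of_tendsto U he hli hz
        (s := fun t => ‖lam t‖⁻¹ • (ξ t + (2 : ℝ) • (z t - x)) +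
          ∑ a, (‖lam t‖⁻¹ • lam t) a • v t a) ?_ ?_
      · simpa using (hinv.smul (hΞ.add hshift)).add (tendsto_sum_smul hw hl)
      · filter_upwards [hall] with t ht
        have := (gradSpan e (z t)).smul_mem ‖lam t‖⁻¹ ht.2.2.2.1
        convert this using 1
        simp only [smul_add, Finset.smul_sum, Pi.smul_apply, smul_assoc]
        abel
    have hev := hRC l w (fun a => ge_of_tendsto (tendsto_pi_nhds.1 hl a)
      (hall.mono fun t h => mul_nonneg (inv_nonneg.2 (norm_nonneg _)) (h.2.1 a))) hl0 hwx hrel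
    have hev' := (hz.prodMk_nhds hw).eventually hev
    -- The relation from `RelaxedCPLD` is supported in the support of l, whereas reducedness
    -- concerns the support of lam t.
    have hsupp : ∀ᶠ t in U, ∀ a, lam t a = 0 → l a = 0 := eventually_all.2 fun a => by
      by_cases ha : l a = 0
      · simp [ha]
      · filter_upwards [(tendsto_pi_nhds.1 hl a).eventually (isOpen_ne.mem_nhds ha)] with t ht h0
        simp [h0] at ht
    obtain ⟨t, h1, h2, h3, h4⟩ := (hev'.and (hsupp.and (hall.and hzx))).exists
    obtain ⟨α, k1, k2, k3⟩ := h1 h4 h3.2.2.1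
    exact k1 (h3.2.2.2.2 α (fun a ha => k2 a (h2 a ha)) k3)

theorem isClosed_zeroLocus {e : J → E → ℝ} (he : ∀ j, Continuous (e j)) :
    IsClosed {y | ∀ j, e j y = 0} := by
  rw [Set.ofPred_forall]
  exact isClosed_iInter fun j => isClosed_eq (he j) continuous_const

/-- Local minimizers satisfy the limiting multiplier rule under the relaxed constant positive
linear dependence condition. -/
theorem RelaxedCPLD.exists_multipliers {φ : A → E → ℝ} {e : J → E → ℝ} {f : E → ℝ} {x : E}
    (hRC : RelaxedCPLD φ e x) (hφ : ∀ z a, LipNear (φ a) z) (hφx : ∀ a, φ a x = 0)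
    (he : ∀ j, ContDiff ℝ 1 (e j)) (hex : ∀ j, e j x = 0)
    (hli : LinearIndependent ℝ fun j => gradient (e j) x) (hf : LipNear f x)
    (hmin : ∀ᶠ y in 𝓝 x, (∀ a, φ a y ≤ 0) → (∀ j, e j y = 0) → f x ≤ f y) :
    ∃ ξ ∈ limitingSubdiff f x, ∃ (lam : A → ℝ) (v : A → E), (∀ a, 0 ≤ lam a) ∧
      (∀ a, v a ∈ limitingSubdiff (φ a) x) ∧ ξ + ∑ a, lam a • v a ∈ gradSpan e x := by
  have hφc : ∀ a, Continuous (φ a) := fun a =>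
    continuous_iff_continuousAt.2 fun z => (hφ z a).continuousAt
  obtain ⟨δ, hδ, hball⟩ := Metric.nhds_basis_closedBall.eventually_iff.1
    (hmin.and (hf.eventually.and (eventually_linearIndependent_gradients he hli)))
  set C := Metric.closedBall x δ ∩ {y | ∀ j, e j y = 0} with hC
  have hCc : IsCompact C :=
    (isCompact_closedBall x δ).inter_right (isClosed_zeroLocus fun j => (he j).continuous)
  have hxC : x ∈ C := ⟨Metric.mem_closedBall_self hδ.le, hex⟩
  have hfc : ContinuousOn f C := fun y hy =>
    (hball hy.1).2.1.continuousAt.continuousWithinAt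
  have hQ : Continuous fun y => ∑ a, max (φ a y) 0 ^ 2 := by fun_prop
  have hF : ContinuousOn (fun y => f y + ‖y - x‖ ^ 2) C :=
    hfc.add (Continuous.continuousOn (by fun_prop))
  -- The proximal term ‖y - x‖² makes x the only possible limit of the penalty minimizers, although
  -- x need not be a strict local minimizer of f.
  have hmins : ∀ N : ℕ, ∃ z ∈ C, IsMinOn
      (fun y => f y + ‖y - x‖ ^ 2 + N * ∑ a, max (φ a y) 0 ^ 2) C z := fun N =>
    hCc.exists_isMinOn ⟨x, hxC⟩ (hF.add (Continuous.continuousOn (by fun_prop)))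
  choose z hzC hzmin using hmins
  obtain ⟨q, hqC, hq⟩ := hCc.ultrafilter_le_nhds ((hyperfilter ℕ).map z) (by
    rw [Filter.le_principal_iff]
    exact Filter.Eventually.of_forall (f := (hyperfilter ℕ : Filter ℕ)) hzC)
  have hq : Tendsto z (hyperfilter ℕ) (𝓝 q) := hq
  have hqin : Tendsto z (hyperfilter ℕ) (𝓝[C] q) :=
    tendsto_nhdsWithin_iff.2 ⟨hq, Filter.Eventually.of_forall hzC⟩
  have hlimF := (hF q hqC).tendsto.comp hqin
  have hle : ∀ N : ℕ, (f (z N) + ‖z N - x‖ ^ 2) + N * ∑ a, max (φ a (z N)) 0 ^ 2 ≤ f x :=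
    fun N => by
      have := hzmin N hxC
      simpa [hφx] using this
  have hFq : f q + ‖q - x‖ ^ 2 ≤ f x := by
    refine le_of_tendsto hlimF (Filter.Eventually.of_forall fun N => ?_)
    have : 0 ≤ (N : ℝ) * ∑ a, max (φ a (z N)) 0 ^ 2 := by positivity
    simp only [Function.comp]
    linarith [hle N]
  have hQq : ∑ a, max (φ a q) 0 ^ 2 = 0 := by
    refine le_antisymm ?_ (by positivity)
    have hN : Tendsto (fun N : ℕ => (N : ℝ)⁻¹) (hyperfilter ℕ) (𝓝 0) :=
      (tendsto_inv_atTop_nhds_zero_nat (𝕜 := ℝ)).mono_left Nat.hyperfilter_le_atTop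
    have := hN.mul ((tendsto_const_nhds (x := f x)).sub hlimF)
    rw [zero_mul] at this
    refine le_of_tendsto_of_tendsto ((hQ.tendsto q).comp hq) this ?_
    filter_upwards [(eventually_gt_atTop 0).filter_mono Nat.hyperfilter_le_atTop] with N hN
    have hN' : (0 : ℝ) < N := by exact_mod_cast hN
    simp only [Function.comp]
    rw [inv_mul_eq_div, le_div_iff₀ hN']
    linarith [hle N]
  have hqx : q = x := by
    have h1 : ∀ a, φ a q ≤ 0 := fun a => by
      have := (Finset.sum_eq_zero_iff_of_nonneg fun b _ => by positivity).1 hQq a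
        (Finset.mem_univ a)
      simpa using this
    have h2 := (hball hqC.1).1 h1 hqC.2
    have h3 : ‖q - x‖ = 0 := by nlinarith [norm_nonneg (q - x)]
    exact sub_eq_zero.1 (norm_eq_zero.1 h3)
  subst hqx
  have hmult : ∀ᶠ N in hyperfilter ℕ, ∃ ξ ∈ limitingSubdiff f (z N), ∃ v : A → E,
      (∀ a, v a ∈ limitingSubdiff (φ a) (z N)) ∧
      ξ + ∑ a, (2 * N * max (φ a (z N) + 0) 0) • v a + (2 : ℝ) • (z N - q) ∈
        gradSpan e (z N) := by
    filter_upwards [hq.eventually (Metric.ball_mem_nhds q hδ)] with N hN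
    have hb := hball (hzC N).1
    refine exists_multipliers_of_penalty (s := 0) (Nat.cast_nonneg N) hb.2.1 (hφ (z N)) he
      (hzC N).2 hb.2.2 ?_
    filter_upwards [Metric.isOpen_ball.mem_nhds hN] with y hy hey
    have := hzmin N ⟨Metric.ball_subset_closedBall hy, hey⟩
    simpa using this
  by_cases hne : ∀ᶠ N in hyperfilter ℕ, z N ≠ q
  · refine hRC.exists_multipliers_of_tendsto (hyperfilter ℕ) (hφ q) he hli hf hq hne ?_
    filter_upwards [hmult] with N hN
    obtain ⟨ξ, hξ, v, hv, hrel⟩ := hN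
    exact ⟨ξ, hξ, _, v, fun a => by positivity, hv, hrel⟩
  -- `RelaxedCPLD` speaks only of points other than the reference point. If the reference point is
  -- itself a penalty minimizer, its penalty multipliers are zero, because every φ a vanishes there.
  · have hfr : ∃ᶠ N in hyperfilter ℕ, z N = q := hne
    obtain ⟨N, hzq, ξ, hξ, v, hv, hrel⟩ := (hfr.and_eventually hmult).exists
    rw [hzq] at hξ hv hrel
    exact ⟨ξ, hξ, 0, v, fun a => le_rfl, hv, by simpa [hφx] using hrel⟩

end RelaxedCPLD

/-! ### Radial stationary points, constant rank and a mean value inequality -/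

section Directions

variable {E : Type*} [NormedAddCommGroup E] [InnerProductSpace ℝ E] [CompleteSpace E]
  [FiniteDimensional ℝ E] {A B J : Type*} [Fintype A] [Fintype B] [Fintype J]

theorem norm_inv_norm_smul {w : E} (hw : w ≠ 0) : ‖‖w‖⁻¹ • w‖ = 1 := by
  rw [norm_smul, norm_inv, norm_norm, inv_mul_cancel₀ (norm_ne_zero_iff.2 hw)]

theorem exists_tendsto_direction {ι : Type*} (U : Ultrafilter ι) {x : E} {y : ι → E}
    (hne : ∀ᶠ t in U, y t ≠ x) :
    ∃ u : E, ‖u‖ = 1 ∧ Tendsto (fun t => ‖y t - x‖⁻¹ • (y t - x)) U (𝓝 u) := by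
  have h1 : ∀ᶠ t in U, ‖‖y t - x‖⁻¹ • (y t - x)‖ = 1 :=
    hne.mono fun t ht => norm_inv_norm_smul (sub_ne_zero.2 ht)
  obtain ⟨u, hu⟩ := U.exists_tendsto_of_bounded
    (s := fun t => ‖y t - x‖⁻¹ • (y t - x)) (a := 0) (R := 1)
    (h1.mono fun t ht => by rw [dist_zero_right, ht])
  exact ⟨u, tendsto_nhds_unique hu.norm (tendsto_const_nhds.congr' (h1.mono fun t ht => ht.symm)),
    hu⟩

/-- The inequality for regular subgradients, applied to f and to -f along difference quotients that
vanish. -/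
theorem inner_gradient_eq_zero_of_tendsto {ι : Type*} {F : Filter ι} [F.NeBot] {f : E → ℝ}
    {x u : E} {y : ι → E} (hf : ContDiff ℝ 1 f) (hy : Tendsto y F (𝓝 x))
    (hne : ∀ᶠ t in F, y t ≠ x)
    (hu : Tendsto (fun t => ‖y t - x‖⁻¹ • (y t - x)) F (𝓝 u))
    (hfy : ∀ᶠ t in F, f (y t) = 0) (hfx : f x = 0) : inner ℝ (gradient f x) u = 0 := by
  have h1 := inner_le_of_mem_regularSubdiff (hf.hasGradientAt x).mem_regularSubdiff hy hne hu
    (tendsto_const_nhds (x := (0 : ℝ)) |>.congr' (hfy.mono fun t ht => by simp [ht, hfx]))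
  have h2 := inner_le_of_mem_regularSubdiff (hf.hasGradientAt x).neg'.mem_regularSubdiff hy hne hu
    (tendsto_const_nhds (x := (0 : ℝ)) |>.congr' (hfy.mono fun t ht => by simp [ht, hfx]))
  rw [inner_neg_left] at h2
  linarith

theorem inner_eq_zero_of_mem_gradSpan {e : J → E → ℝ} {x u g : E}
    (h : ∀ j, inner ℝ (gradient (e j) x) u = 0) (hg : g ∈ gradSpan e x) : inner ℝ g u = 0 := by
  obtain ⟨β, rfl⟩ := mem_span_range_iff_exists_fintype_sum.1 hg
  simp [sum_inner, real_inner_smul_left, h]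

theorem eq_zero_of_mem_limitingSubdiff_const {a : ℝ} {x ξ : E}
    (h : ξ ∈ limitingSubdiff (fun _ => a) x) : ξ = 0 := by
  have := norm_le_of_mem_limitingSubdiff (K := 0) univ_mem
    (LipschitzWith.const a).lipschitzOnWith h
  simpa using this

/-- If the `φ b` are positive at a point `z` of `S` with `e z = 0`, there is such a point `y`, no
farther from `x`, at which `y - x` is a combination of subgradients of the `-φ b` and of the
gradients of `e`. -/
theorem exists_radial_stationary_point [Nonempty B] {S : Set E} {φ : B → E → ℝ}
    {e : J → E → ℝ} {x z : E} {r : ℝ} (hS : IsOpen S) (hxS : IsClosed (insert x S))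
    (hφ : ∀ z b, LipNear (φ b) z) (hφx : ∀ b, φ b x = 0) (he : ∀ j, ContDiff ℝ 1 (e j))
    (hli : ∀ y ∈ Metric.ball x r, LinearIndependent ℝ fun j => gradient (e j) y)
    (hzr : z ∈ Metric.ball x r) (hzS : z ∈ S) (hφz : ∀ b, 0 < φ b z) (hez : ∀ j, e j z = 0) :
    ∃ y ∈ S, ‖y - x‖ ≤ ‖z - x‖ ∧ (∀ j, e j y = 0) ∧ (∀ b, 0 < φ b y) ∧
      ∃ (β : B → ℝ) (w : B → E), (∀ b, w b ∈ limitingSubdiff (fun u => -φ b u) y) ∧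
        ∑ b, β b • w b + (y - x) ∈ gradSpan e y := by
  have hφc : ∀ b, Continuous (φ b) := fun b =>
    continuous_iff_continuousAt.2 fun z => (hφ z b).continuousAt
  -- This weight makes a single violation φ b y ≤ 0 cost more than ‖z - x‖², the value of the
  -- objective at z. The minimizer therefore keeps every φ b positive.
  set N : ℝ := ∑ b, (‖z - x‖ ^ 2 + 1) / φ b z ^ 2 with hN
  have hN0 : 0 ≤ N := by positivity
  have hNb : ∀ b, ‖z - x‖ ^ 2 < N * φ b z ^ 2 := fun b => by
    have h1 : (‖z - x‖ ^ 2 + 1) / φ b z ^ 2 ≤ N :=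
      Finset.single_le_sum (f := fun b => (‖z - x‖ ^ 2 + 1) / φ b z ^ 2)
        (fun b _ => by positivity) (Finset.mem_univ b)
    have h2 : 0 < φ b z ^ 2 := pow_pos (hφz b) 2
    rw [div_le_iff₀ h2] at h1
    linarith
  rw [Metric.mem_ball, dist_eq_norm] at hzr
  obtain ⟨r', hr1, hr2⟩ := exists_between hzr
  set C := Metric.closedBall x r' ∩ (insert x S ∩ {y | ∀ j, e j y = 0}) with hC
  have hCc : IsCompact C := (isCompact_closedBall x r').inter_right
    (hxS.inter (isClosed_zeroLocus fun j => (he j).continuous))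
  have hzC : z ∈ C := ⟨by rw [Metric.mem_closedBall, dist_eq_norm]; exact hr1.le,
    Set.mem_insert_of_mem _ hzS, hez⟩
  -- Squared distance to x plus a penalty for letting φ b drop below φ b z. The point x is adjoined
  -- to S for compactness and is not the minimizer, since φ b x = 0.
  obtain ⟨y, hyC, hymin⟩ := hCc.exists_isMinOn ⟨z, hzC⟩
    (f := fun y => ‖y - x‖ ^ 2 + N * ∑ b, max (-φ b y + φ b z) 0 ^ 2)
    (Continuous.continuousOn (by fun_prop))
  have hle : ‖y - x‖ ^ 2 + N * ∑ b, max (-φ b y + φ b z) 0 ^ 2 ≤ ‖z - x‖ ^ 2 := by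
    have := hymin hzC
    simpa using this
  have hnorm : ‖y - x‖ ≤ ‖z - x‖ := by
    have : 0 ≤ N * ∑ b, max (-φ b y + φ b z) 0 ^ 2 := by positivity
    exact le_of_sq_le_sq (by linarith) (norm_nonneg _)
  have hφy : ∀ b, 0 < φ b y := fun b => by
    by_contra hcon
    have h1 : φ b z ≤ max (-φ b y + φ b z) 0 := le_max_of_le_left (by linarith)
    have h2 : φ b z ^ 2 ≤ ∑ b, max (-φ b y + φ b z) 0 ^ 2 :=
      (pow_le_pow_left₀ (hφz b).le h1 2).trans
        (Finset.single_le_sum (f := fun b => max (-φ b y + φ b z) 0 ^ 2)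
          (fun b _ => by positivity) (Finset.mem_univ b))
    have h3 := mul_le_mul_of_nonneg_left h2 hN0
    have := hNb b
    nlinarith [sq_nonneg ‖y - x‖]
  have hyx : y ≠ x := fun h => by
    have := hφy (Classical.arbitrary B)
    rw [h, hφx] at this
    exact lt_irrefl _ this
  have hyS : y ∈ S := (Set.mem_insert_iff.1 hyC.2.1).resolve_left hyx
  have hyr : y ∈ Metric.ball x r' := by
    rw [Metric.mem_ball, dist_eq_norm]
    linarith
  obtain ⟨ξ, hξ, w, hw, hrel⟩ := exists_multipliers_of_penalty (f := fun _ => (0 : ℝ))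
    (φ := fun b u => -φ b u) (e := e) (x := x) (z := y) (N := N) (s := fun b => φ b z) hN0
    ((LipschitzWith.const 0).locallyLipschitz.lipNear y) (fun b => (hφ y b).neg) he hyC.2.2
    (hli y (Metric.ball_subset_ball hr2.le hyr)) (by
      filter_upwards [hS.mem_nhds hyS, Metric.isOpen_ball.mem_nhds hyr] with y' h1 h2 h3
      have := hymin ⟨Metric.ball_subset_closedBall h2, Set.mem_insert_of_mem _ h1, h3⟩
      simpa using this)
  rw [eq_zero_of_mem_limitingSubdiff_const hξ, zero_add] at hrel
  refine ⟨y, hyS, hnorm, hyC.2.2, hφy,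
    fun b => N * max (-φ b y + φ b z) 0, w, hw, ?_⟩
  have := (gradSpan e y).smul_mem (2⁻¹ : ℝ) hrel
  rw [smul_add, smul_smul, Finset.smul_sum] at this
  convert this using 2
  · refine Finset.sum_congr rfl fun b _ => ?_
    rw [smul_smul]
    congr 1
    ring
  · norm_num

/-- A function whose gradient stays in the span of the independent gradients of `e` vanishes on the
zero set of `e`, near a common zero. -/
theorem eventually_nonpos_of_gradient_mem_gradSpan {f : E → ℝ} {e : J → E → ℝ} {x : E}
    (hf : ContDiff ℝ 1 f) (he : ∀ j, ContDiff ℝ 1 (e j)) (hfx : f x = 0) (hex : ∀ j, e j x = 0)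
    (hli : LinearIndependent ℝ fun j => gradient (e j) x)
    (hspan : ∀ᶠ y in 𝓝 x, gradient f y ∈ gradSpan e y) :
    ∀ᶠ y in 𝓝 x, (∀ j, e j y = 0) → f y ≤ 0 := by
  by_contra hcon
  have hfr : ∃ᶠ y in 𝓝 x, (∀ j, e j y = 0) ∧ 0 < f y := by
    refine hcon.imp fun h => h.mono fun y hy hey => ?_
    by_contra h'
    exact hy ⟨hey, not_le.1 h'⟩
  obtain ⟨r, hr, hball⟩ := Metric.eventually_nhds_iff_ball.1
    (hspan.and (eventually_linearIndependent_gradients he hli))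
  have hex' : ∀ n : ℕ, ∃ y, dist y x < 1 / ((n : ℝ) + 1) ∧ (y ≠ x ∧ (∀ j, e j y = 0) ∧
      y - x ∈ gradSpan e y) := fun n => by
    obtain ⟨z, ⟨h1, h2⟩, h3⟩ := (hfr.and_eventually (Metric.ball_mem_nhds x
      (lt_min hr (show (0 : ℝ) < 1 / ((n : ℝ) + 1) by positivity)))).exists
    rw [lt_min_iff] at h3
    have hzx : z ≠ x := fun h => by
      rw [h, hfx] at h2
      exact lt_irrefl _ h2
    -- At such a point y - x is a combination of -∇f(y) and gradients of e. As ∇f(y) lies in their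
    -- span, so does y - x.
    obtain ⟨y, hyS, hy1, hy2, -, β, w, hw, hrel⟩ := exists_radial_stationary_point (B := Unit)
      (S := {x}ᶜ) (φ := fun _ => f) isOpen_compl_singleton (by simp [Set.insert_eq])
      (fun z _ => hf.lipNear z) (fun _ => hfx) he (fun y hy => (hball y hy).2)
      (Metric.mem_ball.2 h3.1) (by simpa using hzx) (fun _ => h2) h1
    have hyz : dist y x ≤ dist z x := by simpa [dist_eq_norm] using hy1
    refine ⟨y, hyz.trans_lt h3.2, by simpa using hyS, hy2, ?_⟩
    have hwf : w () = -gradient f y := by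
      have := hw ()
      rw [hf.neg.limitingSubdiff_eq, gradient_neg' hf] at this
      exact this
    have hgy := (hball y (Metric.mem_ball.2 (hyz.trans_lt h3.1))).1
    have := (gradSpan e y).add_mem hrel ((gradSpan e y).smul_mem (β ()) hgy)
    simpa [hwf] using this
  choose y hy1 hyx hey hyspan using hex'
  have hyt : Tendsto y (hyperfilter ℕ) (𝓝 x) :=
    (tendsto_of_dist_lt_one_div hy1).mono_left Nat.hyperfilter_le_atTop
  obtain ⟨u, hu1, hu⟩ := exists_tendsto_direction (hyperfilter ℕ)
    (Eventually.of_forall hyx)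
  -- The limiting direction is normal to the zero set of e and, since the y n stay on it, also
  -- tangent. A unit vector cannot be both.
  have h1 : u ∈ gradSpan e x := mem_gradSpan_of_tendsto (hyperfilter ℕ) he hli hyt hu
    (Eventually.of_forall fun n => (gradSpan e _).smul_mem _ (hyspan n))
  have h2 := inner_eq_zero_of_mem_gradSpan (fun j => inner_gradient_eq_zero_of_tendsto (he j) hyt
    (Eventually.of_forall hyx) hu (Eventually.of_forall fun n => hey n j) (hex j)) h1
  rw [real_inner_self_eq_norm_sq, hu1] at h2
  norm_num at h2

theorem eventually_eq_zero_of_gradient_mem_gradSpan {f : E → ℝ} {e : J → E → ℝ} {x : E}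
    (hf : ContDiff ℝ 1 f) (he : ∀ j, ContDiff ℝ 1 (e j)) (hfx : f x = 0) (hex : ∀ j, e j x = 0)
    (hli : LinearIndependent ℝ fun j => gradient (e j) x)
    (hspan : ∀ᶠ y in 𝓝 x, gradient f y ∈ gradSpan e y) :
    ∀ᶠ y in 𝓝 x, (∀ j, e j y = 0) → f y = 0 := by
  filter_upwards [eventually_nonpos_of_gradient_mem_gradSpan hf he hfx hex hli hspan,
    eventually_nonpos_of_gradient_mem_gradSpan hf.neg he (by simp [hfx]) hex hli
      (hspan.mono fun y hy => by
        have := gradient_neg' hf y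
        change gradient (fun y => -f y) y ∈ _
        rw [this]
        exact Submodule.neg_mem _ hy)] with y h1 h2 h3
  have := h2 h3
  linarith [h1 h3]

set_option maxHeartbeats 1000000 in
/-- A mean value inequality for a sum of Lipschitz functions along the segment from `x` to
`x + t • u`. -/
theorem exists_mean_value_subgradients_of_unit {S : Set E} {φ : B → E → ℝ} {x p u : E}
    {L r η t R : ℝ}
    (hS : IsOpen S) (hxS : IsClosed (insert x S)) (hφ : ∀ z b, LipNear (φ b) z)
    (hL : 0 ≤ L) (hη : 0 < η)
    (hΦ : ∀ y ∈ Metric.ball x r, |∑ b, φ b y| ≤ L * ‖y - x‖) (hpS : p ∈ S) (hu1 : ‖u‖ = 1)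
    (ht0 : 0 < t) (hpt : p - x = t • u) (hR : R = t * (4 * L + 4 * η) / η) (hr : R < r) :
    ∃ c ∈ S, ‖c - x‖ ≤ R ∧ ∃ ξ : B → E,
      (∀ b, ξ b ∈ limitingSubdiff (fun u => -φ b u) c) ∧
      (∑ b, φ b p) / t - η ≤ ∑ b, inner ℝ (-ξ b) u := by
  have hφc : ∀ b, Continuous (φ b) := fun b =>
    continuous_iff_continuousAt.2 fun z => (hφ z b).continuousAt
  have ht : t = ‖p - x‖ := by rw [hpt, norm_smul, hu1, mul_one, Real.norm_of_nonneg ht0.le]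
  have huu : inner ℝ u u = (1 : ℝ) := by rw [real_inner_self_eq_norm_sq, hu1, one_pow]
  have hpu : inner ℝ u (p - x) = t := by rw [hpt, real_inner_smul_right, huu, mul_one]
  have hRt : t ≤ R := by
    rw [hR, le_div_iff₀ hη]
    nlinarith [mul_nonneg ht0.le hL, mul_pos ht0 hη]
  have hR0 : 0 < R := ht0.trans_le hRt
  -- Write s = ⟪u, y - x⟫. The test function H is ρ s + κ s², plus N times the squared distance to
  -- the line x + ℝu, minus Σ φ b. At an interior minimizer c the subgradients satisfy Σ ⟪-ξ b, u⟫ =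
  -- ρ + 2κ s with s > 0: the transversal term is orthogonal to u.
  obtain ⟨ρ, hρ⟩ : ∃ ρ, ρ = (∑ b, φ b p) / t - η := ⟨_, rfl⟩
  rw [← hρ]
  -- This gives H p = -(η t / 2), and κ R = 2L + 2η dominates the linear terms on the sphere of
  -- radius R, so c does not lie on the sphere.
  obtain ⟨κ, hκ⟩ : ∃ κ, κ = η / (2 * t) := ⟨_, rfl⟩
  have hκ0 : 0 < κ := by rw [hκ]; positivity
  -- The second summand makes H larger than -(η t / 2) on the face s = 0, so c has s > 0 and in
  -- particular differs from x.
  obtain ⟨N, hN⟩ : ∃ N, N = κ + L ^ 2 / (η * t) := ⟨_, rfl⟩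
  have hNκ : κ ≤ N := hN ▸ le_add_of_nonneg_right (by positivity)
  obtain ⟨H, hH⟩ : ∃ H : E → ℝ, H = fun y => ρ * inner ℝ u (y - x) +
    κ * inner ℝ u (y - x) ^ 2 + N * (‖y - x‖ ^ 2 - inner ℝ u (y - x) ^ 2) - ∑ b, φ b y :=
    ⟨_, rfl⟩
  have hHc : Continuous H := by
    rw [hH]
    fun_prop
  set C := Metric.closedBall x R ∩ (insert x S ∩ {y | 0 ≤ inner ℝ u (y - x)}) with hC
  have hCc : IsCompact C := (isCompact_closedBall x R).inter_right
    (hxS.inter (isClosed_le continuous_const (by fun_prop)))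
  have hpC : p ∈ C := ⟨by rw [Metric.mem_closedBall, dist_eq_norm]; exact ht ▸ hRt,
    Set.mem_insert_of_mem _ hpS, by
      change 0 ≤ inner ℝ u (p - x)
      rw [hpu]
      exact ht0.le⟩
  obtain ⟨c, hcC, hcmin⟩ := hCc.exists_isMinOn ⟨p, hpC⟩ hHc.continuousOn
  have hpr : p ∈ Metric.ball x r := by
    rw [Metric.mem_ball, dist_eq_norm]
    exact (ht ▸ hRt).trans_lt hr
  have hHp : H p = -(η * t / 2) := by
    simp only [hH, hpu, ← ht, hρ, hκ]
    field_simp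
    ring
  have hHc' : H c ≤ -(η * t / 2) := hHp ▸ hcmin hpC
  have hcR : ‖c - x‖ ≤ R := by simpa [dist_eq_norm] using hcC.1
  have hs0 : 0 ≤ inner ℝ u (c - x) := hcC.2.2
  have hcs : inner ℝ u (c - x) ≤ ‖c - x‖ := by
    have := real_inner_le_norm u (c - x)
    rwa [hu1, one_mul] at this
  have hΦc := hΦ c (by rw [Metric.mem_ball, dist_eq_norm]; exact hcR.trans_lt hr)
  have hΦc' := le_of_abs_le hΦc
  have hΦp : -(L + η) ≤ ρ := by
    have := neg_le_of_abs_le (hΦ p hpr)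
    rw [← ht] at this
    rw [hρ]
    have : -L ≤ (∑ b, φ b p) / t := by
      rw [le_div_iff₀ ht0]
      linarith
    linarith
  have hspos : 0 < inner ℝ u (c - x) := by
    refine lt_of_le_of_ne hs0 fun h0 => ?_
    have h1 : H c = N * ‖c - x‖ ^ 2 - ∑ b, φ b c := by simp [hH, ← h0]
    have h2 : L ^ 2 / (η * t) * ‖c - x‖ ^ 2 ≤ N * ‖c - x‖ ^ 2 :=
      mul_le_mul_of_nonneg_right (hN ▸ le_add_of_nonneg_left hκ0.le) (by positivity)
    have h3 : 0 < L ^ 2 / (η * t) * ‖c - x‖ ^ 2 - L * ‖c - x‖ + η * t / 2 := by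
      have hq : 0 < η * t := by positivity
      have h4 : L ^ 2 / (η * t) * ‖c - x‖ ^ 2 - L * ‖c - x‖ + η * t / 2 =
          ((L * ‖c - x‖) ^ 2 - L * ‖c - x‖ * (η * t) + (η * t) ^ 2 / 2) / (η * t) := by
        field_simp
      rw [h4]
      refine div_pos ?_ hq
      nlinarith [sq_nonneg (L * ‖c - x‖ - η * t / 2), sq_pos_of_pos hq]
    linarith
  have hcx : c ≠ x := fun h => by simp [h] at hspos
  have hcS : c ∈ S := (Set.mem_insert_iff.1 hcC.2.1).resolve_left hcx
  have hcR' : ‖c - x‖ < R := by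
    refine lt_of_le_of_ne hcR fun h0 => ?_
    have hκR : κ * R = 2 * L + 2 * η := by
      rw [hκ, hR]
      field_simp
      ring
    have h1 : κ * R ^ 2 ≤ κ * inner ℝ u (c - x) ^ 2 +
        N * (‖c - x‖ ^ 2 - inner ℝ u (c - x) ^ 2) := by
      have h2 : 0 ≤ ‖c - x‖ ^ 2 - inner ℝ u (c - x) ^ 2 := by nlinarith
      have := mul_le_mul_of_nonneg_right hNκ h2
      rw [← h0]
      linarith
    have h2 : -(L + η) * R ≤ ρ * inner ℝ u (c - x) := by
      have h3 := mul_le_mul_of_nonneg_right hΦp hs0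
      have h4 : inner ℝ u (c - x) ≤ R := hcs.trans hcR
      have h5 := mul_le_mul_of_nonneg_left h4 (add_nonneg hL hη.le)
      linarith
    have h3 : κ * R ^ 2 = (2 * L + 2 * η) * R := by rw [pow_two, ← mul_assoc, hκR]
    have h4 : H c = ρ * inner ℝ u (c - x) + (κ * inner ℝ u (c - x) ^ 2 +
        N * (‖c - x‖ ^ 2 - inner ℝ u (c - x) ^ 2)) - ∑ b, φ b c := by
      simp only [hH]
      ring
    rw [h0] at hΦc'
    have := mul_pos hη hR0
    have := mul_pos hη ht0
    linarith
  obtain ⟨ξ, hξ, hsum⟩ := exists_subgradients_of_isLocalMin (ψ := fun b u => -φ b u) (z := c)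
    (ζ := (ρ + 2 * κ * inner ℝ u (c - x)) • u + (2 * N) • ((c - x) - inner ℝ u (c - x) • u))
    (K := κ + N) (fun b => (hφ c b).neg) (by
      have hopen : IsOpen {y | 0 < inner ℝ u (y - x)} :=
        isOpen_lt continuous_const (by fun_prop)
      have hball : c ∈ Metric.ball x R := by rw [Metric.mem_ball, dist_eq_norm]; exact hcR'
      filter_upwards [hS.mem_nhds hcS, Metric.isOpen_ball.mem_nhds hball,
        hopen.mem_nhds hspos] with y h1 h2 h3
      have h4 : H c ≤ H y :=
        hcmin ⟨Metric.ball_subset_closedBall h2, Set.mem_insert_of_mem _ h1, le_of_lt h3⟩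
      have h5 : ‖y - x‖ ^ 2 = ‖c - x‖ ^ 2 + 2 * inner ℝ (c - x) (y - c) + ‖y - c‖ ^ 2 := by
        rw [← norm_add_sq_real]
        congr 2
        abel
      have h6 : inner ℝ u (y - x) = inner ℝ u (c - x) + inner ℝ u (y - c) := by
        rw [← inner_add_right]
        congr 1
        abel
      have h7 : inner ℝ u (y - c) ^ 2 ≤ ‖y - c‖ ^ 2 := by
        have := abs_real_inner_le_norm u (y - c)
        rw [hu1, one_mul] at this
        rw [← sq_abs]
        exact pow_le_pow_left₀ (abs_nonneg _) this 2
      have h8 : inner ℝ ((ρ + 2 * κ * inner ℝ u (c - x)) • u +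
          (2 * N) • ((c - x) - inner ℝ u (c - x) • u)) y =
          inner ℝ ((ρ + 2 * κ * inner ℝ u (c - x)) • u +
          (2 * N) • ((c - x) - inner ℝ u (c - x) • u)) c +
          ((ρ + 2 * κ * inner ℝ u (c - x)) * inner ℝ u (y - c) +
          2 * N * (inner ℝ (c - x) (y - c) - inner ℝ u (c - x) * inner ℝ u (y - c))) := by
        rw [← sub_eq_iff_eq_add', ← inner_sub_right, inner_add_left, real_inner_smul_left,
          real_inner_smul_left, inner_sub_left, real_inner_smul_left]
      rw [h8]
      simp only [hH, h5, h6, Finset.sum_neg_distrib] at h4 ⊢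
      have h9 := mul_le_mul_of_nonneg_left h7 hκ0.le
      have h10 : 0 ≤ N * inner ℝ u (y - c) ^ 2 := mul_nonneg (hκ0.le.trans hNκ) (sq_nonneg _)
      linarith)
  refine ⟨c, hcS, hcR, ξ, hξ, ?_⟩
  have h1 : ∑ b, inner ℝ (-ξ b) u = inner ℝ ((ρ + 2 * κ * inner ℝ u (c - x)) • u +
      (2 * N) • ((c - x) - inner ℝ u (c - x) • u)) u := by
    rw [← sum_inner, Finset.sum_neg_distrib, neg_eq_of_add_eq_zero_right hsum]
  rw [h1, inner_add_left, real_inner_smul_left, real_inner_smul_left, inner_sub_left,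
    real_inner_smul_left, huu, real_inner_comm u (c - x)]
  rw [real_inner_comm] at hspos
  nlinarith [mul_pos hκ0 hspos]

/-- A mean value inequality for a sum of Lipschitz functions along a ray. -/
theorem exists_mean_value_subgradients {S : Set E} {φ : B → E → ℝ} {x p : E} {L r η : ℝ}
    (hS : IsOpen S) (hxS : IsClosed (insert x S)) (hφ : ∀ z b, LipNear (φ b) z)
    (hL : 0 ≤ L) (hη : 0 < η)
    (hΦ : ∀ y ∈ Metric.ball x r, |∑ b, φ b y| ≤ L * ‖y - x‖) (hpS : p ∈ S) (hpx : p ≠ x)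
    (hr : ‖p - x‖ * (4 * L + 4 * η) / η < r) :
    ∃ c ∈ S, ‖c - x‖ ≤ ‖p - x‖ * (4 * L + 4 * η) / η ∧ ∃ ξ : B → E,
      (∀ b, ξ b ∈ limitingSubdiff (fun u => -φ b u) c) ∧
      (∑ b, φ b p) / ‖p - x‖ - η ≤ ∑ b, inner ℝ (-ξ b) (‖p - x‖⁻¹ • (p - x)) := by
  have ht0 : 0 < ‖p - x‖ := norm_pos_iff.2 (sub_ne_zero.2 hpx)
  exact exists_mean_value_subgradients_of_unit hS hxS hφ hL hη hΦ hpS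
    (norm_inv_norm_smul (sub_ne_zero.2 hpx)) ht0 (by rw [smul_inv_smul₀ ht0.ne']) rfl hr

end Directions

/-! ### Minimal positive relations and their propagation -/

section MinimalRelations

variable {E : Type*} [NormedAddCommGroup E] [InnerProductSpace ℝ E] [CompleteSpace E]
  [FiniteDimensional ℝ E] {A J : Type*} [Fintype A] [Fintype J]

/-- `lam` are the coefficients of a convex combination of the `v a`, `a ∈ I`, that lies in the span
of the gradients of the equality constraints. -/
def IsPosRel (e : J → E → ℝ) (I : Finset A) (y : E) (v : A → E) (lam : A → ℝ) : Prop :=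
  (∀ a, 0 ≤ lam a) ∧ (∀ a ∉ I, lam a = 0) ∧ ∑ a, lam a = 1 ∧ ∑ a, lam a • v a ∈ gradSpan e y

/-- The graph over `S` of the family of subdifferentials. -/
def subgradGraph (φ : A → E → ℝ) (S : Set E) : Set (E × (A → E)) :=
  {q | q.1 ∈ S ∧ ∀ a, q.2 a ∈ limitingSubdiff (φ a) q.1}

theorem mem_limitingSubdiff_of_mem_closure_graph {φ : A → E → ℝ} {S : Set E} {x : E} {v : A → E}
    (hφ : ∀ a, LipNear (φ a) x) (h : (x, v) ∈ closure (subgradGraph φ S)) (a : A) :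
    v a ∈ limitingSubdiff (φ a) x := by
  have := mem_closure_iff_nhdsWithin_neBot.1 h
  refine limitingSubdiff_closed (F := 𝓝[subgradGraph φ S] (x, v)) (y := fun q => q.1)
    (w := fun q => q.2 a) ?_ ?_ ?_ (hφ a).continuousAt
  · filter_upwards [self_mem_nhdsWithin] with q hq
    exact hq.2 a
  · exact (continuous_fst.tendsto (x, v)).mono_left nhdsWithin_le_nhds
  · exact (((continuous_apply a).comp continuous_snd).tendsto (x, v)).mono_left nhdsWithin_le_nhds

theorem mem_closure_graph_of_tendsto {ι : Type*} {F : Filter ι} [F.NeBot] {φ : A → E → ℝ}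
    {S : Set E} {x : E} {y : ι → E} {v : ι → A → E} {w : A → E} (hy : Tendsto y F (𝓝 x))
    (hv : Tendsto v F (𝓝 w)) (hyS : ∀ᶠ t in F, y t ∈ S)
    (hsel : ∀ᶠ t in F, ∀ a, v t a ∈ limitingSubdiff (φ a) (y t)) :
    (x, w) ∈ closure (subgradGraph φ S) :=
  mem_closure_of_tendsto (hy.prodMk_nhds hv) (hyS.and hsel)

/-- The normalization to total weight one bounds the coefficients and survives in the limit. -/
theorem IsPosRel.exists_tendsto {ι : Type*} (U : Ultrafilter ι) {e : J → E → ℝ} {I : Finset A}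
    {x : E} (he : ∀ j, ContDiff ℝ 1 (e j)) (hli : LinearIndependent ℝ fun j => gradient (e j) x)
    {y : ι → E} {v : ι → A → E} {w : A → E} {lam : ι → A → ℝ} (hy : Tendsto y U (𝓝 x))
    (hv : Tendsto v U (𝓝 w)) (h : ∀ᶠ t in U, IsPosRel e I (y t) (v t) (lam t)) :
    ∃ l, Tendsto lam U (𝓝 l) ∧ IsPosRel e I x w l := by
  obtain ⟨l, hl⟩ := U.exists_tendsto_of_bounded (s := lam) (a := 0) (R := 1) (by
    filter_upwards [h] with t ht
    rw [dist_zero_right, pi_norm_le_iff_of_nonneg zero_le_one]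
    intro a
    rw [Real.norm_of_nonneg (ht.1 a), ← ht.2.2.1]
    exact Finset.single_le_sum (fun a _ => ht.1 a) (Finset.mem_univ a))
  have hl' := tendsto_pi_nhds.1 hl
  refine ⟨l, hl, fun a => ge_of_tendsto (hl' a) (h.mono fun t ht => ht.1 a), fun a ha => ?_, ?_, ?_⟩
  · exact tendsto_nhds_unique (hl' a)
      (tendsto_const_nhds.congr' (h.mono fun t ht => (ht.2.1 a ha).symm))
  · exact tendsto_nhds_unique (tendsto_finsetSum _ fun a _ => hl' a)
      (tendsto_const_nhds.congr' (h.mono fun t ht => ht.2.2.1.symm))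
  · exact mem_gradSpan_of_tendsto U he hli hy (tendsto_sum_smul hv hl)
      (h.mono fun t ht => ht.2.2.2)

theorem IsPosRel.ne_zero {e : J → E → ℝ} {I : Finset A} {y : E} {v : A → E} {lam : A → ℝ}
    (h : IsPosRel e I y v lam) : lam ≠ 0 := fun h0 => by
  have := h.2.2.1
  simp [h0] at this

theorem IsPosRel.nonempty {e : J → E → ℝ} {I : Finset A} {y : E} {v : A → E} {lam : A → ℝ}
    (h : IsPosRel e I y v lam) : I.Nonempty := by
  obtain ⟨a, ha⟩ := Function.ne_iff.1 h.ne_zero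
  exact ⟨a, by_contra fun h' => ha (h.2.1 a h')⟩

theorem exists_isPosRel_of_nonneg {e : J → E → ℝ} {I : Finset A} {y : E} {v : A → E} {c : A → ℝ}
    (h0 : ∀ a, 0 ≤ c a) (hne : c ≠ 0) (hI : ∀ a ∉ I, c a = 0)
    (hrel : ∑ a, c a • v a ∈ gradSpan e y) : ∃ lam, IsPosRel e I y v lam := by
  have hpos : 0 < ∑ a, c a := by
    obtain ⟨a, ha⟩ := Function.ne_iff.1 hne
    exact Finset.sum_pos' (fun a _ => h0 a)
      ⟨a, Finset.mem_univ a, lt_of_le_of_ne (h0 a) (Ne.symm ha)⟩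
  refine ⟨fun a => (∑ a, c a)⁻¹ * c a, fun a => mul_nonneg (inv_nonneg.2 hpos.le) (h0 a),
    fun a ha => by simp [hI a ha], ?_, ?_⟩
  · rw [← Finset.mul_sum, inv_mul_cancel₀ hpos.ne']
  · simp only [mul_smul, ← Finset.smul_sum]
    exact (gradSpan e y).smul_mem _ hrel

/-- `I` is minimal among the index sets that carry a positive relation between subgradients at `x`
that are limits of subgradients at points of `S`. -/
structure IsMinimalRel (φ : A → E → ℝ) (e : J → E → ℝ) (x : E) (S : Set E) (I : Finset A) :
    Prop where
  exists_rel : ∃ v lam, (x, v) ∈ closure (subgradGraph φ S) ∧ IsPosRel e I x v lam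
  minimal : ∀ I' ⊂ I, ∀ v lam, (x, v) ∈ closure (subgradGraph φ S) → ¬ IsPosRel e I' x v lam

theorem exists_isMinimalRel {φ : A → E → ℝ} {e : J → E → ℝ} {x : E} {S : Set E} {I₀ : Finset A}
    (h : ∃ v lam, (x, v) ∈ closure (subgradGraph φ S) ∧ IsPosRel e I₀ x v lam) :
    ∃ I ⊆ I₀, IsMinimalRel φ e x S I := by
  induction I₀ using Finset.strongInduction with
  | H I₀ ih =>
    by_cases hex : ∃ I' ⊂ I₀, ∃ v lam, (x, v) ∈ closure (subgradGraph φ S) ∧ IsPosRel e I' x v lam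
    · obtain ⟨I', h1, h2⟩ := hex
      obtain ⟨I, h3, h4⟩ := ih I' h1 h2
      exact ⟨I, h3.trans h1.1, h4⟩
    · exact ⟨I₀, subset_rfl, h, fun I' hI' v lam hv hrel => hex ⟨I', hI', v, lam, hv, hrel⟩⟩

namespace IsMinimalRel

variable {φ : A → E → ℝ} {e : J → E → ℝ} {x : E} {S : Set E} {I : Finset A}

/-- A vanishing coefficient would let `I.erase a` carry the same relation. -/
theorem pos (h : IsMinimalRel φ e x S I) {v : A → E} {lam : A → ℝ}
    (hv : (x, v) ∈ closure (subgradGraph φ S)) (hrel : IsPosRel e I x v lam) {a : A}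
    (ha : a ∈ I) : 0 < lam a := by
  classical
  refine lt_of_le_of_ne (hrel.1 a) fun h0 => ?_
  refine h.minimal (I.erase a) (Finset.erase_ssubset ha) v lam hv
    ⟨hrel.1, fun b hb => ?_, hrel.2.2⟩
  by_cases hba : b = a
  · rw [hba, ← h0]
  · exact hrel.2.1 b fun hbI => hb (Finset.mem_erase.2 ⟨hba, hbI⟩)

/-- A minimal index set is a circuit modulo the gradients of e: from a second, non-proportional
relation the ratio test would produce a positive relation on a proper subset. -/
theorem eq_smul (h : IsMinimalRel φ e x S I) {v : A → E} {lam α : A → ℝ}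
    (hv : (x, v) ∈ closure (subgradGraph φ S)) (hrel : IsPosRel e I x v lam)
    (hα : ∀ a ∉ I, α a = 0) (hαrel : ∑ a, α a • v a ∈ gradSpan e x) :
    ∃ c : ℝ, α = c • lam := by
  classical
  obtain ⟨a₀, ha₀⟩ := hrel.nonempty
  have hl₀ := h.pos hv hrel ha₀
  refine ⟨α a₀ / lam a₀, ?_⟩
  by_contra hne
  -- The correction makes the entry at a₀ vanish, so the coefficient lam a₀ > 0 survives the
  -- elimination and the new relation is nontrivial.
  have hβ : α - (α a₀ / lam a₀) • lam ≠ 0 := sub_ne_zero.2 hne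
  have hβ₀ : (α - (α a₀ / lam a₀) • lam) a₀ = 0 := by
    simp only [Pi.sub_apply, Pi.smul_apply, smul_eq_mul]
    field_simp
    ring
  have hsupp : ∀ a, lam a = 0 → (α - (α a₀ / lam a₀) • lam) a = 0 := fun a ha => by
    have : a ∉ I := fun haI => (h.pos hv hrel haI).ne' ha
    simp [ha, hα a this]
  have hβrel : ∑ a, (α - (α a₀ / lam a₀) • lam) a • v a ∈ gradSpan e x := by
    simp only [Pi.sub_apply, Pi.smul_apply, sub_smul, Finset.sum_sub_distrib, smul_assoc,
      ← Finset.smul_sum]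
    exact (gradSpan e x).sub_mem hαrel ((gradSpan e x).smul_mem _ hrel.2.2.2)
  obtain ⟨t, h1, a₁, h2, h3⟩ := exists_sub_smul_nonneg_vanishing hrel.1 hβ hsupp
  have ha₁ : a₁ ∈ I := by_contra fun h' => h2 (hrel.2.1 a₁ h')
  obtain ⟨l, hl⟩ := exists_isPosRel_of_nonneg (e := e) (I := I.erase a₁) (y := x) (v := v) h1
    (fun h0 => by
      have := congrFun h0 a₀
      simp only [hβ₀, Pi.zero_apply] at this
      linarith)
    (fun b hb => by
      by_cases hba : b = a₁
      · rw [hba, h3]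
      · have hbI : b ∉ I := fun hbI => hb (Finset.mem_erase.2 ⟨hba, hbI⟩)
        rw [hsupp b (hrel.2.1 b hbI), hrel.2.1 b hbI]
        ring)
    (by
      simp only [sub_smul, mul_smul, Finset.sum_sub_distrib, ← Finset.smul_sum]
      exact (gradSpan e x).sub_mem hrel.2.2.2 ((gradSpan e x).smul_mem _ hβrel))
  exact h.minimal _ (Finset.erase_ssubset ha₁) v l hv hl

/-- Near a limiting selection with a positive relation all selections have positive relations. -/
theorem eventually_isPosRel (h : IsMinimalRel φ e x S I) (hRC : RelaxedCPLD φ e x)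
    (hφ : ∀ a, LipNear (φ a) x) (he : ∀ j, ContDiff ℝ 1 (e j))
    (hli : LinearIndependent ℝ fun j => gradient (e j) x) (hxS : x ∉ S)
    {v : A → E} {lam : A → ℝ}
    (hv : (x, v) ∈ closure (subgradGraph φ S)) (hrel : IsPosRel e I x v lam) :
    ∀ᶠ q : E × (A → E) in 𝓝 (x, v), q ∈ subgradGraph φ S → ∃ l, IsPosRel e I q.1 q.2 l := by
  classical
  by_contra hcon
  have hRC' := hRC lam v hrel.1 hrel.ne_zero (mem_limitingSubdiff_of_mem_closure_graph hφ hv)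
    hrel.2.2.2
  have hfr : ∃ᶠ q : E × (A → E) in 𝓝 (x, v),
      q ∈ subgradGraph φ S ∧ ∀ l, ¬ IsPosRel e I q.1 q.2 l := by
    refine hcon.imp fun h => h.mono fun q hq hq' => ?_
    by_contra hno
    push Not at hno
    exact hq ⟨hq', hno⟩
  have hfr' := hfr.and_eventually hRC'
  have := frequently_iff_neBot.1 hfr'
  set U := Ultrafilter.of (𝓝 (x, v) ⊓ 𝓟 {q : E × (A → E) |
    (q ∈ subgradGraph φ S ∧ ∀ l, ¬ IsPosRel e I q.1 q.2 l) ∧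
    (q.1 ≠ x → (∀ a, q.2 a ∈ limitingSubdiff (φ a) q.1) →
      ∃ α : A → ℝ, α ≠ 0 ∧ (∀ a, lam a = 0 → α a = 0) ∧ ∑ a, α a • q.2 a ∈ gradSpan e q.1)})
    with hU
  have hUle := Ultrafilter.of_le (𝓝 (x, v) ⊓ 𝓟 {q : E × (A → E) |
    (q ∈ subgradGraph φ S ∧ ∀ l, ¬ IsPosRel e I q.1 q.2 l) ∧
    (q.1 ≠ x → (∀ a, q.2 a ∈ limitingSubdiff (φ a) q.1) →
      ∃ α : A → ℝ, α ≠ 0 ∧ (∀ a, lam a = 0 → α a = 0) ∧ ∑ a, α a • q.2 a ∈ gradSpan e q.1)})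
  rw [← hU] at hUle
  have hUn : (U : Filter (E × (A → E))) ≤ 𝓝 (x, v) := hUle.trans inf_le_left
  have hUev : ∀ᶠ q in U, q ∈ {q : E × (A → E) |
    (q ∈ subgradGraph φ S ∧ ∀ l, ¬ IsPosRel e I q.1 q.2 l) ∧
    (q.1 ≠ x → (∀ a, q.2 a ∈ limitingSubdiff (φ a) q.1) →
      ∃ α : A → ℝ, α ≠ 0 ∧ (∀ a, lam a = 0 → α a = 0) ∧ ∑ a, α a • q.2 a ∈ gradSpan e q.1)} :=
    (hUle.trans inf_le_right) (mem_principal_self _)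
  have hchoose : ∀ q : E × (A → E), ∃ α : A → ℝ, q ∈ subgradGraph φ S →
      (q.1 ≠ x → (∀ a, q.2 a ∈ limitingSubdiff (φ a) q.1) →
      ∃ α : A → ℝ, α ≠ 0 ∧ (∀ a, lam a = 0 → α a = 0) ∧ ∑ a, α a • q.2 a ∈ gradSpan e q.1) →
      ‖α‖ = 1 ∧ (∀ a, lam a = 0 → α a = 0) ∧ ∑ a, α a • q.2 a ∈ gradSpan e q.1 := fun q => by
    by_cases hq : q ∈ subgradGraph φ S ∧ (q.1 ≠ x → (∀ a, q.2 a ∈ limitingSubdiff (φ a) q.1) →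
      ∃ α : A → ℝ, α ≠ 0 ∧ (∀ a, lam a = 0 → α a = 0) ∧ ∑ a, α a • q.2 a ∈ gradSpan e q.1)
    · obtain ⟨α, h1, h2, h3⟩ := hq.2 (fun h0 => hxS (h0 ▸ hq.1.1)) hq.1.2
      refine ⟨‖α‖⁻¹ • α, fun _ _ => ⟨?_, fun a ha => by simp [h2 a ha], ?_⟩⟩
      · rw [norm_smul, norm_inv, norm_norm, inv_mul_cancel₀ (norm_ne_zero_iff.2 h1)]
      · simp only [Pi.smul_apply, smul_assoc, ← Finset.smul_sum]
        exact (gradSpan e q.1).smul_mem _ h3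
    · exact ⟨0, fun h1 h2 => absurd ⟨h1, h2⟩ hq⟩
  choose α hα using hchoose
  have hαev : ∀ᶠ q in U, ‖α q‖ = 1 ∧ (∀ a, lam a = 0 → α q a = 0) ∧
      ∑ a, α q a • q.2 a ∈ gradSpan e q.1 := hUev.mono fun q hq => hα q hq.1.1 hq.2
  obtain ⟨α', hα'⟩ := U.exists_tendsto_of_bounded (s := α) (a := 0) (R := 1)
    (hαev.mono fun q hq => by rw [dist_zero_right, hq.1])
  have hα'c := tendsto_pi_nhds.1 hα'
  have hfst : Tendsto (fun q : E × (A → E) => q.1) U (𝓝 x) :=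
    (continuous_fst.tendsto (x, v)).mono_left hUn
  have hsnd : Tendsto (fun q : E × (A → E) => q.2) U (𝓝 v) :=
    (continuous_snd.tendsto (x, v)).mono_left hUn
  have hα'1 : ‖α'‖ = 1 := tendsto_nhds_unique hα'.norm
    (tendsto_const_nhds.congr' (hαev.mono fun q hq => hq.1.symm))
  have hα'rel := mem_gradSpan_of_tendsto U he hli hfst (tendsto_sum_smul hsnd hα')
    (hαev.mono fun q hq => hq.2.2)
  have hα'I : ∀ a ∉ I, α' a = 0 := fun a ha => tendsto_nhds_unique (hα'c a)
    (tendsto_const_nhds.congr' (hαev.mono fun q hq => (hq.2.1 a (hrel.2.1 a ha)).symm))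
  -- `RelaxedCPLD` gives relations α q without sign information. Their normalized limit is a nonzero
  -- multiple c of lam, which is positive on I, so c α q is eventually positive on I.
  obtain ⟨c, hc⟩ := h.eq_smul hv hrel hα'I hα'rel
  have hc0 : c ≠ 0 := fun h0 => by simp [hc, h0] at hα'1
  have hsign : ∀ᶠ q in U, ∀ a ∈ I, 0 < c * α q a := by
    refine (eventually_all_finset I).2 fun a ha => ?_
    have h1 : 0 < c * α' a := by
      have := h.pos hv hrel ha
      simp only [hc, Pi.smul_apply, smul_eq_mul]
      rw [← mul_assoc]
      exact mul_pos (mul_self_pos.2 hc0) this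
    exact ((hα'c a).const_mul c).eventually (lt_mem_nhds h1)
  obtain ⟨q, hq1, hq2, hq3⟩ := (hUev.and (hαev.and hsign)).exists
  have hqI : ∀ a ∉ I, c * α q a = 0 := fun a ha => by
    rw [hq2.2.1 a (hrel.2.1 a ha), mul_zero]
  obtain ⟨a₀, ha₀⟩ := hrel.nonempty
  obtain ⟨l, hl⟩ := exists_isPosRel_of_nonneg (e := e) (I := I) (y := q.1) (v := q.2)
    (c := fun a => c * α q a) (fun a => by
      by_cases ha : a ∈ I
      · exact (hq3 a ha).le
      · exact (hqI a ha).ge) (fun h0 => (hq3 a₀ ha₀).ne' (congrFun h0 a₀)) hqI (by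
      simp only [mul_smul, ← Finset.smul_sum]
      exact (gradSpan e q.1).smul_mem _ hq2.2.2)
  exact hq1.1.2 l hl

/-- Positive relations persist, uniformly near `x`, under small changes of the selection. -/
theorem exists_uniform (h : IsMinimalRel φ e x S I) (hRC : RelaxedCPLD φ e x)
    (hφ : ∀ a, LipNear (φ a) x) (he : ∀ j, ContDiff ℝ 1 (e j))
    (hli : LinearIndependent ℝ fun j => gradient (e j) x) (hxS : x ∉ S) :
    ∃ τ > (0 : ℝ), ∀ q ∈ subgradGraph φ S, ∀ q' ∈ subgradGraph φ S, dist q.1 x < τ →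
      dist q'.1 x < τ → dist q.2 q'.2 < τ → (∃ l, IsPosRel e I q.1 q.2 l) →
      ∃ l, IsPosRel e I q'.1 q'.2 l := by
  by_contra hcon
  push Not at hcon
  -- If no τ works, there are two sequences of selections with a common limit. The relations of the
  -- first pass to the limit, and `eventually_isPosRel` transfers them to the second.
  choose q hq q' hq' h1 h2 h3 h4 h5 using fun n : ℕ => hcon (1 / ((n : ℝ) + 1)) (by positivity)
  choose l hl using h4
  have hy : Tendsto (fun n => (q n).1) (hyperfilter ℕ) (𝓝 x) :=
    (tendsto_of_dist_lt_one_div h1).mono_left Nat.hyperfilter_le_atTop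
  have hy' : Tendsto (fun n => (q' n).1) (hyperfilter ℕ) (𝓝 x) :=
    (tendsto_of_dist_lt_one_div h2).mono_left Nat.hyperfilter_le_atTop
  obtain ⟨w, hw, -⟩ := exists_tendsto_selection (hyperfilter ℕ) hφ hy
    (Eventually.of_forall fun n => (hq n).2)
  have hd : Tendsto (fun n => dist (q' n).2 (q n).2) (hyperfilter ℕ) (𝓝 0) := by
    refine Tendsto.mono_left ?_ Nat.hyperfilter_le_atTop
    refine squeeze_zero (fun _ => dist_nonneg) (fun n => ?_) tendsto_one_div_add_atTop_nhds_zero_nat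
    rw [dist_comm]
    exact (h3 n).le
  have hw' : Tendsto (fun n => (q' n).2) (hyperfilter ℕ) (𝓝 w) := by
    refine (tendsto_iff_of_dist ?_).1 hw
    simpa only [dist_comm] using hd
  obtain ⟨lam, -, hlam⟩ := IsPosRel.exists_tendsto (hyperfilter ℕ) he hli hy hw
    (Eventually.of_forall hl)
  have hcl := mem_closure_graph_of_tendsto (φ := φ) (S := S) hy hw
    (Eventually.of_forall fun n => (hq n).1) (Eventually.of_forall fun n => (hq n).2)
  have := (hy'.prodMk_nhds hw').eventually
    (h.eventually_isPosRel hRC hφ he hli hxS hcl hlam)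
  obtain ⟨n, hn⟩ := this.exists
  obtain ⟨l', hl'⟩ := hn (hq' n)
  exact h5 n l' hl'

end IsMinimalRel

/-- Outer semicontinuity, uniform over selections: selections at points tending to y are bounded and
accumulate at selections at y. -/
theorem eventually_exists_near_selection {φ : A → E → ℝ} {y : E} (hφ : ∀ z a, LipNear (φ a) z)
    {τ : ℝ} (hτ : 0 < τ) :
    ∀ᶠ y' in 𝓝 y, ∀ v' : A → E, (∀ a, v' a ∈ limitingSubdiff (φ a) y') →
      ∃ v : A → E, (∀ a, v a ∈ limitingSubdiff (φ a) y) ∧ dist v v' < τ := by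
  by_contra hcon
  have hfr : ∃ᶠ y' in 𝓝 y, ∃ v' : A → E, (∀ a, v' a ∈ limitingSubdiff (φ a) y') ∧
      ∀ v : A → E, (∀ a, v a ∈ limitingSubdiff (φ a) y) → τ ≤ dist v v' := by
    refine hcon.imp fun h => h.mono fun y' hy' v' hv' => ?_
    by_contra hno
    push Not at hno
    exact hy' ⟨v', hv', hno⟩
  have := frequently_iff_neBot.1 hfr
  obtain ⟨U, hUle⟩ : ∃ U : Ultrafilter E, (U : Filter E) ≤ 𝓝 y ⊓ 𝓟 {y' | ∃ v' : A → E,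
    (∀ a, v' a ∈ limitingSubdiff (φ a) y') ∧
      ∀ v : A → E, (∀ a, v a ∈ limitingSubdiff (φ a) y) → τ ≤ dist v v'} :=
    ⟨Ultrafilter.of _, Ultrafilter.of_le _⟩
  have hUev : ∀ᶠ y' in U, ∃ v' : A → E,
    (∀ a, v' a ∈ limitingSubdiff (φ a) y') ∧
      ∀ v : A → E, (∀ a, v a ∈ limitingSubdiff (φ a) y) → τ ≤ dist v v' :=
    (hUle.trans inf_le_right) (mem_principal_self _)
  have hch : ∀ y' : E, ∃ v' : A → E, (∃ v' : A → E,
    (∀ a, v' a ∈ limitingSubdiff (φ a) y') ∧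
      ∀ v : A → E, (∀ a, v a ∈ limitingSubdiff (φ a) y) → τ ≤ dist v v') →
    (∀ a, v' a ∈ limitingSubdiff (φ a) y') ∧
      ∀ v : A → E, (∀ a, v a ∈ limitingSubdiff (φ a) y) → τ ≤ dist v v' := fun y' => by
    by_cases h : ∃ v' : A → E, (∀ a, v' a ∈ limitingSubdiff (φ a) y') ∧
      ∀ v : A → E, (∀ a, v a ∈ limitingSubdiff (φ a) y) → τ ≤ dist v v'
    · obtain ⟨v', hv'⟩ := h
      exact ⟨v', fun _ => hv'⟩
    · exact ⟨0, fun h' => absurd h' h⟩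
  choose v' hv' using hch
  have hev := hUev.mono fun y' h => hv' y' h
  obtain ⟨w, hw, hwx⟩ := exists_tendsto_selection U (hφ y) (y := id) (hUle.trans inf_le_left)
    (hev.mono fun y' h => h.1)
  have : τ ≤ 0 := by
    have hd : Tendsto (fun y' => dist w (v' y')) U (𝓝 (dist w w)) := tendsto_const_nhds.dist hw
    rw [dist_self] at hd
    exact ge_of_tendsto hd (hev.mono fun y' h => h.2 w hwx)
  linarith

/-- Positive relations persist along a convex set of selections. -/
theorem exists_isPosRel_of_convex_chain {P : (A → E) → Prop} {C : Set (A → E)} {τ : ℝ}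
    (hτ : 0 < τ) (hC : Convex ℝ C)
    (hstep : ∀ v ∈ C, ∀ v' ∈ C, dist v v' < τ → P v → P v') {v v' : A → E} (hv : v ∈ C)
    (hv' : v' ∈ C) (hP : P v) : P v' := by
  -- The number of equal pieces of the segment, each shorter than τ.
  obtain ⟨n, hn⟩ := exists_nat_gt (dist v v' / τ)
  have hn0 : (0 : ℝ) < n := lt_of_le_of_lt (by positivity) hn
  have key : ∀ k : ℕ, k ≤ n → P (AffineMap.lineMap v v' ((k : ℝ) / n)) := by
    intro k
    induction k with
    | zero => intro _; simpa using hP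
    | succ k ih =>
      intro hk
      have hmem : ∀ j : ℕ, j ≤ n → (AffineMap.lineMap v v' ((j : ℝ) / n) : A → E) ∈ C :=
        fun j hj => hC.lineMap_mem hv hv' ⟨by positivity, by
          rw [div_le_one hn0]
          exact_mod_cast hj⟩
      refine hstep _ (hmem k (by omega)) _ (hmem (k + 1) hk) ?_ (ih (by omega))
      rw [dist_lineMap_lineMap, Real.dist_eq]
      have : ((k : ℝ) / n - ((k + 1 : ℕ) : ℝ) / n) = -(1 / n) := by
        push_cast
        field_simp
        ring
      rw [this, abs_neg, abs_of_pos (by positivity), one_div, inv_mul_eq_div, div_lt_iff₀ hn0]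
      rw [div_lt_iff₀ hτ] at hn
      linarith
  have := key n le_rfl
  rwa [div_self hn0.ne', AffineMap.lineMap_apply_one] at this

/-- For a minimal index set, all selections of subgradients at all points of `S` near `x` have
positive relations. -/
theorem IsMinimalRel.eventually_forall_isPosRel {φ : A → E → ℝ} {e : J → E → ℝ} {x : E}
    {S : Set E} {I : Finset A} (h : IsMinimalRel φ e x S I) (hRC : RelaxedCPLD φ e x)
    (hφ : ∀ z a, LipNear (φ a) z) (he : ∀ j, ContDiff ℝ 1 (e j))
    (hli : LinearIndependent ℝ fun j => gradient (e j) x)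
    (hreg : ∀ a, ∀ᶠ y in 𝓝 x, SubdiffRegularAt (φ a) y)
    (hS : IsOpen S) (hxS : x ∉ S) (hconn : ∀ ε > 0, IsPreconnected (S ∩ Metric.ball x ε)) :
    ∀ᶠ y in 𝓝 x, y ∈ S → ∀ v : A → E, (∀ a, v a ∈ limitingSubdiff (φ a) y) →
      ∃ l, IsPosRel e I y v l := by
  obtain ⟨τ, hτ, hunif⟩ := h.exists_uniform hRC (hφ x) he hli hxS
  obtain ⟨δ, hδ, hreg'⟩ := Metric.eventually_nhds_iff_ball.1 (eventually_all.2 hreg)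
  set ε := min τ δ with hε
  have hε0 : 0 < ε := lt_min hτ hδ
  have hstep : ∀ y ∈ S ∩ Metric.ball x ε, ∀ y' ∈ S ∩ Metric.ball x ε, ∀ v v' : A → E,
      (∀ a, v a ∈ limitingSubdiff (φ a) y) → (∀ a, v' a ∈ limitingSubdiff (φ a) y') →
      dist v v' < τ → (∃ l, IsPosRel e I y v l) → ∃ l, IsPosRel e I y' v' l :=
    fun y hy y' hy' v v' hv hv' hd hp =>
      hunif (y, v) ⟨hy.1, hv⟩ (y', v') ⟨hy'.1, hv'⟩ (lt_of_lt_of_le hy.2 (min_le_left _ _))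
        (lt_of_lt_of_le hy'.2 (min_le_left _ _)) hd hp
  -- At a fixed point regularity makes the set of selections convex, so a relation for one selection
  -- spreads to all of them by short steps.
  have hall : ∀ y ∈ S ∩ Metric.ball x ε, ∀ v v' : A → E,
      (∀ a, v a ∈ limitingSubdiff (φ a) y) → (∀ a, v' a ∈ limitingSubdiff (φ a) y) →
      (∃ l, IsPosRel e I y v l) → ∃ l, IsPosRel e I y v' l := fun y hy v v' hv hv' hp => by
    have hconv : Convex ℝ {v : A → E | ∀ a, v a ∈ limitingSubdiff (φ a) y} := by
      have h1 : ∀ a, Convex ℝ (limitingSubdiff (φ a) y) := fun a => by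
        rw [hreg' y (Metric.ball_subset_ball (min_le_right _ _) hy.2) a]
        exact convex_regularSubdiff _ _
      have := convex_pi (s := Set.univ) (t := fun a => limitingSubdiff (φ a) y) fun a _ => h1 a
      simpa [Set.pi] using this
    exact exists_isPosRel_of_convex_chain (P := fun v => ∃ l, IsPosRel e I y v l) hτ hconv
      (fun v hv v' hv' hd hp => hstep y hy y hy v v' hv hv' hd hp) hv hv' hp
  have hsel : ∀ y, ∃ v : A → E, ∀ a, v a ∈ limitingSubdiff (φ a) y := fun y =>
    ⟨fun a => (hφ y a).nonempty_limitingSubdiff.some,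
      fun a => (hφ y a).nonempty_limitingSubdiff.some_mem⟩
  set T := S ∩ Metric.ball x ε with hT
  have hTo : IsOpen T := hS.inter Metric.isOpen_ball
  -- Z and T \ Z are both open, because relations pass between nearby points along nearby
  -- selections. Since T is connected and meets Z, it lies in Z.
  set Z := {y ∈ T | ∃ v : A → E, (∀ a, v a ∈ limitingSubdiff (φ a) y) ∧ ∃ l, IsPosRel e I y v l}
    with hZ
  have hZo : IsOpen Z := by
    rw [isOpen_iff_mem_nhds]
    rintro y ⟨hyT, v, hv, hp⟩
    filter_upwards [hTo.mem_nhds hyT, eventually_exists_near_selection hφ hτ (y := y)]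
      with y' h1 h2
    obtain ⟨v', hv'⟩ := hsel y'
    obtain ⟨w, hw, hd⟩ := h2 v' hv'
    exact ⟨h1, v', hv', hstep y hyT y' h1 w v' hw hv' hd (hall y hyT v w hv hw hp)⟩
  have hZo' : IsOpen (T \ Z) := by
    rw [isOpen_iff_mem_nhds]
    rintro y ⟨hyT, hyZ⟩
    filter_upwards [hTo.mem_nhds hyT, eventually_exists_near_selection hφ hτ (y := y)]
      with y' h1 h2
    refine ⟨h1, ?_⟩
    rintro ⟨-, v', hv', hp⟩
    obtain ⟨w, hw, hd⟩ := h2 v' hv'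
    exact hyZ ⟨hyT, w, hw, hstep y' h1 y hyT v' w hv' hw (by rwa [dist_comm]) hp⟩
  have hne : (T ∩ Z).Nonempty := by
    obtain ⟨v, lam, hv, hrel⟩ := h.exists_rel
    have h1 := h.eventually_isPosRel hRC (hφ x) he hli hxS hv hrel
    have h2 : ∀ᶠ q : E × (A → E) in 𝓝 (x, v), q.1 ∈ Metric.ball x ε :=
      (continuous_fst.tendsto (x, v)).eventually (Metric.ball_mem_nhds x hε0)
    obtain ⟨q, hq, h3, h4⟩ := ((mem_closure_iff_frequently.1 hv).and_eventually (h1.and h2)).exists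
    exact ⟨q.1, ⟨hq.1, h4⟩, ⟨hq.1, h4⟩, q.2, hq.2, h3 hq⟩
  have hsub : T ⊆ Z := (hconn ε hε0).subset_left_of_subset_union hZo hZo'
    Set.disjoint_sdiff_right (fun y hy => by
      by_cases hyZ : y ∈ Z
      · exact Or.inl hyZ
      · exact Or.inr ⟨hy, hyZ⟩) hne
  filter_upwards [Metric.ball_mem_nhds x hε0] with y hy hyS v hv
  obtain ⟨-, v', hv', hp⟩ := hsub ⟨hyS, hy⟩
  exact hall y ⟨hyS, hy⟩ v' v hv' hv hp

end MinimalRelations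

/-! ### Constraints of a minimal relation are not all violated -/

section PositivePoints

variable {E : Type*} [NormedAddCommGroup E] [InnerProductSpace ℝ E] [CompleteSpace E]
  [FiniteDimensional ℝ E] {A J : Type*} [Fintype A] [Fintype J]

theorem exists_selection_extending {φ : A → E → ℝ} {y : E} (hφ : ∀ a, LipNear (φ a) y)
    {I : Finset A} {w : I → E} (hw : ∀ a : I, w a ∈ limitingSubdiff (φ a) y) :
    ∃ v : A → E, (∀ a, v a ∈ limitingSubdiff (φ a) y) ∧ ∀ a : I, v a = w a := by
  classical
  refine ⟨fun a => if h : a ∈ I then w ⟨a, h⟩ else (hφ a).nonempty_limitingSubdiff.some,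
    fun a => ?_, fun a => by simp⟩
  by_cases h : a ∈ I
  · simpa [h] using hw ⟨a, h⟩
  · simpa [h] using (hφ a).nonempty_limitingSubdiff.some_mem

/-- The radial point comes with subgradients of -φ a; regularity makes them negatives of
subgradients of φ a, and the signs are absorbed by the span. -/
theorem exists_radial_selection {I : Finset A} (hI : I.Nonempty) {S : Set E} {φ : A → E → ℝ}
    {e : J → E → ℝ} {x z : E} {r : ℝ} (hS : IsOpen S) (hxS : IsClosed (insert x S))
    (hφ : ∀ z a, LipNear (φ a) z) (hφx : ∀ a, φ a x = 0) (he : ∀ j, ContDiff ℝ 1 (e j))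
    (hli : ∀ y ∈ Metric.ball x r, LinearIndependent ℝ fun j => gradient (e j) y)
    (hreg : ∀ y ∈ Metric.ball x r, ∀ a, ∀ᶠ y' in 𝓝 y, SubdiffRegularAt (φ a) y')
    (hzr : z ∈ Metric.ball x r) (hzS : z ∈ S) (hφz : ∀ a ∈ I, 0 < φ a z) (hez : ∀ j, e j z = 0) :
    ∃ y ∈ S, ‖y - x‖ ≤ ‖z - x‖ ∧ (∀ j, e j y = 0) ∧ (∀ a ∈ I, 0 < φ a y) ∧
      ∃ v : A → E, (∀ a, v a ∈ limitingSubdiff (φ a) y) ∧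
        y - x ∈ Submodule.span ℝ (v '' I) ⊔ gradSpan e y := by
  have : Nonempty I := hI.to_subtype
  obtain ⟨y, hyS, hyz, hey, hφy, β, w, hw, hrel⟩ := exists_radial_stationary_point (B := I)
    (φ := fun a => φ a) hS hxS (fun z a => hφ z a) (fun a => hφx a) he hli hzr hzS
    (fun a => hφz a a.2) hez
  have hyr : y ∈ Metric.ball x r := by
    rw [Metric.mem_ball, dist_eq_norm] at hzr ⊢
    linarith
  obtain ⟨v, hv, hvw⟩ := exists_selection_extending (hφ y) (I := I) (w := fun a => -w a)
    fun a => neg_mem_limitingSubdiff_of_regular (hφ y a) (hreg y hyr a) (hw a)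
  refine ⟨y, hyS, hyz, hey, fun a ha => hφy ⟨a, ha⟩, v, hv, ?_⟩
  have h1 : ∑ a, β a • w a ∈ Submodule.span ℝ (v '' I) ⊔ gradSpan e y := by
    refine Submodule.mem_sup_left (Submodule.sum_mem _ fun a _ => Submodule.smul_mem _ _ ?_)
    rw [← neg_neg (w a), ← hvw a]
    exact Submodule.neg_mem _ (Submodule.subset_span ⟨a, a.2, rfl⟩)
  have := Submodule.sub_mem _ (Submodule.mem_sup_right hrel : _ ∈ Submodule.span ℝ (v '' I) ⊔ _) h1
  rwa [add_sub_cancel_left] at this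

/-- The mean value inequality in terms of subgradients of φ a; regularity changes the sign as in
`exists_radial_selection`. -/
theorem exists_mean_value_selection {I : Finset A} {S : Set E} {φ : A → E → ℝ} {x p : E}
    {L r η : ℝ} (hS : IsOpen S) (hxS : IsClosed (insert x S)) (hφ : ∀ z a, LipNear (φ a) z)
    (hL : 0 ≤ L) (hη : 0 < η)
    (hΦ : ∀ y ∈ Metric.ball x r, |∑ a ∈ I, φ a y| ≤ L * ‖y - x‖) (hpS : p ∈ S) (hpx : p ≠ x)
    (hreg : ∀ y ∈ Metric.ball x r, ∀ a, ∀ᶠ y' in 𝓝 y, SubdiffRegularAt (φ a) y')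
    (hr : ‖p - x‖ * (4 * L + 4 * η) / η < r) :
    ∃ c ∈ S, ‖c - x‖ ≤ ‖p - x‖ * (4 * L + 4 * η) / η ∧ ∃ w : A → E,
      (∀ a, w a ∈ limitingSubdiff (φ a) c) ∧
      (∑ a ∈ I, φ a p) / ‖p - x‖ - η ≤ ∑ a ∈ I, inner ℝ (w a) (‖p - x‖⁻¹ • (p - x)) := by
  obtain ⟨c, hcS, hc, ξ, hξ, hle⟩ := exists_mean_value_subgradients (B := I) (φ := fun a => φ a)
    hS hxS (fun z a => hφ z a) hL hη
    (fun y hy => by rw [Finset.sum_coe_sort I fun a => φ a y]; exact hΦ y hy) hpS hpx hr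
  have hcr : c ∈ Metric.ball x r := by
    rw [Metric.mem_ball, dist_eq_norm]
    linarith
  obtain ⟨w, hw, hwξ⟩ := exists_selection_extending (hφ c) (I := I) (w := fun a => -ξ a)
    fun a => neg_mem_limitingSubdiff_of_regular (hφ c a) (hreg c hcr a) (hξ a)
  refine ⟨c, hcS, hc, w, hw, ?_⟩
  rw [Finset.sum_coe_sort I fun a => φ a p] at hle
  rw [← Finset.sum_coe_sort I fun a => inner ℝ (w a) (‖p - x‖⁻¹ • (p - x))]
  simpa only [hwξ] using hle

theorem LipNear.exists_abs_sub_le {f : E → ℝ} {x : E} (hf : LipNear f x) :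
    ∃ L : ℝ, 0 ≤ L ∧ ∀ᶠ y in 𝓝 x, |f y - f x| ≤ L * ‖y - x‖ := by
  obtain ⟨K, U, hU, hK⟩ := hf
  refine ⟨K, K.2, ?_⟩
  filter_upwards [hU] with y hy
  have := hK.dist_le_mul y hy x (mem_of_mem_nhds hU)
  rwa [Real.dist_eq, dist_eq_norm] at this

namespace IsMinimalRel

variable {φ : A → E → ℝ} {e : J → E → ℝ} {x : E} {S : Set E} {I : Finset A}

/-- A relation avoiding a₀ is a multiple of lam that vanishes at a₀, where lam is positive, so it is
zero. -/
theorem linearIndependent_erase (h : IsMinimalRel φ e x S I)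
    (hli : LinearIndependent ℝ fun j => gradient (e j) x) {v : A → E} {lam : A → ℝ}
    (hv : (x, v) ∈ closure (subgradGraph φ S)) (hrel : IsPosRel e I x v lam) {a₀ : A}
    (ha₀ : a₀ ∈ I) :
    LinearIndependent ℝ (Sum.elim (fun a : {a // a ∈ I ∧ a ≠ a₀} => v a)
      fun j => gradient (e j) x) := by
  classical
  refine Fintype.linearIndependent_iff.2 fun β hβ => ?_
  rw [Fintype.sum_sum_type] at hβ
  simp only [Sum.elim_inl, Sum.elim_inr] at hβ
  obtain ⟨α, hα⟩ : ∃ α : A → ℝ, α = fun a => if h : a ∈ I ∧ a ≠ a₀ then β (Sum.inl ⟨a, h⟩) else 0 :=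
    ⟨_, rfl⟩
  have hsum : ∑ a, α a • v a = ∑ a : {a // a ∈ I ∧ a ≠ a₀}, β (Sum.inl a) • v a := by
    rw [← Finset.sum_subset (Finset.subset_univ (I.filter fun a => a ≠ a₀)) (fun a _ ha => by
      have : ¬ (a ∈ I ∧ a ≠ a₀) := by simpa using ha
      simp only [hα, this, dite_false, zero_smul]),
      Finset.sum_subtype (p := fun a => a ∈ I ∧ a ≠ a₀) _ (fun a => by simp)]
    refine Finset.sum_congr rfl fun a _ => ?_
    simp only [hα, a.2, dite_true, ne_eq, not_false_eq_true, and_self]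
  have hαrel : ∑ a, α a • v a ∈ gradSpan e x := by
    rw [hsum, eq_neg_of_add_eq_zero_left hβ]
    exact Submodule.neg_mem _ (Submodule.sum_mem _ fun j _ => Submodule.smul_mem _ _
      (Submodule.subset_span ⟨j, rfl⟩))
  obtain ⟨c, hc⟩ := h.eq_smul hv hrel (fun a ha => by
    have : ¬ (a ∈ I ∧ a ≠ a₀) := fun h' => ha h'.1
    simp only [hα, this, dite_false]) hαrel
  have hα0 : α = 0 := by
    have h1 := congrFun hc a₀
    have h2 : α a₀ = 0 := by simp [hα]
    rw [h2] at h1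
    simp only [Pi.smul_apply, smul_eq_mul] at h1
    rcases mul_eq_zero.1 h1.symm with h3 | h3
    · rw [hc, h3, zero_smul]
    · exact absurd h3 (h.pos hv hrel ha₀).ne'
  have hβl : ∀ a, β (Sum.inl a) = 0 := fun a => by
    have h1 := congrFun hα0 a
    simp only [hα, a.2, dite_true, Pi.zero_apply, ne_eq, not_false_eq_true, and_self] at h1
    exact h1
  simp only [hβl, zero_smul, Finset.sum_const_zero, zero_add] at hβ
  have := Fintype.linearIndependent_iff.1 hli _ hβ
  rintro (a | j)
  · exact hβl a
  · exact this j

/-- Let u be the limit of the directions from x to y n, and D a the limit of the difference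
quotients of φ a. Then u is orthogonal to the gradients of e, D a ≥ 0 on I, and regularity gives ⟪ξ,
u⟫ ≤ D a for all subgradients ξ at x. The mean value points force ⟪w' a, u⟫ = D a on I. The positive
relation of w' then gives D a = 0, and that of v' gives ⟪v' a, u⟫ = 0 on I. But u is in the span of
the v' a and the gradients of e, so it is orthogonal to itself. -/
theorem false_of_sequences (h : IsMinimalRel φ e x S I)
    (hφ : ∀ z a, LipNear (φ a) z) (hφx : ∀ a, φ a x = 0) (he : ∀ j, ContDiff ℝ 1 (e j))
    (hex : ∀ j, e j x = 0)
    (hli : LinearIndependent ℝ fun j => gradient (e j) x)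
    (hreg : ∀ a, SubdiffRegularAt (φ a) x) (hxS : x ∉ S) {y c : ℕ → E} {v w : ℕ → A → E}
    {lam mu : ℕ → A → ℝ} (hyS : ∀ n, y n ∈ S) (hcS : ∀ n, c n ∈ S)
    (hy : ∀ n : ℕ, dist (y n) x < 1 / ((n : ℝ) + 1))
    (hc : ∀ n : ℕ, dist (c n) x < 1 / ((n : ℝ) + 1))
    (hey : ∀ n j, e j (y n) = 0) (hφy : ∀ n, ∀ a ∈ I, 0 < φ a (y n))
    (hv : ∀ n a, v n a ∈ limitingSubdiff (φ a) (y n))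
    (hw : ∀ n a, w n a ∈ limitingSubdiff (φ a) (c n))
    (hlam : ∀ n, IsPosRel e I (y n) (v n) (lam n)) (hmu : ∀ n, IsPosRel e I (c n) (w n) (mu n))
    (hspan : ∀ n, y n - x ∈ Submodule.span ℝ (v n '' I) ⊔ gradSpan e (y n))
    (hmvt : ∀ n : ℕ, (∑ a ∈ I, φ a (y n)) / ‖y n - x‖ - 1 / ((n : ℝ) + 1) ≤
      ∑ a ∈ I, inner ℝ (w n a) (‖y n - x‖⁻¹ • (y n - x))) : False := by
  classical
  have hU : (hyperfilter ℕ : Filter ℕ) ≤ atTop := Nat.hyperfilter_le_atTop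
  have hyx : ∀ n, y n ≠ x := fun n h => hxS (h ▸ hyS n)
  have hyt : Tendsto y (hyperfilter ℕ) (𝓝 x) := (tendsto_of_dist_lt_one_div hy).mono_left hU
  have hct : Tendsto c (hyperfilter ℕ) (𝓝 x) := (tendsto_of_dist_lt_one_div hc).mono_left hU
  obtain ⟨u, hu1, hu⟩ := exists_tendsto_direction (hyperfilter ℕ) (Eventually.of_forall hyx)
  obtain ⟨v', hv', hv'x⟩ := exists_tendsto_selection (hyperfilter ℕ) (hφ x) hyt
    (Eventually.of_forall hv)
  obtain ⟨w', hw', hw'x⟩ := exists_tendsto_selection (hyperfilter ℕ) (hφ x) hct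
    (Eventually.of_forall hw)
  have hv'c := mem_closure_graph_of_tendsto (φ := φ) (S := S) hyt hv' (Eventually.of_forall hyS)
    (Eventually.of_forall hv)
  have hw'c := mem_closure_graph_of_tendsto (φ := φ) (S := S) hct hw' (Eventually.of_forall hcS)
    (Eventually.of_forall hw)
  obtain ⟨lam', hlam', hlamrel⟩ := IsPosRel.exists_tendsto (hyperfilter ℕ) he hli hyt hv'
    (Eventually.of_forall hlam)
  obtain ⟨mu', -, hmurel⟩ := IsPosRel.exists_tendsto (hyperfilter ℕ) he hli hct hw'
    (Eventually.of_forall hmu)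
  have hD : ∀ a, ∃ D : ℝ, Tendsto (fun n => (φ a (y n) - φ a x) / ‖y n - x‖) (hyperfilter ℕ)
      (𝓝 D) := fun a => by
    obtain ⟨L, hL0, hL⟩ := (hφ x a).exists_abs_sub_le
    refine (hyperfilter ℕ).exists_tendsto_of_bounded (a := 0) (R := L) ?_
    filter_upwards [hyt.eventually hL] with n hn
    rw [Real.dist_eq, sub_zero, abs_div, abs_norm]
    exact div_le_of_le_mul₀ (norm_nonneg _) hL0 hn
  choose D hD using hD
  have hD0 : ∀ a ∈ I, 0 ≤ D a := fun a ha => ge_of_tendsto (hD a) (Eventually.of_forall fun n => by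
    rw [hφx, sub_zero]
    exact div_nonneg (hφy n a ha).le (norm_nonneg _))
  have hle : ∀ a, ∀ ξ ∈ limitingSubdiff (φ a) x, inner ℝ ξ u ≤ D a := fun a ξ hξ => by
    rw [hreg a] at hξ
    exact inner_le_of_mem_regularSubdiff hξ hyt (Eventually.of_forall hyx) hu (hD a)
  have hge : ∑ a ∈ I, D a ≤ ∑ a ∈ I, inner ℝ (w' a) u := by
    have h1 : Tendsto (fun n : ℕ => (∑ a ∈ I, φ a (y n)) / ‖y n - x‖ - 1 / ((n : ℝ) + 1))
        (hyperfilter ℕ) (𝓝 (∑ a ∈ I, D a - 0)) := by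
      refine Tendsto.sub ?_ (tendsto_one_div_add_atTop_nhds_zero_nat.mono_left hU)
      refine (tendsto_finsetSum I fun a _ => hD a).congr fun n => ?_
      rw [Finset.sum_div]
      simp [hφx]
    rw [sub_zero] at h1
    refine le_of_tendsto_of_tendsto' h1 (tendsto_finsetSum I fun a _ => ?_) hmvt
    exact (tendsto_pi_nhds.1 hw' a).inner hu
  have hgrad : ∀ j, inner ℝ (gradient (e j) x) u = 0 := fun j =>
    inner_gradient_eq_zero_of_tendsto (he j) hyt (Eventually.of_forall hyx) hu
      (Eventually.of_forall fun n => hey n j) (hex j)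
  have hzero : ∀ {ζ : A → E} {l : A → ℝ}, IsPosRel e I x ζ l →
      ∑ a ∈ I, l a * inner ℝ (ζ a) u = 0 := fun {ζ l} hl => by
    have := inner_eq_zero_of_mem_gradSpan hgrad hl.2.2.2
    rw [sum_inner] at this
    rw [← this]
    simp only [real_inner_smul_left]
    exact Finset.sum_subset (Finset.subset_univ I) fun a _ ha => by rw [hl.2.1 a ha, zero_mul]
  -- The terms satisfy ≤ and the sums satisfy ≥, so every term is an equality.
  have hwD : ∀ a ∈ I, inner ℝ (w' a) u = D a :=
    (Finset.sum_eq_sum_iff_of_le fun a _ => hle a _ (hw'x a)).1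
      (le_antisymm (Finset.sum_le_sum fun a _ => hle a _ (hw'x a)) hge)
  have hDz : ∀ a ∈ I, D a = 0 := fun a ha => by
    have h1 := hzero hmurel
    rw [Finset.sum_congr rfl fun a ha => by rw [hwD a ha], Finset.sum_eq_zero_iff_of_nonneg
      fun a ha => mul_nonneg (hmurel.1 a) (hD0 a ha)] at h1
    exact (mul_eq_zero.1 (h1 a ha)).resolve_left (h.pos hw'c hmurel ha).ne'
  have hvz : ∀ a ∈ I, inner ℝ (v' a) u = 0 := fun a ha => by
    have h1 := hzero hlamrel
    rw [Finset.sum_eq_zero_iff_of_nonpos fun a ha =>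
      mul_nonpos_of_nonneg_of_nonpos (hlamrel.1 a) (by
        have := hle a _ (hv'x a)
        rwa [hDz a ha] at this)] at h1
    exact (mul_eq_zero.1 (h1 a ha)).resolve_left (h.pos hv'c hlamrel ha).ne'
  obtain ⟨a₀, ha₀⟩ := hlamrel.nonempty
  -- Without a₀ the limit family is independent, so membership in the moving spans passes to the
  -- limit. Nothing is lost: as lam n a₀ > 0, the vector v n a₀ is a combination of the others.
  have hli' := h.linearIndependent_erase hli hv'c hlamrel ha₀
  have hlpos : ∀ᶠ n : ℕ in hyperfilter ℕ, 0 < lam n a₀ :=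
    (tendsto_pi_nhds.1 hlam' a₀).eventually (lt_mem_nhds (h.pos hv'c hlamrel ha₀))
  have huspan := hli'.mem_span_of_tendsto (hyperfilter ℕ)
    (w' := fun n => Sum.elim (fun a : {a // a ∈ I ∧ a ≠ a₀} => v n a)
      fun j => gradient (e j) (y n)) (by
      refine tendsto_pi_nhds.2 ?_
      rintro (a | j)
      · exact tendsto_pi_nhds.1 hv' a
      · exact ((he j).continuous_gradient.tendsto x).comp hyt) hu (by
    filter_upwards [hlpos] with n hn
    have hW : gradSpan e (y n) ≤ Submodule.span ℝ (Set.range (Sum.elim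
        (fun a : {a // a ∈ I ∧ a ≠ a₀} => v n a) fun j => gradient (e j) (y n))) := by
      refine Submodule.span_mono ?_
      rintro _ ⟨j, rfl⟩
      exact ⟨Sum.inr j, rfl⟩
    have hne : ∀ a ∈ I, a ≠ a₀ → v n a ∈ Submodule.span ℝ (Set.range (Sum.elim
        (fun a : {a // a ∈ I ∧ a ≠ a₀} => v n a) fun j => gradient (e j) (y n))) :=
      fun a ha hne => Submodule.subset_span ⟨Sum.inl ⟨a, ha, hne⟩, rfl⟩
    have h0 : v n a₀ ∈ Submodule.span ℝ (Set.range (Sum.elim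
        (fun a : {a // a ∈ I ∧ a ≠ a₀} => v n a) fun j => gradient (e j) (y n))) := by
      have h1 := hW (hlam n).2.2.2
      rw [← Finset.add_sum_erase _ _ (Finset.mem_univ a₀)] at h1
      have h2 : ∑ a ∈ Finset.univ.erase a₀, lam n a • v n a ∈ Submodule.span ℝ (Set.range (Sum.elim
        (fun a : {a // a ∈ I ∧ a ≠ a₀} => v n a) fun j => gradient (e j) (y n))) := by
        refine Submodule.sum_mem _ fun a ha => ?_
        by_cases haI : a ∈ I
        · exact Submodule.smul_mem _ _ (hne a haI (Finset.ne_of_mem_erase ha))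
        · rw [(hlam n).2.1 a haI, zero_smul]
          exact Submodule.zero_mem _
      rw [Submodule.add_mem_iff_left _ h2] at h1
      exact (Submodule.smul_mem_iff _ hn.ne').1 h1
    have hle : Submodule.span ℝ (v n '' I) ⊔ gradSpan e (y n) ≤ Submodule.span ℝ (Set.range
        (Sum.elim (fun a : {a // a ∈ I ∧ a ≠ a₀} => v n a) fun j => gradient (e j) (y n))) := by
      refine sup_le (Submodule.span_le.2 ?_) hW
      rintro _ ⟨a, ha, rfl⟩
      by_cases hne' : a = a₀
      · rw [hne']
        exact h0
      · exact hne a ha hne'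
    exact Submodule.smul_mem _ _ (hle (hspan n)))
  obtain ⟨β, hβ⟩ := mem_span_range_iff_exists_fintype_sum.1 huspan
  have huu : inner ℝ u u = (0 : ℝ) := by
    nth_rewrite 1 [← hβ]
    rw [sum_inner]
    refine Finset.sum_eq_zero ?_
    rintro (a | j) -
    · simp [real_inner_smul_left, hvz a a.2.1]
    · simp [real_inner_smul_left, hgrad j]
  rw [inner_self_eq_zero] at huu
  rw [huu, norm_zero] at hu1
  exact zero_ne_one hu1

/-- The constraints that carry a minimal relation are not simultaneously violated near `x`. -/
theorem eventually_not_forall_pos (h : IsMinimalRel φ e x S I) (hRC : RelaxedCPLD φ e x)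
    (hφ : ∀ z a, LipNear (φ a) z) (hφx : ∀ a, φ a x = 0) (he : ∀ j, ContDiff ℝ 1 (e j))
    (hex : ∀ j, e j x = 0) (hli : LinearIndependent ℝ fun j => gradient (e j) x)
    (hreg : ∀ a, ∀ᶠ y in 𝓝 x, SubdiffRegularAt (φ a) y)
    (hS : IsOpen S) (hxS : x ∉ S) (hcl : IsClosed (insert x S))
    (hconn : ∀ ε > 0, IsPreconnected (S ∩ Metric.ball x ε)) :
    ∀ᶠ z in 𝓝 x, z ∈ S → (∀ j, e j z = 0) → ∃ a ∈ I, φ a z ≤ 0 := by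
  by_contra hcon
  have hfr : ∃ᶠ z in 𝓝 x, z ∈ S ∧ (∀ j, e j z = 0) ∧ ∀ a ∈ I, 0 < φ a z := by
    refine hcon.imp fun h => h.mono fun z hz h1 h2 => ?_
    by_contra h3
    push Not at h3
    exact hz ⟨h1, h2, h3⟩
  have hI : I.Nonempty := by
    obtain ⟨v, lam, -, hrel⟩ := h.exists_rel
    exact hrel.nonempty
  choose L hL0 hL using fun a => (hφ x a).exists_abs_sub_le
  obtain ⟨r, hr, hball⟩ := Metric.eventually_nhds_iff_ball.1
    ((h.eventually_forall_isPosRel hRC hφ he hli hreg hS hxS hconn).and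
      ((eventually_linearIndependent_gradients he hli).and ((eventually_all.2 hL).and
        (eventually_all.2 fun a => eventually_eventually_nhds.2 (hreg a)))))
  obtain ⟨M, hM⟩ : ∃ M, M = ∑ a ∈ I, L a := ⟨_, rfl⟩
  have hM0 : 0 ≤ M := hM ▸ Finset.sum_nonneg fun a _ => hL0 a
  have hΦ : ∀ y ∈ Metric.ball x r, |∑ a ∈ I, φ a y| ≤ M * ‖y - x‖ := fun y hy => by
    refine (Finset.abs_sum_le_sum_abs _ _).trans ?_
    rw [hM, Finset.sum_mul]
    refine Finset.sum_le_sum fun a _ => ?_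
    have := (hball y hy).2.2.1 a
    rwa [hφx, sub_zero] at this
  have hstep : ∀ n : ℕ, ∃ (y c : E) (v w : A → E), y ∈ S ∧ c ∈ S ∧
      dist y x < 1 / ((n : ℝ) + 1) ∧ dist c x < 1 / ((n : ℝ) + 1) ∧ (∀ j, e j y = 0) ∧
      (∀ a ∈ I, 0 < φ a y) ∧ (∀ a, v a ∈ limitingSubdiff (φ a) y) ∧
      (∀ a, w a ∈ limitingSubdiff (φ a) c) ∧ (∃ l, IsPosRel e I y v l) ∧
      (∃ l, IsPosRel e I c w l) ∧ y - x ∈ Submodule.span ℝ (v '' I) ⊔ gradSpan e y ∧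
      (∑ a ∈ I, φ a y) / ‖y - x‖ - 1 / ((n : ℝ) + 1) ≤
        ∑ a ∈ I, inner ℝ (w a) (‖y - x‖⁻¹ • (y - x)) := fun n => by
    obtain ⟨η, hη⟩ : ∃ η : ℝ, η = 1 / ((n : ℝ) + 1) := ⟨_, rfl⟩
    rw [← hη]
    have hη0 : 0 < η := hη ▸ by positivity
    -- So close to x, both the radial point and the mean value point, which lies farther out by a
    -- factor of at most (4M + 4η) / η, stay within min r η.
    obtain ⟨ρ, hρ⟩ : ∃ ρ : ℝ, ρ = min r η / ((4 * M + 4 * η) / η + 1) := ⟨_, rfl⟩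
    have hq : 0 ≤ (4 * M + 4 * η) / η := by positivity
    have hm : 0 < min r η := lt_min hr hη0
    have hρ0 : 0 < ρ := hρ ▸ by positivity
    have hρm : ρ * ((4 * M + 4 * η) / η + 1) = min r η := by
      rw [hρ]
      field_simp
    have hρ1 : ρ ≤ min r η := by nlinarith
    obtain ⟨z, ⟨hzS, hez, hφz⟩, hzρ⟩ := (hfr.and_eventually (Metric.ball_mem_nhds x hρ0)).exists
    have hzr : z ∈ Metric.ball x r :=
      Metric.ball_subset_ball (hρ1.trans (min_le_left _ _)) hzρ
    rw [dist_eq_norm] at hzρ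
    obtain ⟨y, hyS, hyz, hey, hφy, v, hv, hspan⟩ := exists_radial_selection hI hS hcl hφ hφx he
      (fun y hy => (hball y hy).2.1) (fun y hy => (hball y hy).2.2.2) hzr hzS hφz hez
    have hyρ : ‖y - x‖ < ρ := by linarith
    have hsmall : ‖y - x‖ * (4 * M + 4 * η) / η < min r η := by
      rw [mul_div_assoc]
      nlinarith
    have hyx : y ≠ x := fun h => hxS (h ▸ hyS)
    obtain ⟨c, hcS, hc, w, hw, hmvt⟩ := exists_mean_value_selection (I := I) hS hcl hφ hM0 hη0 hΦ
      hyS hyx (fun y hy => (hball y hy).2.2.2) (hsmall.trans_le (min_le_left _ _))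
    have hyd : dist y x < min r η := by rw [dist_eq_norm]; linarith
    have hcd : dist c x < min r η := by rw [dist_eq_norm]; linarith
    exact ⟨y, c, v, w, hyS, hcS, hyd.trans_le (min_le_right _ _), hcd.trans_le (min_le_right _ _),
      hey, hφy, hv, hw, (hball y (hyd.trans_le (min_le_left _ _))).1 hyS v hv,
      (hball c (hcd.trans_le (min_le_left _ _))).1 hcS w hw, hspan, hmvt⟩
  choose y c v w h1 h2 h3 h4 h5 h6 h7 h8 h9 h10 h11 h12 using hstep
  choose lam hlam using h9
  choose mu hmu using h10
  exact h.false_of_sequences hφ hφx he hex hli (fun a => (hreg a).self_of_nhds) hxS h1 h2 h3 h4 h5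
    h6 h7 h8 hlam hmu h11 h12

end IsMinimalRel

end PositivePoints

/-! ### Connected germs and the abstract error bound -/

section ErrorBound

variable {E : Type*} [NormedAddCommGroup E] [InnerProductSpace ℝ E]

/-- The radial map y ↦ x + ε y / (1 + ‖y‖) carries the punctured space, connected in dimension
greater than one, onto the punctured ball. -/
theorem isPreconnected_punctured_ball (hE : 1 < Module.rank ℝ E) (x : E) {ε : ℝ} (hε : 0 < ε) :
    IsPreconnected ({x}ᶜ ∩ Metric.ball x ε) := by
  have hc : Continuous fun y : E => x + (ε / (1 + ‖y‖)) • y := by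
    refine continuous_const.add (Continuous.smul (continuous_const.div (by fun_prop) fun y => ?_)
      continuous_id)
    positivity
  have himg : {x}ᶜ ∩ Metric.ball x ε = (fun y : E => x + (ε / (1 + ‖y‖)) • y) '' {0}ᶜ := by
    ext p
    simp only [Set.mem_inter_iff, Set.mem_compl_iff, Set.mem_singleton_iff, Metric.mem_ball,
      dist_eq_norm, Set.mem_image]
    constructor
    · rintro ⟨h1, h2⟩
      have h3 : 0 < ε - ‖p - x‖ := sub_pos.2 h2
      refine ⟨(ε - ‖p - x‖)⁻¹ • (p - x), ?_, ?_⟩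
      · exact smul_ne_zero (inv_pos.2 h3).ne' (sub_ne_zero.2 h1)
      · rw [norm_smul, norm_inv, Real.norm_of_nonneg h3.le, smul_smul]
        have : ε / (1 + (ε - ‖p - x‖)⁻¹ * ‖p - x‖) * (ε - ‖p - x‖)⁻¹ = 1 := by
          field_simp
          rw [sub_add_cancel]
        rw [this, one_smul, add_sub_cancel]
    · rintro ⟨y, hy, rfl⟩
      have hpos : 0 < 1 + ‖y‖ := by positivity
      refine ⟨fun h => ?_, ?_⟩
      · have h1 : (ε / (1 + ‖y‖)) • y = 0 := by simpa using h
        exact (smul_ne_zero (by positivity) hy) h1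
      · rw [add_sub_cancel_left, norm_smul, Real.norm_of_nonneg (by positivity), div_mul_eq_mul_div,
          div_lt_iff₀ hpos]
        nlinarith
  rw [himg]
  exact (isConnected_compl_singleton_of_one_lt_rank hE 0).isPreconnected.image _ hc.continuousOn

/-- The hypothesis on b forces dimension at most one, so the boundary of the half-space is the
single point x. -/
theorem half_space_germ {b x : E} (hb : ∀ w : E, inner ℝ b w = 0 → w = 0) :
    IsOpen {y | 0 < inner ℝ b (y - x)} ∧ x ∉ {y | 0 < inner ℝ b (y - x)} ∧
      IsClosed (insert x {y | 0 < inner ℝ b (y - x)}) ∧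
      ∀ ε > 0, IsPreconnected ({y | 0 < inner ℝ b (y - x)} ∩ Metric.ball x ε) := by
  have hc : Continuous fun y => inner ℝ b (y - x) := by fun_prop
  refine ⟨isOpen_lt continuous_const hc, by simp, ?_, fun ε _ => ?_⟩
  · have : insert x {y | 0 < inner ℝ b (y - x)} = {y | 0 ≤ inner ℝ b (y - x)} := by
      ext y
      simp only [Set.mem_insert_iff, Set.mem_ofPred_eq]
      constructor
      · rintro (rfl | h)
        · simp
        · exact h.le
      · intro h
        rcases h.eq_or_lt with h | h
        · exact Or.inl (sub_eq_zero.1 (hb _ h.symm))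
        · exact Or.inr h
    rw [this]
    exact isClosed_le continuous_const hc
  · refine (Convex.inter ?_ (convex_ball x ε)).isPreconnected
    have : {y | 0 < inner ℝ b (y - x)} = {y | inner ℝ b x < innerₛₗ ℝ b y} := by
      ext y
      simp [inner_sub_right]
    rw [this]
    exact convex_halfSpace_gt (innerₛₗ ℝ b).isLinear _

/-- An ultrafilter of points distinct from `x` lives on an open set that touches `x` in a connected
way. -/
theorem exists_connected_germ [FiniteDimensional ℝ E] {ι : Type*} (U : Ultrafilter ι) {x : E}
    {z : ι → E} (hz : ∀ t, z t ≠ x) :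
    ∃ S : Set E, (IsOpen S ∧ x ∉ S ∧ IsClosed (insert x S) ∧
      ∀ ε > 0, IsPreconnected (S ∩ Metric.ball x ε)) ∧ ∀ᶠ t in U, z t ∈ S := by
  -- In dimension at least two the punctured space serves. In dimension one it is disconnected, but
  -- the ultrafilter selects one of the two half-lines.
  by_cases hrank : 1 < Module.finrank ℝ E
  · refine ⟨{x}ᶜ, ⟨isOpen_compl_singleton, by simp, ?_, fun ε hε =>
      isPreconnected_punctured_ball (Module.one_lt_rank_of_one_lt_finrank hrank) x hε⟩,
      Eventually.of_forall hz⟩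
    rw [Set.insert_eq, Set.union_compl_self]
    exact isClosed_univ
  obtain ⟨t₀, -⟩ := (Eventually.of_forall (f := (U : Filter ι)) (p := fun _ => True)
    fun _ => trivial).exists
  obtain ⟨b, hb⟩ : ∃ b, b = z t₀ - x := ⟨_, rfl⟩
  have hb0 : b ≠ 0 := hb ▸ sub_ne_zero.2 (hz t₀)
  have h1 : Module.finrank ℝ E = 1 := by
    have : 0 < Module.finrank ℝ E := Module.finrank_pos_iff_exists_ne_zero.2 ⟨b, hb0⟩
    omega
  have hb' : ∀ w : E, inner ℝ b w = 0 → w = 0 := fun w hw => by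
    obtain ⟨c, rfl⟩ := (finrank_eq_one_iff_of_nonzero' b hb0).1 h1 w
    rw [real_inner_smul_right, mul_eq_zero, inner_self_eq_zero] at hw
    rw [hw.resolve_right hb0, zero_smul]
  by_cases hU : ∀ᶠ t in U, 0 < inner ℝ b (z t - x)
  · exact ⟨_, half_space_germ (x := x) hb', hU⟩
  · refine ⟨_, half_space_germ (b := -b) (x := x) (fun w hw => hb' w (by simpa using hw)), ?_⟩
    filter_upwards [Ultrafilter.eventually_not.2 hU] with t ht
    have h2 : inner ℝ b (z t - x) ≠ 0 := fun h => hz t (sub_eq_zero.1 (hb' _ h))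
    rw [inner_neg_left, neg_pos]
    exact lt_of_le_of_ne (not_lt.1 ht) h2

variable [FiniteDimensional ℝ E] [CompleteSpace E] {A J : Type*} [Fintype A] [Fintype J]

/-- The error bound on the manifold `e = 0`. -/
theorem RelaxedCPLD.error_bound_on_zeroLocus {φ : A → E → ℝ} {e : J → E → ℝ} {x : E}
    (hRC : RelaxedCPLD φ e x) (hφ : ∀ z a, LipNear (φ a) z) (hφx : ∀ a, φ a x = 0)
    (he : ∀ j, ContDiff ℝ 1 (e j)) (hex : ∀ j, e j x = 0)
    (hli : LinearIndependent ℝ fun j => gradient (e j) x)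
    (hreg : ∀ a, ∀ᶠ y in 𝓝 x, SubdiffRegularAt (φ a) y) :
    ∃ C : ℝ, 0 ≤ C ∧ ∀ᶠ y₀ in 𝓝 x, (∀ j, e j y₀ = 0) → ∃ z, (∀ j, e j z = 0) ∧
      (∀ a, φ a z ≤ 0) ∧ ‖z - y₀‖ ≤ C * violation φ y₀ := by
  classical
  by_contra hcon
  obtain ⟨r, hr, hball⟩ := Metric.eventually_nhds_iff_ball.1
    (eventually_linearIndependent_gradients he hli)
  -- If no such near-stationary point existed for some n, the error bound would hold with constant n
  -- + 1.
  have hstep : ∀ n : ℕ, ∃ z, dist z x < 1 / ((n : ℝ) + 1) ∧ (∀ j, e j z = 0) ∧ z ≠ x ∧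
      ∃ (c : A → ℝ) (v : A → E) (ξ : E), (∀ a, 0 ≤ c a) ∧ ∑ a, c a ^ 2 = 1 ∧
      (∀ a, c a ≠ 0 ↔ 0 < φ a z) ∧ (∀ a, v a ∈ limitingSubdiff (φ a) z) ∧
      ‖ξ‖ ≤ 1 / ((n : ℝ) + 1) ∧ ξ + ∑ a, c a • v a ∈ gradSpan e z := fun n => by
    have hn : 0 < 1 / ((n : ℝ) + 1) := by positivity
    by_contra hno
    push Not at hno
    refine hcon ⟨(1 / ((n : ℝ) + 1))⁻¹, by positivity, eventually_error_bound_of_not_stationary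
      hn (lt_min hr hn)
      (fun a => continuous_iff_continuousAt.2 fun z => (hφ z a).continuousAt) hφ hφx he ?_⟩
    intro z hz hez hzx
    refine ⟨hball z (Metric.ball_subset_ball (min_le_left _ _) hz), ?_⟩
    rintro ⟨c, v, ξ, h1, h2, h3, h4, h5, h6⟩
    exact hno z (lt_of_lt_of_le hz (min_le_right _ _)) hez hzx c v ξ h1 h2 h3 h4 h5 h6
  choose z hz hez hzx c v ξ hc0 hc1 hcφ hv hξ hrel using hstep
  obtain ⟨S, ⟨hS, hxS, hcl, hconn⟩, hzS⟩ := exists_connected_germ (hyperfilter ℕ) hzx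
  have hU : (hyperfilter ℕ : Filter ℕ) ≤ atTop := Nat.hyperfilter_le_atTop
  have hzt : Tendsto z (hyperfilter ℕ) (𝓝 x) := (tendsto_of_dist_lt_one_div hz).mono_left hU
  -- Only finitely many sets of violated constraints are possible, so one occurs for almost all n;
  -- the limit multipliers live on it.
  obtain ⟨I₀, hI₀⟩ := (hyperfilter ℕ).exists_eventually_eq
    fun n => Finset.univ.filter fun a => 0 < φ a (z n)
  obtain ⟨v', hv', -⟩ := exists_tendsto_selection (hyperfilter ℕ) (hφ x) hzt
    (Eventually.of_forall hv)
  obtain ⟨c', hc'⟩ := (hyperfilter ℕ).exists_tendsto_of_bounded (s := c) (a := 0) (R := 1)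
    (Eventually.of_forall fun n => by
      rw [dist_zero_right, pi_norm_le_iff_of_nonneg zero_le_one]
      intro a
      rw [Real.norm_of_nonneg (hc0 n a)]
      have h1 : c n a ^ 2 ≤ 1 := by
        rw [← hc1 n]
        exact Finset.single_le_sum (f := fun a => c n a ^ 2) (fun a _ => sq_nonneg _)
          (Finset.mem_univ a)
      nlinarith [hc0 n a])
  have hc'a := tendsto_pi_nhds.1 hc'
  have hξt : Tendsto ξ (hyperfilter ℕ) (𝓝 0) :=
    (squeeze_zero_norm hξ tendsto_one_div_add_atTop_nhds_zero_nat).mono_left hU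
  have hrel' := mem_gradSpan_of_tendsto (hyperfilter ℕ) he hli hzt
    (hξt.add (tendsto_sum_smul hv' hc')) (Eventually.of_forall hrel)
  rw [zero_add] at hrel'
  have hc'1 : ∑ a, c' a ^ 2 = 1 := tendsto_nhds_unique
    (tendsto_finsetSum _ fun a _ => (hc'a a).pow 2)
    (tendsto_const_nhds.congr fun n => (hc1 n).symm)
  obtain ⟨lam, hlam⟩ := exists_isPosRel_of_nonneg (e := e) (I := I₀) (y := x) (v := v') (c := c')
    (fun a => ge_of_tendsto' (hc'a a) fun n => hc0 n a)
    (fun h => by simp [h] at hc'1)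
    (fun a ha => tendsto_nhds_unique (hc'a a) (tendsto_const_nhds.congr'
      (hI₀.mono fun n hn => by
        by_contra hne
        have h1 := (hcφ n a).1 (Ne.symm hne)
        rw [← hn] at ha
        exact ha (by simpa using h1)))) hrel'
  -- All constraints in I ⊆ I₀ are positive at z n for almost all n, which
  -- `eventually_not_forall_pos` rules out.
  obtain ⟨I, hI, hmin⟩ := exists_isMinimalRel (φ := φ) (S := S) ⟨v', lam,
    mem_closure_graph_of_tendsto hzt hv' hzS (Eventually.of_forall hv), hlam⟩
  obtain ⟨n, h1, h2, h3⟩ := ((hzt.eventually (hmin.eventually_not_forall_pos hRC hφ hφx he hex hli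
    hreg hS hxS hcl hconn)).and (hI₀.and hzS)).exists
  obtain ⟨a, haI, ha⟩ := h1 h3 (hez n)
  have : a ∈ Finset.univ.filter fun a => 0 < φ a (z n) := h2 ▸ hI haI
  simp only [Finset.mem_filter, Finset.mem_univ, true_and] at this
  linarith

theorem violation_le_sum (φ : A → E → ℝ) (y : E) : violation φ y ≤ ∑ a, max (φ a y) 0 := by
  refine Real.sqrt_le_iff.2 ⟨Finset.sum_nonneg fun a _ => le_max_right _ _, ?_⟩
  exact Finset.sum_sq_le_sq_sum_of_nonneg fun a _ => le_max_right _ _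

/-- The distance to the zero locus of functions with independent gradients. -/
theorem eventually_dist_zeroLocus_le {e : J → E → ℝ} {x : E} (he : ∀ j, ContDiff ℝ 1 (e j))
    (hex : ∀ j, e j x = 0) (hli : LinearIndependent ℝ fun j => gradient (e j) x) :
    ∃ C : ℝ, 0 ≤ C ∧ ∀ᶠ y in 𝓝 x, ∃ z, (∀ j, e j z = 0) ∧ ‖z - y‖ ≤ C * ∑ j, |e j y| := by
  obtain ⟨c₀, hc₀, hlow⟩ := hli.exists_lower_bound
  obtain ⟨r, hr, hball⟩ := Metric.eventually_nhds_iff_ball.1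
    ((tendsto_gradients he x).eventually hlow)
  -- Near-stationarity with this ε would bound the weight differences by 1 / (card J + 1). Their
  -- squares sum to one, while card J numbers of that size have squares summing to less than one.
  obtain ⟨ε, hε⟩ : ∃ ε, ε = c₀ / (Fintype.card J + 1) := ⟨_, rfl⟩
  have hε0 : 0 < ε := hε ▸ by positivity
  obtain ⟨φ, hφ⟩ : ∃ φ : J ⊕ J → E → ℝ, φ = Sum.elim e fun j y => -e j y := ⟨_, rfl⟩
  have hφC : ∀ a, ContDiff ℝ 1 (φ a) := by
    rintro (j | j)
    · simpa [hφ] using he j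
    · simpa [hφ] using (he j).neg
  refine ⟨ε⁻¹, by positivity, ?_⟩
  have hEB := eventually_error_bound_of_not_stationary (φ := φ) (J := PEmpty.{1})
    (e := fun j _ => j.elim) (x := x) hε0 hr (fun a => (hφC a).continuous)
    (fun z a => (hφC a).lipNear z) (by rintro (j | j) <;> simp [hφ, hex]) (fun j => j.elim) (by
    intro z hz _ _
    refine ⟨linearIndependent_empty_type, ?_⟩
    rintro ⟨c, v, ξ, h1, h2, h3, h4, h5, h6⟩
    have h7 : ξ + ∑ a, c a • v a = 0 := by simpa [Set.range_eq_empty] using h6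
    have hv : ∀ a, v a = gradient (φ a) z := fun a => by
      have := h4 a
      rwa [(hφC a).limitingSubdiff_eq] at this
    have hvl : ∀ j, v (Sum.inl j) = gradient (e j) z := fun j => by rw [hv]; simp [hφ]
    have hvr : ∀ j, v (Sum.inr j) = -gradient (e j) z := fun j => by
      rw [hv, ← gradient_neg' (he j)]
      simp [hφ]
    have hsum : ∑ a, c a • v a = ∑ j, (c (Sum.inl j) - c (Sum.inr j)) • gradient (e j) z := by
      rw [Fintype.sum_sum_type, ← Finset.sum_add_distrib]
      refine Finset.sum_congr rfl fun j _ => ?_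
      rw [hvl, hvr, sub_smul, smul_neg, sub_eq_add_neg]
    have hβ : c₀ * ‖fun j => c (Sum.inl j) - c (Sum.inr j)‖ ≤ ε := by
      refine (hball z hz _).trans ?_
      rw [← hsum, eq_neg_of_add_eq_zero_right h7, norm_neg]
      exact h5
    -- The functions e j and -e j are not positive together, so taking differences of the weights
    -- does not change the sum of squares.
    have hprod : ∀ j, c (Sum.inl j) * c (Sum.inr j) = 0 := fun j => by
      by_contra hne
      have k1 := (h3 _).1 (left_ne_zero_of_mul hne)
      have k2 := (h3 _).1 (right_ne_zero_of_mul hne)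
      simp only [hφ, Sum.elim_inl, Sum.elim_inr] at k1 k2
      linarith
    have hB : ‖fun j => c (Sum.inl j) - c (Sum.inr j)‖ ≤ 1 / (Fintype.card J + 1) := by
      rw [hε] at hβ
      have : c₀ / ((Fintype.card J : ℝ) + 1) = c₀ * (1 / (Fintype.card J + 1)) := by ring
      rw [this] at hβ
      exact le_of_mul_le_mul_left hβ hc₀
    have hone : (1 : ℝ) ≤ Fintype.card J * (1 / (Fintype.card J + 1)) := by
      have k1 : (1 : ℝ) / (Fintype.card J + 1) ≤ 1 := by
        rw [div_le_one (by positivity)]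
        have : (0 : ℝ) ≤ Fintype.card J := Nat.cast_nonneg _
        linarith
      have k0 : (0 : ℝ) ≤ 1 / (Fintype.card J + 1) := by positivity
      calc (1 : ℝ) = ∑ j, (c (Sum.inl j) - c (Sum.inr j)) ^ 2 := by
            rw [← h2, Fintype.sum_sum_type, ← Finset.sum_add_distrib]
            refine Finset.sum_congr rfl fun j _ => ?_
            linear_combination 2 * hprod j
        _ ≤ ∑ j : J, 1 / ((Fintype.card J : ℝ) + 1) := by
            refine Finset.sum_le_sum fun j _ => ?_
            have k2 := (norm_le_pi_norm (fun j => c (Sum.inl j) - c (Sum.inr j)) j).trans hB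
            rw [Real.norm_eq_abs] at k2
            rw [← sq_abs]
            nlinarith [abs_nonneg (c (Sum.inl j) - c (Sum.inr j))]
        _ = Fintype.card J * (1 / (Fintype.card J + 1)) := by simp
    rw [mul_one_div, le_div_iff₀ (by positivity)] at hone
    linarith)
  filter_upwards [hEB] with y hy
  obtain ⟨z, -, h1, h2⟩ := hy fun j => j.elim
  refine ⟨z, fun j => ?_, h2.trans (mul_le_mul_of_nonneg_left ?_ (by positivity))⟩
  · have k1 := h1 (Sum.inl j)
    have k2 := h1 (Sum.inr j)
    simp only [hφ, Sum.elim_inl, Sum.elim_inr] at k1 k2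
    linarith
  · refine (violation_le_sum φ y).trans (le_of_eq ?_)
    rw [Fintype.sum_sum_type, ← Finset.sum_add_distrib]
    refine Finset.sum_congr rfl fun j _ => ?_
    simp only [hφ, Sum.elim_inl, Sum.elim_inr]
    rcases le_total 0 (e j y) with h | h
    · rw [max_eq_left h, max_eq_right (by linarith), abs_of_nonneg h, add_zero]
    · rw [max_eq_right h, max_eq_left (by linarith), abs_of_nonpos h, zero_add]

/-- The local error bound under the relaxed constant positive linear dependence condition. -/
theorem RelaxedCPLD.error_bound {φ : A → E → ℝ} {e : J → E → ℝ} {x : E}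
    (hRC : RelaxedCPLD φ e x) (hφ : ∀ z a, LipNear (φ a) z) (hφx : ∀ a, φ a x = 0)
    (he : ∀ j, ContDiff ℝ 1 (e j)) (hex : ∀ j, e j x = 0)
    (hli : LinearIndependent ℝ fun j => gradient (e j) x)
    (hreg : ∀ a, ∀ᶠ y in 𝓝 x, SubdiffRegularAt (φ a) y) {P : E → Prop} (hP : ∀ᶠ w in 𝓝 x, P w) :
    ∃ C : ℝ, 0 ≤ C ∧ ∀ᶠ y in 𝓝 x, ∃ w, (∀ a, φ a w ≤ 0) ∧ (∀ j, e j w = 0) ∧ P w ∧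
      ‖w - y‖ ≤ C * (∑ a, max (φ a y) 0 + ∑ j, |e j y|) := by
  obtain ⟨C₁, hC₁, h₁⟩ := eventually_dist_zeroLocus_le he hex hli
  obtain ⟨C₂, hC₂, h₂⟩ := hRC.error_bound_on_zeroLocus hφ hφx he hex hli hreg
  choose K U hU hK using hφ x
  have hUev : ∀ᶠ y in 𝓝 x, ∀ a, y ∈ U a := eventually_all.2 hU
  obtain ⟨M, hM⟩ : ∃ M : ℝ, M = ∑ a, (K a : ℝ) := ⟨_, rfl⟩
  have hM0 : 0 ≤ M := hM ▸ Finset.sum_nonneg fun a _ => (K a).2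
  have hφc : ∀ a, Continuous (φ a) := fun a =>
    continuous_iff_continuousAt.2 fun z => (hφ z a).continuousAt
  have hec : ∀ j, Continuous (e j) := fun j => (he j).continuous
  -- With inequality residual R and equation residual Q, first ‖z - y‖ ≤ C₁ Q reaches e = 0, then ‖w
  -- - z‖ ≤ C₂ (R + M ‖z - y‖) restores φ ≤ 0; M bounds the growth of the violation between y and z.
  obtain ⟨C, hC⟩ : ∃ C : ℝ, C = C₁ + C₂ + C₂ * M * C₁ := ⟨_, rfl⟩
  have hC0 : 0 ≤ C := hC ▸ by positivity
  obtain ⟨r, hr, hball⟩ := Metric.eventually_nhds_iff_ball.1 (h₂.and (hUev.and hP))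
  have hsmall : ∀ᶠ y in 𝓝 x, C * (∑ a, max (φ a y) 0 + ∑ j, |e j y|) < r / 2 := by
    have hc : Continuous fun y => C * (∑ a, max (φ a y) 0 + ∑ j, |e j y|) := by fun_prop
    have := hc.tendsto x
    simp only [hφx, hex, max_self, abs_zero, Finset.sum_const_zero, add_zero, mul_zero] at this
    exact this.eventually (gt_mem_nhds (by positivity))
  refine ⟨C, hC0, ?_⟩
  filter_upwards [h₁, hsmall, Metric.ball_mem_nhds x (half_pos hr)] with y h1 h2 h3
  obtain ⟨z, hez, hz⟩ := h1
  obtain ⟨R, hR⟩ : ∃ R, R = ∑ a, max (φ a y) 0 := ⟨_, rfl⟩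
  obtain ⟨Q, hQ⟩ : ∃ Q, Q = ∑ j, |e j y| := ⟨_, rfl⟩
  have hR0 : 0 ≤ R := hR ▸ Finset.sum_nonneg fun a _ => le_max_right _ _
  have hQ0 : 0 ≤ Q := hQ ▸ Finset.sum_nonneg fun j _ => abs_nonneg _
  rw [← hR, ← hQ] at h2 ⊢
  rw [← hQ] at hz
  rw [Metric.mem_ball, dist_eq_norm] at h3
  have hzC : C₁ * Q ≤ C * (R + Q) := by
    rw [hC]
    have : 0 ≤ C₁ * R + C₂ * (R + Q) + C₂ * M * C₁ * (R + Q) := by positivity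
    nlinarith
  have hyr : y ∈ Metric.ball x r := by
    rw [Metric.mem_ball, dist_eq_norm]
    linarith
  have hzr : z ∈ Metric.ball x r := by
    rw [Metric.mem_ball, dist_eq_norm]
    have := norm_sub_le_norm_sub_add_norm_sub z y x
    linarith
  obtain ⟨w, hew, hφw, hw⟩ := (hball z hzr).1 hez
  have hviol : violation φ z ≤ R + M * ‖z - y‖ := by
    refine (violation_le_sum φ z).trans ?_
    rw [hR, hM, Finset.sum_mul, ← Finset.sum_add_distrib]
    refine Finset.sum_le_sum fun a _ => max_le ?_ ?_
    · have k1 := (hK a).dist_le_mul z ((hball z hzr).2.1 a) y ((hball y hyr).2.1 a)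
      rw [Real.dist_eq, dist_eq_norm] at k1
      have k2 := le_abs_self (φ a z - φ a y)
      have k3 := le_max_left (φ a y) 0
      linarith
    · have : 0 ≤ (K a : ℝ) := (K a).2
      have := le_max_right (φ a y) 0
      positivity
  have hwy : ‖w - y‖ ≤ C * (R + Q) := by
    have k1 := norm_sub_le_norm_sub_add_norm_sub w z y
    have k2 := mul_le_mul_of_nonneg_left hviol hC₂
    have k3 : C₂ * M * ‖z - y‖ ≤ C₂ * M * (C₁ * Q) :=
      mul_le_mul_of_nonneg_left hz (by positivity)
    have k4 : 0 ≤ C₁ * R + C₂ * Q + C₂ * M * C₁ * R := by positivity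
    rw [hC]
    nlinarith
  refine ⟨w, hφw, hew, (hball w ?_).2.2, hwy⟩
  rw [Metric.mem_ball, dist_eq_norm]
  have := norm_sub_le_norm_sub_add_norm_sub w y x
  linarith

end ErrorBound

/-! ### Normal cones of the axes and of the cross -/

section PlanarCones

theorem inner_nonpos_of_mem_regularNormalCone {E : Type*} [NormedAddCommGroup E]
    [InnerProductSpace ℝ E] {C : Set E} {x v w : E} (hv : v ∈ regularNormalCone C x)
    (hw : ∀ t > (0 : ℝ), x + t • w ∈ C) : inner ℝ v w ≤ 0 := by
  refine le_of_forall_pos_le_add fun ε hε => ?_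
  have hε' : 0 < ε / (‖w‖ + 1) := by positivity
  have h1 : Tendsto (fun t : ℝ => x + t • w) (𝓝[>] 0) (𝓝[C] x) :=
    tendsto_nhdsWithin_iff.2 ⟨tendsto_add_smul_nhdsGT x w,
      by filter_upwards [self_mem_nhdsWithin] with t ht using hw t ht⟩
  obtain ⟨t, h2, h3⟩ := ((h1.eventually (hv.2 _ hε')).and self_mem_nhdsWithin).exists
  have h3 : 0 < t := h3
  rw [add_sub_cancel_left, real_inner_smul_right, norm_smul, Real.norm_of_nonneg h3.le] at h2
  have h4 : inner ℝ v w ≤ ε / (‖w‖ + 1) * ‖w‖ := by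
    refine le_of_mul_le_mul_left ?_ h3
    linarith
  have h5 : ε / (‖w‖ + 1) * ‖w‖ ≤ ε := by
    rw [div_mul_eq_mul_div, div_le_iff₀ (by positivity)]
    nlinarith
  linarith

theorem regularNormalCone_subset_limitingNormalCone {E : Type*} [NormedAddCommGroup E]
    [InnerProductSpace ℝ E] (C : Set E) (x : E) :
    regularNormalCone C x ⊆ limitingNormalCone C x := fun v hv =>
  ⟨fun _ => x, fun _ => v, fun _ => hv.1, fun _ => hv, tendsto_const_nhds, tendsto_const_nhds⟩

theorem inner_plane (v w : EuclideanSpace ℝ (Fin 2)) : inner ℝ v w = v 0 * w 0 + v 1 * w 1 := by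
  simp [PiLp.inner_apply, Fin.sum_univ_two]
  ring

/-- If `C` contains the horizontal line through `y`, its regular normals at `y` are vertical. -/
theorem apply_zero_of_mem_regularNormalCone {C : Set (EuclideanSpace ℝ (Fin 2))}
    {y η : EuclideanSpace ℝ (Fin 2)} (hη : η ∈ regularNormalCone C y)
    (hC : ∀ z, z 1 = y 1 → z ∈ C) : η 0 = 0 := by
  have h1 := inner_nonpos_of_mem_regularNormalCone (w := !₂[(1 : ℝ), 0]) hη
    fun t _ => hC _ (by simp)
  have h2 := inner_nonpos_of_mem_regularNormalCone (w := !₂[(-1 : ℝ), 0]) hη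
    fun t _ => hC _ (by simp)
  rw [inner_plane] at h1 h2
  simp at h1 h2
  linarith

theorem apply_one_of_mem_regularNormalCone {C : Set (EuclideanSpace ℝ (Fin 2))}
    {y η : EuclideanSpace ℝ (Fin 2)} (hη : η ∈ regularNormalCone C y)
    (hC : ∀ z, z 0 = y 0 → z ∈ C) : η 1 = 0 := by
  have h1 := inner_nonpos_of_mem_regularNormalCone (w := !₂[(0 : ℝ), 1]) hη
    fun t _ => hC _ (by simp)
  have h2 := inner_nonpos_of_mem_regularNormalCone (w := !₂[(0 : ℝ), -1]) hη
    fun t _ => hC _ (by simp)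
  rw [inner_plane] at h1 h2
  simp at h1 h2
  linarith

/-- Near y the set C lies on a horizontal line, to which a vertical vector is orthogonal. -/
theorem mem_regularNormalCone_of_apply_zero {C : Set (EuclideanSpace ℝ (Fin 2))}
    {y η : EuclideanSpace ℝ (Fin 2)} (hη : η 0 = 0) (hy : y ∈ C)
    (hC : ∀ᶠ z in 𝓝[C] y, z 1 = y 1) : η ∈ regularNormalCone C y := by
  refine ⟨hy, fun ε hε => ?_⟩
  filter_upwards [hC] with z hz
  rw [inner_plane, hη]
  simp only [PiLp.sub_apply, hz, sub_self, mul_zero, zero_mul, add_zero]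
  positivity

theorem mem_regularNormalCone_of_apply_one {C : Set (EuclideanSpace ℝ (Fin 2))}
    {y η : EuclideanSpace ℝ (Fin 2)} (hη : η 1 = 0) (hy : y ∈ C)
    (hC : ∀ᶠ z in 𝓝[C] y, z 0 = y 0) : η ∈ regularNormalCone C y := by
  refine ⟨hy, fun ε hε => ?_⟩
  filter_upwards [hC] with z hz
  rw [inner_plane, hη]
  simp only [PiLp.sub_apply, hz, sub_self, mul_zero, zero_mul, add_zero]
  positivity

theorem regularNormalCone_axisOne {y : EuclideanSpace ℝ (Fin 2)} (hy : y ∈ axisOne) :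
    regularNormalCone axisOne y = {η | η 0 = 0} := by
  have hy1 : y 1 = 0 := hy
  refine Set.Subset.antisymm (fun η hη => ?_) fun η hη => ?_
  · exact apply_zero_of_mem_regularNormalCone hη fun z hz => hz.trans hy1
  · refine mem_regularNormalCone_of_apply_zero hη hy ?_
    filter_upwards [self_mem_nhdsWithin] with z hz
    rw [hy1]
    exact hz

theorem regularNormalCone_axisTwo {y : EuclideanSpace ℝ (Fin 2)} (hy : y ∈ axisTwo) :
    regularNormalCone axisTwo y = {η | η 1 = 0} := by
  have hy0 : y 0 = 0 := hy
  refine Set.Subset.antisymm (fun η hη => ?_) fun η hη => ?_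
  · exact apply_one_of_mem_regularNormalCone hη fun z hz => hz.trans hy0
  · refine mem_regularNormalCone_of_apply_one hη hy ?_
    filter_upwards [self_mem_nhdsWithin] with z hz
    rw [hy0]
    exact hz

theorem limitingNormalCone_axisOne {y : EuclideanSpace ℝ (Fin 2)} (hy : y ∈ axisOne) :
    limitingNormalCone axisOne y = {η | η 0 = 0} := by
  refine Set.Subset.antisymm ?_ ?_
  · rintro η ⟨z, w, h1, h2, -, h4⟩
    have h5 : ∀ k, w k 0 = 0 := fun k => by
      have := h2 k
      rwa [regularNormalCone_axisOne (h1 k)] at this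
    refine tendsto_nhds_unique (((PiLp.continuous_apply 2 _ 0).tendsto η).comp h4) ?_
    exact tendsto_const_nhds.congr fun k => (h5 k).symm
  · rw [← regularNormalCone_axisOne hy]
    exact regularNormalCone_subset_limitingNormalCone _ _

theorem limitingNormalCone_axisTwo {y : EuclideanSpace ℝ (Fin 2)} (hy : y ∈ axisTwo) :
    limitingNormalCone axisTwo y = {η | η 1 = 0} := by
  refine Set.Subset.antisymm ?_ ?_
  · rintro η ⟨z, w, h1, h2, -, h4⟩
    have h5 : ∀ k, w k 1 = 0 := fun k => by
      have := h2 k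
      rwa [regularNormalCone_axisTwo (h1 k)] at this
    refine tendsto_nhds_unique (((PiLp.continuous_apply 2 _ 1).tendsto η).comp h4) ?_
    exact tendsto_const_nhds.congr fun k => (h5 k).symm
  · rw [← regularNormalCone_axisTwo hy]
    exact regularNormalCone_subset_limitingNormalCone _ _

/-- The cross contains a full axis through each of its points, and a regular normal is orthogonal to
that axis. -/
theorem regularNormalCone_switchingSet_subset (y : EuclideanSpace ℝ (Fin 2)) :
    regularNormalCone switchingSet y ⊆ {η | η 0 * η 1 = 0} := fun η hη => by
  rcases mul_eq_zero.1 (hη.1 : y 0 * y 1 = 0) with h | h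
  · have := apply_one_of_mem_regularNormalCone hη fun z hz =>
      show z 0 * z 1 = 0 by rw [hz, h, zero_mul]
    simp [this]
  · have := apply_zero_of_mem_regularNormalCone hη fun z hz =>
      show z 0 * z 1 = 0 by rw [hz, h, mul_zero]
    simp [this]

theorem mem_regularNormalCone_switchingSet_of_apply_zero {y η : EuclideanSpace ℝ (Fin 2)}
    (hy0 : y 0 ≠ 0) (hy1 : y 1 = 0) (hη : η 0 = 0) : η ∈ regularNormalCone switchingSet y := by
  refine mem_regularNormalCone_of_apply_zero hη (show y 0 * y 1 = 0 by rw [hy1, mul_zero]) ?_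
  have h1 : ∀ᶠ z : EuclideanSpace ℝ (Fin 2) in 𝓝 y, z 0 ≠ 0 :=
    ((PiLp.continuous_apply 2 _ 0).tendsto y).eventually (isOpen_ne.mem_nhds hy0)
  filter_upwards [h1.filter_mono nhdsWithin_le_nhds, self_mem_nhdsWithin] with z h2 h3
  rw [hy1]
  exact (mul_eq_zero.1 (h3 : z 0 * z 1 = 0)).resolve_left h2

theorem mem_regularNormalCone_switchingSet_of_apply_one {y η : EuclideanSpace ℝ (Fin 2)}
    (hy0 : y 0 = 0) (hy1 : y 1 ≠ 0) (hη : η 1 = 0) : η ∈ regularNormalCone switchingSet y := by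
  refine mem_regularNormalCone_of_apply_one hη (show y 0 * y 1 = 0 by rw [hy0, zero_mul]) ?_
  have h1 : ∀ᶠ z : EuclideanSpace ℝ (Fin 2) in 𝓝 y, z 1 ≠ 0 :=
    ((PiLp.continuous_apply 2 _ 1).tendsto y).eventually (isOpen_ne.mem_nhds hy1)
  filter_upwards [h1.filter_mono nhdsWithin_le_nhds, self_mem_nhdsWithin] with z h2 h3
  rw [hy0]
  exact (mul_eq_zero.1 (h3 : z 0 * z 1 = 0)).resolve_right h2

/-- The origin itself has only the zero regular normal. Nonzero normals arise from points of the
axes tending to 0, where the cross is a line: vertical ones along the horizontal axis and vice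
versa. Conversely η 0 * η 1 = 0 is a closed condition. -/
theorem limitingNormalCone_switchingSet_zero :
    limitingNormalCone switchingSet 0 = {η | η 0 * η 1 = 0} := by
  have h0 : Tendsto (fun k : ℕ => 1 / ((k : ℝ) + 1)) atTop (𝓝 0) :=
    tendsto_one_div_add_atTop_nhds_zero_nat
  refine Set.Subset.antisymm ?_ fun η hη => ?_
  · rintro η ⟨z, w, -, h2, -, h4⟩
    have hc : Continuous fun η : EuclideanSpace ℝ (Fin 2) => η 0 * η 1 :=
      (PiLp.continuous_apply 2 _ 0).mul (PiLp.continuous_apply 2 _ 1)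
    refine tendsto_nhds_unique ((hc.tendsto η).comp h4) ?_
    exact tendsto_const_nhds.congr fun k => (regularNormalCone_switchingSet_subset _ (h2 k)).symm
  · have hpos : ∀ k : ℕ, 1 / ((k : ℝ) + 1) ≠ 0 := fun k => by positivity
    have htend : ∀ b : EuclideanSpace ℝ (Fin 2),
        Tendsto (fun k : ℕ => (1 / ((k : ℝ) + 1)) • b) atTop (𝓝 0) := fun b => by
      simpa using h0.smul_const b
    rcases mul_eq_zero.1 (hη : η 0 * η 1 = 0) with h | h
    · have hmem : ∀ k : ℕ, η ∈ regularNormalCone switchingSet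
          ((1 / ((k : ℝ) + 1)) • !₂[(1 : ℝ), 0]) := fun k =>
        mem_regularNormalCone_switchingSet_of_apply_zero (by simpa using hpos k) (by simp) h
      exact ⟨_, fun _ => η, fun k => (hmem k).1, hmem, htend _, tendsto_const_nhds⟩
    · have hmem : ∀ k : ℕ, η ∈ regularNormalCone switchingSet
          ((1 / ((k : ℝ) + 1)) • !₂[(0 : ℝ), 1]) := fun k =>
        mem_regularNormalCone_switchingSet_of_apply_one (by simp) (by simpa using hpos k) h
      exact ⟨_, fun _ => η, fun k => (hmem k).1, hmem, htend _, tendsto_const_nhds⟩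

theorem limitingNormalCone_switchingSet_zero_eq_iUnion :
    limitingNormalCone switchingSet 0 = ⋃ y, regularNormalCone switchingSet y := by
  rw [limitingNormalCone_switchingSet_zero]
  refine Set.Subset.antisymm (fun η hη => Set.mem_iUnion.2 ?_)
    (Set.iUnion_subset regularNormalCone_switchingSet_subset)
  rcases mul_eq_zero.1 (hη : η 0 * η 1 = 0) with h | h
  · exact ⟨!₂[1, 0], mem_regularNormalCone_switchingSet_of_apply_zero (by simp) (by simp) h⟩
  · exact ⟨!₂[0, 1], mem_regularNormalCone_switchingSet_of_apply_one (by simp) (by simp) h⟩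

theorem regularNormalCone_axes_zero :
    regularNormalCone axisOne 0 ∪ regularNormalCone axisTwo 0 = {η | η 0 * η 1 = 0} := by
  rw [regularNormalCone_axisOne (by simp [axisOne]), regularNormalCone_axisTwo (by simp [axisTwo])]
  ext η
  simp

end PlanarCones

/-! ### Reindexing of linearly independent families -/

section Reindexing

/-- Both families enumerate W, without repetition, over the same subset of Θ. -/
theorem linearIndependent_iff_of_range_eq {Θ κ κ' E : Type*} [AddCommGroup E] [Module ℝ E]
    (W : Θ → E) {u : κ → E} {u' : κ' → E} {f : κ → Θ} {f' : κ' → Θ} (hu : ∀ i, u i = W (f i))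
    (hu' : ∀ i, u' i = W (f' i)) (hf : Function.Injective f) (hf' : Function.Injective f')
    (h : Set.range f = Set.range f') : LinearIndependent ℝ u ↔ LinearIndependent ℝ u' := by
  have h1 : u = W ∘ f := funext hu
  have h2 : u' = W ∘ f' := funext hu'
  rw [h1, h2, ← linearIndepOn_range_iff hf, ← linearIndepOn_range_iff hf', h]

variable {α β γ E : Type*} [DecidableEq α] [DecidableEq β] [AddCommGroup E] [Module ℝ E]
  {P Q R : Finset β}

theorem linearIndependent_disjSum_iff (a : α → E) (b c : β → E) (I₁ : Finset α) (K₂ : Finset P)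
    (K₃ : Finset Q) :
    LinearIndependent ℝ (fun i : ↥(I₁.disjSum (K₂.disjSum K₃)) =>
        Sum.elim a (Sum.elim (fun i : P => b i) fun i : Q => c i) i) ↔
      LinearIndependent ℝ (Sum.elim (fun i : I₁ => a i)
        (Sum.elim (fun i : ↥(K₂.map (Function.Embedding.subtype _)) => b i)
          fun i : ↥(K₃.map (Function.Embedding.subtype _)) => c i)) := by
  refine linearIndependent_iff_of_range_eq (Sum.elim a (Sum.elim b c))
    (f := fun i : ↥(I₁.disjSum (K₂.disjSum K₃)) =>
      Sum.map id (Sum.map (fun i : P => (i : β)) fun i : Q => (i : β)) i)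
    (f' := Sum.elim (fun i : I₁ => Sum.inl (i : α))
      (Sum.elim (fun i : ↥(K₂.map (Function.Embedding.subtype _)) => Sum.inr (Sum.inl (i : β)))
        fun i : ↥(K₃.map (Function.Embedding.subtype _)) => Sum.inr (Sum.inr (i : β))))
    ?_ ?_ ?_ ?_ ?_
  · rintro ⟨i | i | i, hi⟩ <;> rfl
  · rintro (i | i | i) <;> rfl
  · exact (Function.injective_id.sumMap
      (Subtype.val_injective.sumMap Subtype.val_injective)).comp Subtype.val_injective
  · rintro (i | i | i) (j | j | j) hij <;> first | (simp at hij; done) | simpa using hij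
  · ext (i | i | i) <;> simp

theorem range_disjSum (a : α → E) (b c : β → E) (I₁ : Finset α) (K₂ : Finset P) (K₃ : Finset Q) :
    Set.range (fun i : ↥(I₁.disjSum (K₂.disjSum K₃)) =>
        Sum.elim a (Sum.elim (fun i : P => b i) fun i : Q => c i) i) =
      Set.range (Sum.elim (fun i : I₁ => a i)
        (Sum.elim (fun i : ↥(K₂.map (Function.Embedding.subtype _)) => b i)
          fun i : ↥(K₃.map (Function.Embedding.subtype _)) => c i)) := by
  ext y
  simp

/-- Independence concerns indexed families, so no index may be merged when sums of types become
unions of finsets. This is where disjointness of P and Q from R is needed. -/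
theorem linearIndependent_system_iff (v : γ → E) (a : α → E) (b c : β → E)
    (I₄ : Finset γ) (I₁ : Finset α) (K₂ : Finset P) (K₃ : Finset Q) {p q : R → Prop}
    {I₅ I₆ : Finset β} (hPR : Disjoint P R) (hQR : Disjoint Q R)
    (h₅ : ∀ i, i ∈ I₅ ↔ ∃ h : i ∈ R, p ⟨i, h⟩) (h₆ : ∀ i, i ∈ I₆ ↔ ∃ h : i ∈ R, q ⟨i, h⟩) :
    LinearIndependent ℝ (Sum.elim (fun i : I₄ => v i)
      (Sum.elim (fun i : ↥(I₁.disjSum (K₂.disjSum K₃)) =>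
        Sum.elim a (Sum.elim (fun i : P => b i) fun i : Q => c i) i)
        (Sum.elim (fun i : {i : R // p i} => b i) fun i : {i : R // q i} => c i))) ↔
    LinearIndependent ℝ (Sum.elim (fun i : I₄ => v i)
      (Sum.elim (fun i : I₁ => a i)
        (Sum.elim (fun i : ↥(K₂.map (Function.Embedding.subtype _) ∪ I₅) => b i)
          fun i : ↥(K₃.map (Function.Embedding.subtype _) ∪ I₆) => c i))) := by
  have hPR' : ∀ (i : P) (j : R), (i : β) ≠ j := fun i j h =>
    (Finset.disjoint_left.1 hPR) i.2 (h ▸ j.2)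
  have hQR' : ∀ (i : Q) (j : R), (i : β) ≠ j := fun i j h =>
    (Finset.disjoint_left.1 hQR) i.2 (h ▸ j.2)
  refine linearIndependent_iff_of_range_eq
    (Sum.elim v (Sum.elim a (Sum.elim b c)))
    (f := Sum.elim (fun i : I₄ => Sum.inl (i : γ))
      (Sum.elim (fun i : ↥(I₁.disjSum (K₂.disjSum K₃)) =>
        Sum.inr (Sum.map id (Sum.map (fun i : P => (i : β)) fun i : Q => (i : β)) i))
        (Sum.elim (fun i : {i : R // p i} => Sum.inr (Sum.inr (Sum.inl (i : β))))
          fun i : {i : R // q i} => Sum.inr (Sum.inr (Sum.inr (i : β))))))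
    (f' := Sum.elim (fun i : I₄ => Sum.inl (i : γ))
      (Sum.elim (fun i : I₁ => Sum.inr (Sum.inl (i : α)))
      (Sum.elim (fun i : ↥(K₂.map (Function.Embedding.subtype _) ∪ I₅) =>
          Sum.inr (Sum.inr (Sum.inl (i : β))))
        fun i : ↥(K₃.map (Function.Embedding.subtype _) ∪ I₆) =>
          Sum.inr (Sum.inr (Sum.inr (i : β))))))
    ?_ ?_ ?_ ?_ ?_
  · rintro (i | ⟨i | i | i, hi⟩ | i | i) <;> rfl
  · rintro (i | i | i | i) <;> rfl
  · rintro (i | ⟨i | i | i, hi⟩ | i | i) (j | ⟨j | j | j, hj⟩ | j | j) hij <;>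
      first
      | (simp at hij; done)
      | (simp [hPR', hQR', fun i j => (hPR' i j).symm, fun i j => (hQR' i j).symm] at hij; done)
      | (simp at hij; rw [Subtype.ext hij])
      | simpa using hij
  · rintro (i | i | i | i) (j | j | j | j) hij <;> first | (simp at hij; done) | simpa using hij
  · ext (i | i | i | i) <;> simp [h₅, h₆]

end Reindexing

/-! ### Equivalence of the forms of RCPLD -/

section Reformulation

theorem sum_system {α β E : Type*} [DecidableEq α] [DecidableEq β] [AddCommGroup E] [Module ℝ E]
    {P Q R : Finset β} (a : α → E) (b c : β → E) {I₁ : Finset α} {K₂ : Finset P} {K₃ : Finset Q}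
    {K₅ K₆ : Finset R} {lame : α ⊕ P ⊕ Q → ℝ} {η0 η1 : R → ℝ} {lamh : α → ℝ} {lamG lamH : β → ℝ}
    (hPR : Disjoint P R) (hQR : Disjoint Q R)
    (h₁ : ∀ i ∈ I₁, lamh i = lame (Sum.inl i))
    (h₂ : ∀ i ∈ K₂, lamG i = lame (Sum.inr (Sum.inl i)))
    (h₃ : ∀ i ∈ K₃, lamH i = lame (Sum.inr (Sum.inr i)))
    (h₅ : ∀ i, η0 i ≠ 0 ↔ i ∈ K₅) (h₆ : ∀ i, η1 i ≠ 0 ↔ i ∈ K₆)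
    (h₅' : ∀ i ∈ K₅, lamG i = η0 i) (h₆' : ∀ i ∈ K₆, lamH i = η1 i) :
    ∑ i ∈ I₁.disjSum (K₂.disjSum K₃),
        lame i • Sum.elim a (Sum.elim (fun i : P => b i) fun i : Q => c i) i +
      ∑ i : R, (η0 i • b i + η1 i • c i) =
    ∑ i ∈ I₁, lamh i • a i +
      ∑ i ∈ K₂.map (Function.Embedding.subtype _) ∪ K₅.map (Function.Embedding.subtype _),
        lamG i • b i +
      ∑ i ∈ K₃.map (Function.Embedding.subtype _) ∪ K₆.map (Function.Embedding.subtype _),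
        lamH i • c i := by
  have hdisj : ∀ {T : Finset β}, Disjoint T R → ∀ (K : Finset T) (K' : Finset R),
      Disjoint (K.map (Function.Embedding.subtype _)) (K'.map (Function.Embedding.subtype _)) := by
    intro T hT K K'
    refine Finset.disjoint_left.2 fun i hi hi' => ?_
    simp only [Finset.mem_map, Function.Embedding.subtype_apply, Subtype.exists,
      exists_and_right, exists_eq_right] at hi hi'
    obtain ⟨k1, -⟩ := hi
    obtain ⟨k2, -⟩ := hi'
    exact Finset.disjoint_left.1 hT k1 k2
  have hη : ∀ {η : R → ℝ} {K : Finset R} {lam : β → ℝ} (d : β → E), (∀ i, η i ≠ 0 ↔ i ∈ K) →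
      (∀ i ∈ K, lam i = η i) → ∑ i, η i • d i = ∑ i ∈ K, lam i • d i := by
    intro η K lam d k1 k2
    rw [← Finset.sum_subset (Finset.subset_univ K) fun i _ hi => by
      rw [not_not.1 fun h => hi ((k1 i).1 h), zero_smul]]
    exact Finset.sum_congr rfl fun i hi => by rw [k2 i hi]
  have e₁ : ∑ i ∈ I₁, lame (Sum.inl i) • a i = ∑ i ∈ I₁, lamh i • a i :=
    Finset.sum_congr rfl fun i hi => by rw [h₁ i hi]
  have e₂ : ∑ i ∈ K₂, lame (Sum.inr (Sum.inl i)) • b i = ∑ i ∈ K₂, lamG i • b i :=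
    Finset.sum_congr rfl fun i hi => by rw [h₂ i hi]
  have e₃ : ∑ i ∈ K₃, lame (Sum.inr (Sum.inr i)) • c i = ∑ i ∈ K₃, lamH i • c i :=
    Finset.sum_congr rfl fun i hi => by rw [h₃ i hi]
  rw [Finset.sum_union (hdisj hPR _ _), Finset.sum_union (hdisj hQR _ _), Finset.sum_map,
    Finset.sum_map, Finset.sum_map, Finset.sum_map, Finset.sum_disjSum, Finset.sum_disjSum,
    Finset.sum_add_distrib, hη b h₅ h₅', hη c h₆ h₆']
  simp only [Function.Embedding.subtype_apply, Sum.elim_inl, Sum.elim_inr]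
  rw [e₁, e₂, e₃]
  abel

namespace SwitchingSystem

variable {d n m p : ℕ} (S : SwitchingSystem d n m p) (x : EuclideanSpace ℝ (Fin d))

theorem gradient_eqFun (y : EuclideanSpace ℝ (Fin d)) (i : Fin m ⊕ S.indexG x ⊕ S.indexH x) :
    gradient (S.eqFun x i) y = Sum.elim (fun i => gradient (S.h i) y)
      (Sum.elim (fun i : S.indexG x => gradient (S.G i) y)
        fun i : S.indexH x => gradient (S.H i) y) i := by
  rcases i with i | i | i <;> rfl

theorem disjoint_indexG_indexGH : Disjoint (S.indexG x) (S.indexGH x) :=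
  Finset.disjoint_left.2 fun i h1 h2 => by
    simp only [indexG, indexGH, Finset.mem_filter, Finset.mem_univ, true_and] at h1 h2
    exact h1.2 h2.2

theorem disjoint_indexH_indexGH : Disjoint (S.indexH x) (S.indexGH x) :=
  Finset.disjoint_left.2 fun i h1 h2 => by
    simp only [indexH, indexGH, Finset.mem_filter, Finset.mem_univ, true_and] at h1 h2
    exact h1.1 h2.1

theorem isBasisOfSpan_disjSum_iff (I₁ : Finset (Fin m)) (K₂ : Finset (S.indexG x))
    (K₃ : Finset (S.indexH x)) :
    IsBasisOfSpan (fun i => gradient (S.eqFun x i) x) (I₁.disjSum (K₂.disjSum K₃)) ↔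
      LinearIndependent ℝ (Sum.elim (fun i : I₁ => gradient (S.h i) x)
        (Sum.elim
          (fun i : ↥(K₂.map (Function.Embedding.subtype _)) => gradient (S.G i) x)
          (fun i : ↥(K₃.map (Function.Embedding.subtype _)) => gradient (S.H i) x))) ∧
      Submodule.span ℝ (Set.range (Sum.elim (fun i : I₁ => gradient (S.h i) x)
        (Sum.elim
          (fun i : ↥(K₂.map (Function.Embedding.subtype _)) => gradient (S.G i) x)
          (fun i : ↥(K₃.map (Function.Embedding.subtype _)) => gradient (S.H i) x)))) =
        Submodule.span ℝ (Set.range fun i => gradient (S.eqFun x i) x) := by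
  unfold IsBasisOfSpan
  have h1 := linearIndependent_disjSum_iff (fun i => gradient (S.h i) x)
    (fun i => gradient (S.G i) x) (fun i => gradient (S.H i) x) I₁ K₂ K₃
  have h2 := range_disjSum (fun i => gradient (S.h i) x)
    (fun i => gradient (S.G i) x) (fun i => gradient (S.H i) x) I₁ K₂ K₃
  rw [← h1, ← h2]
  simp only [gradient_eqFun]

/-- The basis splits into its h, G and H parts, and I₅ and I₆ are taken as the supports of the two
entries of η. -/
theorem localRCPLD_of_RCPLD (h : S.RCPLD x) :
    S.LocalRCPLD x fun _ => {η | η 0 * η 1 = 0} := by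
  classical
  refine ⟨h.1, fun J hJ I lamg lame η v hI hN hne hsum xs vs hxs hxne hvs => ?_⟩
  obtain ⟨I₁, K₂, K₃, rfl⟩ : ∃ (I₁ : Finset (Fin m)) (K₂ : Finset (S.indexG x))
      (K₃ : Finset (S.indexH x)), J = I₁.disjSum (K₂.disjSum K₃) :=
    ⟨J.toLeft, J.toRight.toLeft, J.toRight.toRight, by
      rw [Finset.toLeft_disjSum_toRight, Finset.toLeft_disjSum_toRight]⟩
  obtain ⟨hli, hspan⟩ := (S.isBasisOfSpan_disjSum_iff x I₁ K₂ K₃).1 hJ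
  -- Since I^G and I^{GH} are disjoint, one function can hold both kinds of multipliers of the G_i.
  obtain ⟨lamG, hlamG⟩ : ∃ lamG : Fin p → ℝ, lamG = fun i =>
      if h : i ∈ S.indexG x then lame (Sum.inr (Sum.inl ⟨i, h⟩))
      else if h : i ∈ S.indexGH x then η ⟨i, h⟩ 0 else 0 := ⟨_, rfl⟩
  obtain ⟨lamH, hlamH⟩ : ∃ lamH : Fin p → ℝ, lamH = fun i =>
      if h : i ∈ S.indexH x then lame (Sum.inr (Sum.inr ⟨i, h⟩))
      else if h : i ∈ S.indexGH x then η ⟨i, h⟩ 1 else 0 := ⟨_, rfl⟩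
  have hGG : ∀ i : S.indexG x, lamG i = lame (Sum.inr (Sum.inl i)) := fun i => by simp [hlamG]
  have hHH : ∀ i : S.indexH x, lamH i = lame (Sum.inr (Sum.inr i)) := fun i => by simp [hlamH]
  have hG0 : ∀ i : S.indexGH x, lamG i = η i 0 := fun i => by
    have := Finset.disjoint_right.1 (S.disjoint_indexG_indexGH x) i.2
    simp only [hlamG, this, dite_false, i.2, dite_true]
  have hH1 : ∀ i : S.indexGH x, lamH i = η i 1 := fun i => by
    have := Finset.disjoint_right.1 (S.disjoint_indexH_indexGH x) i.2
    simp only [hlamH, this, dite_false, i.2, dite_true]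
  obtain ⟨K₅, hK₅⟩ : ∃ K₅ : Finset (S.indexGH x), ∀ i, i ∈ K₅ ↔ η i 0 ≠ 0 :=
    ⟨Finset.univ.filter fun i => η i 0 ≠ 0, by simp⟩
  obtain ⟨K₆, hK₆⟩ : ∃ K₆ : Finset (S.indexGH x), ∀ i, i ∈ K₆ ↔ η i 1 ≠ 0 :=
    ⟨Finset.univ.filter fun i => η i 1 ≠ 0, by simp⟩
  have key := h.2 I₁ (K₂.map (Function.Embedding.subtype _)) (K₃.map (Function.Embedding.subtype _))
    (Finset.map_subtype_subset K₂) (Finset.map_subtype_subset K₃) hli hspan I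
    (K₅.map (Function.Embedding.subtype _)) (K₆.map (Function.Embedding.subtype _)) lamg
    (fun i => lame (Sum.inl i)) lamG lamH v hI
    (fun i hi => by
      obtain ⟨j, hj, rfl⟩ := Finset.mem_map.1 hi
      exact ⟨j.2, by simpa [hG0] using (hK₅ j).1 hj⟩)
    (fun i hi => by
      obtain ⟨j, hj, rfl⟩ := Finset.mem_map.1 hi
      exact ⟨j.2, by simpa [hH1] using (hK₆ j).1 hj⟩)
    (fun i hi => by
      rw [hG0 ⟨i, hi⟩, hH1 ⟨i, hi⟩]
      exact hN ⟨i, hi⟩)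
    (by
      rcases hne with h1 | ⟨i, hi, h1⟩ | ⟨i, h1⟩
      · exact Or.inl h1
      · rcases i with i | i | i
        · exact Or.inr (Or.inl ⟨i, by simpa using hi, h1⟩)
        · refine Or.inr (Or.inr (Or.inl ⟨i, Finset.mem_union_left _ ?_, by rwa [hGG]⟩))
          exact Finset.mem_map.2 ⟨i, by simpa using hi, rfl⟩
        · refine Or.inr (Or.inr (Or.inr ⟨i, Finset.mem_union_left _ ?_, by rwa [hHH]⟩))
          exact Finset.mem_map.2 ⟨i, by simpa using hi, rfl⟩
      · have : η i 0 ≠ 0 ∨ η i 1 ≠ 0 := by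
          by_contra hno
          push Not at hno
          refine h1 ?_
          ext k
          fin_cases k
          · exact hno.1
          · exact hno.2
        rcases this with h2 | h2
        · refine Or.inr (Or.inr (Or.inl ⟨i, Finset.mem_union_right _ ?_, by rwa [hG0]⟩))
          exact Finset.mem_map.2 ⟨i, (hK₅ i).2 h2, rfl⟩
        · refine Or.inr (Or.inr (Or.inr ⟨i, Finset.mem_union_right _ ?_, by rwa [hH1]⟩))
          exact Finset.mem_map.2 ⟨i, (hK₆ i).2 h2, rfl⟩)
    (by
      have h1 := sum_system (fun i => gradient (S.h i) x) (fun i => gradient (S.G i) x)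
        (fun i => gradient (S.H i) x) (I₁ := I₁) (K₂ := K₂) (K₃ := K₃) (K₅ := K₅) (K₆ := K₆)
        (lame := lame) (η0 := fun i => η i 0) (η1 := fun i => η i 1)
        (lamh := fun i => lame (Sum.inl i)) (lamG := lamG) (lamH := lamH)
        (S.disjoint_indexG_indexGH x) (S.disjoint_indexH_indexGH x) (fun _ _ => rfl)
        (fun i _ => hGG i) (fun i _ => hHH i) (fun i => (hK₅ i).symm) (fun i => (hK₆ i).symm)
        (fun i _ => hG0 i) (fun i _ => hH1 i)
      simp only [gradient_eqFun] at hsum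
      rw [← hsum]
      have h2 := congrArg (fun z => ∑ i ∈ I, lamg i • v i + z) h1
      simp only [← add_assoc] at h2
      exact h2.symm)
    xs vs hxs hxne hvs
  filter_upwards [key] with k hk hli'
  simp only [gradient_eqFun] at hli'
  refine hk ((linearIndependent_system_iff (vs k) (fun i => gradient (S.h i) (xs k))
    (fun i => gradient (S.G i) (xs k)) (fun i => gradient (S.H i) (xs k)) I I₁ K₂ K₃
    (S.disjoint_indexG_indexGH x) (S.disjoint_indexH_indexGH x) (fun i => ?_) fun i => ?_).1 hli')
  · simp [hK₅]
  · simp [hK₆]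

theorem RCPLD_of_localRCPLD (h : S.LocalRCPLD x fun _ => {η | η 0 * η 1 = 0}) : S.RCPLD x := by
  classical
  refine ⟨h.1, fun I₁ I₂ I₃ h₂ h₃ hli hspan I₄ I₅ I₆ lamg lamh lamG lamH v hI h₅ h₆ hprod hne hsum
    xs vs hxs hxne hvs => ?_⟩
  obtain ⟨K₂, rfl⟩ : ∃ K₂ : Finset (S.indexG x), I₂ = K₂.map (Function.Embedding.subtype _) :=
    ⟨I₂.subtype _, (Finset.subtype_map_of_mem h₂).symm⟩
  obtain ⟨K₃, rfl⟩ : ∃ K₃ : Finset (S.indexH x), I₃ = K₃.map (Function.Embedding.subtype _) :=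
    ⟨I₃.subtype _, (Finset.subtype_map_of_mem h₃).symm⟩
  obtain ⟨K₅, rfl⟩ : ∃ K₅ : Finset (S.indexGH x), I₅ = K₅.map (Function.Embedding.subtype _) :=
    ⟨I₅.subtype _, (Finset.subtype_map_of_mem fun i hi => (h₅ i hi).1).symm⟩
  obtain ⟨K₆, rfl⟩ : ∃ K₆ : Finset (S.indexGH x), I₆ = K₆.map (Function.Embedding.subtype _) :=
    ⟨I₆.subtype _, (Finset.subtype_map_of_mem fun i hi => (h₆ i hi).1).symm⟩
  have hlamG : ∀ i ∈ K₅, lamG i ≠ 0 := fun i hi => (h₅ i (Finset.mem_map.2 ⟨i, hi, rfl⟩)).2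
  have hlamH : ∀ i ∈ K₆, lamH i ≠ 0 := fun i hi => (h₆ i (Finset.mem_map.2 ⟨i, hi, rfl⟩)).2
  -- Multipliers at biactive indices outside I₅ or I₆ do not occur in the sum but may be nonzero.
  -- They are cut off so that the supports of η are exactly K₅ and K₆.
  obtain ⟨η, hη⟩ : ∃ η : S.indexGH x → EuclideanSpace ℝ (Fin 2), η = fun i =>
      !₂[if i ∈ K₅ then lamG i else 0, if i ∈ K₆ then lamH i else 0] := ⟨_, rfl⟩
  have hη0 : ∀ i, η i 0 = if i ∈ K₅ then lamG i else 0 := fun i => by simp [hη]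
  have hη1 : ∀ i, η i 1 = if i ∈ K₆ then lamH i else 0 := fun i => by simp [hη]
  have hK₅ : ∀ i, η i 0 ≠ 0 ↔ i ∈ K₅ := fun i => by
    rw [hη0]
    by_cases hi : i ∈ K₅
    · simpa [hi] using hlamG i hi
    · simp [hi]
  have hK₆ : ∀ i, η i 1 ≠ 0 ↔ i ∈ K₆ := fun i => by
    rw [hη1]
    by_cases hi : i ∈ K₆
    · simpa [hi] using hlamH i hi
    · simp [hi]
  have key := h.2 (I₁.disjSum (K₂.disjSum K₃)) ((S.isBasisOfSpan_disjSum_iff x I₁ K₂ K₃).2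
    ⟨hli, hspan⟩) I₄ lamg (Sum.elim lamh (Sum.elim (fun i => lamG i) fun i => lamH i)) η v hI
    (fun i => by
      change η i 0 * η i 1 = 0
      rw [hη0, hη1]
      have := hprod i i.2
      split_ifs <;> simp [this])
    (by
      rcases hne with h1 | ⟨i, hi, h1⟩ | ⟨i, hi, h1⟩ | ⟨i, hi, h1⟩
      · exact Or.inl h1
      · exact Or.inr (Or.inl ⟨Sum.inl i, by simpa using hi, h1⟩)
      · rcases Finset.mem_union.1 hi with hi | hi
        · obtain ⟨j, hj, rfl⟩ := Finset.mem_map.1 hi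
          exact Or.inr (Or.inl ⟨Sum.inr (Sum.inl j), by simpa using hj, h1⟩)
        · obtain ⟨j, hj, rfl⟩ := Finset.mem_map.1 hi
          refine Or.inr (Or.inr ⟨j, fun h0 => (hK₅ j).2 hj (by rw [h0]; rfl)⟩)
      · rcases Finset.mem_union.1 hi with hi | hi
        · obtain ⟨j, hj, rfl⟩ := Finset.mem_map.1 hi
          exact Or.inr (Or.inl ⟨Sum.inr (Sum.inr j), by simpa using hj, h1⟩)
        · obtain ⟨j, hj, rfl⟩ := Finset.mem_map.1 hi
          refine Or.inr (Or.inr ⟨j, fun h0 => (hK₆ j).2 hj (by rw [h0]; rfl)⟩))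
    (by
      have h1 := sum_system (fun i => gradient (S.h i) x) (fun i => gradient (S.G i) x)
        (fun i => gradient (S.H i) x) (I₁ := I₁) (K₂ := K₂) (K₃ := K₃) (K₅ := K₅) (K₆ := K₆)
        (lame := Sum.elim lamh (Sum.elim (fun i => lamG i) fun i => lamH i))
        (η0 := fun i => η i 0) (η1 := fun i => η i 1) (lamh := lamh) (lamG := lamG) (lamH := lamH)
        (S.disjoint_indexG_indexGH x) (S.disjoint_indexH_indexGH x) (fun _ _ => rfl)
        (fun i _ => rfl) (fun i _ => rfl) hK₅ hK₆
        (fun i hi => by simp [hη0, hi]) (fun i hi => by simp [hη1, hi])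
      simp only [gradient_eqFun]
      rw [← hsum]
      have h2 := congrArg (fun z => ∑ i ∈ I₄, lamg i • v i + z) h1
      simp only [← add_assoc] at h2
      exact h2)
    xs vs hxs hxne hvs
  filter_upwards [key] with k hk hli'
  simp only [gradient_eqFun] at hk
  refine hk ((linearIndependent_system_iff (vs k) (fun i => gradient (S.h i) (xs k))
    (fun i => gradient (S.G i) (xs k)) (fun i => gradient (S.H i) (xs k)) I₄ I₁ K₂ K₃
    (S.disjoint_indexG_indexGH x) (S.disjoint_indexH_indexGH x) (fun i => ?_) fun i => ?_).2 hli')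
  · simp only [hK₅]
    simp
  · simp only [hK₆]
    simp

theorem RCPLD_iff_localRCPLD :
    S.RCPLD x ↔ S.LocalRCPLD x fun _ => {η | η 0 * η 1 = 0} :=
  ⟨S.localRCPLD_of_RCPLD x, S.RCPLD_of_localRCPLD x⟩

theorem pair_eq_zero (i : S.indexGH x) : S.pair x i = 0 := by
  have := i.2
  simp only [indexGH, Finset.mem_filter, Finset.mem_univ, true_and] at this
  ext k
  fin_cases k
  · simpa [pair] using this.1
  · simpa [pair] using this.2

theorem RCPLD_iff_localRCPLD_switchingSet : S.RCPLD x ↔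
    S.LocalRCPLD x fun i => limitingNormalCone switchingSet (S.pair x i) := by
  rw [RCPLD_iff_localRCPLD]
  simp only [pair_eq_zero, limitingNormalCone_switchingSet_zero]

theorem RCPLD_iff_localRCPLD_axes : S.RCPLD x ↔
    S.LocalRCPLD x fun i =>
      regularNormalCone axisOne (S.pair x i) ∪ regularNormalCone axisTwo (S.pair x i) := by
  rw [RCPLD_iff_localRCPLD]
  simp only [pair_eq_zero, regularNormalCone_axes_zero]

/-- Normals to an axis have a vanishing entry, so each piece inherits RCPLD. Conversely a given η
with vanishing products is a multiplier of a suitable piece. -/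
theorem RCPLD_iff_piecewiseRCPLD : S.RCPLD x ↔ S.PiecewiseRCPLD x := by
  classical
  rw [RCPLD_iff_localRCPLD]
  have h0₁ : (0 : EuclideanSpace ℝ (Fin 2)) ∈ axisOne := by simp [axisOne]
  have h0₂ : (0 : EuclideanSpace ℝ (Fin 2)) ∈ axisTwo := by simp [axisTwo]
  constructor
  · intro h C hC _
    refine ⟨h.1, fun J hJ I lamg lame η v hI hN => h.2 J hJ I lamg lame η v hI fun i => ?_⟩
    have h1 := hN i
    rcases hC i with h2 | h2
    · simp only [h2, pair_eq_zero, limitingNormalCone_axisOne h0₁] at h1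
      have h1 : η i 0 = 0 := h1
      simp [h1]
    · simp only [h2, pair_eq_zero, limitingNormalCone_axisTwo h0₂] at h1
      have h1 : η i 1 = 0 := h1
      simp [h1]
  · intro h
    refine ⟨(h (fun _ => axisOne) (fun _ => Or.inl rfl) fun i => by
      rw [pair_eq_zero]; exact h0₁).1, fun J hJ I lamg lame η v hI hN => ?_⟩
    -- The partition depends on η: the first axis is used where the first entry vanishes.
    refine (h (fun i => if η i 0 = 0 then axisOne else axisTwo) (fun i => by
      by_cases hi : η i 0 = 0 <;> simp [hi]) (fun i => by
      rw [pair_eq_zero]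
      by_cases hi : η i 0 = 0
      · simpa [hi] using h0₁
      · simpa [hi] using h0₂)).2 J hJ I lamg lame η v hI fun i => ?_
    simp only [pair_eq_zero]
    by_cases hi : η i 0 = 0
    · rw [if_pos hi, limitingNormalCone_axisOne h0₁]
      exact hi
    · rw [if_neg hi, limitingNormalCone_axisTwo h0₂]
      exact (mul_eq_zero.1 (hN i : η i 0 * η i 1 = 0)).resolve_left hi

end SwitchingSystem

end Reformulation

/-! ### Branches of the switching system satisfy the abstract condition -/

section Branches

theorem exists_extension_by_zero {β M : Type*} [Zero M] {p : β → Prop} (γ : {i // p i} → M) :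
    ∃ γ' : β → M, (∀ i : {i // p i}, γ' i = γ i) ∧ ∀ i, ¬ p i → γ' i = 0 := by
  classical
  exact ⟨fun i => if h : p i then γ ⟨i, h⟩ else 0, fun i => by simp [i.2], fun i h => by simp [h]⟩

theorem sum_subtype_smul {β E : Type*} [Fintype β] [AddCommGroup E] [Module ℝ E] {p : β → Prop}
    [Fintype {i // p i}] {γ : {i // p i} → ℝ} {γ' : β → ℝ} (h : ∀ i : {i // p i}, γ' i = γ i)
    (h0 : ∀ i, ¬ p i → γ' i = 0) (w : β → E) : ∑ i, γ i • w i = ∑ i, γ' i • w i := by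
  classical
  rw [← Finset.sum_subset (Finset.subset_univ (Finset.univ.filter p)) (fun i _ hi => by
    rw [h0 i (by simpa using hi), zero_smul]), Finset.sum_subtype (p := p) _ (fun i => by simp)]
  exact Finset.sum_congr rfl fun i _ => by rw [h]

namespace SwitchingSystem

variable {d n m p : ℕ} (S : SwitchingSystem d n m p) (x : EuclideanSpace ℝ (Fin d))

/-- The equality constraint imposed on the biactive index `i` in the branch `σ`: `G_i = 0` if `σ i`
holds, and `H_i = 0` otherwise. -/
def branch (σ : S.indexGH x → Bool) (i : S.indexGH x) : EuclideanSpace ℝ (Fin d) → ℝ :=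
  if σ i then S.G i else S.H i

/-- The active inequality constraints. -/
noncomputable def activeG : Finset (Fin n) := Finset.univ.filter fun i => S.g i x = 0

/-- The inequality constraints of the branch `σ`: the active ones and, as pairs of inequalities,
the equality constraints on the biactive indices. -/
def branchFun (σ : S.indexGH x → Bool) :
    S.activeG x ⊕ S.indexGH x ⊕ S.indexGH x → EuclideanSpace ℝ (Fin d) → ℝ :=
  Sum.elim (fun i => S.g i) (Sum.elim (fun i => S.branch x σ i) fun i y => -S.branch x σ i y)

variable {S x}

theorem contDiff_branch (hG : ∀ i, ContDiff ℝ 1 (S.G i)) (hH : ∀ i, ContDiff ℝ 1 (S.H i))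
    (σ : S.indexGH x → Bool) (i : S.indexGH x) : ContDiff ℝ 1 (S.branch x σ i) := by
  unfold branch
  split_ifs
  · exact hG i
  · exact hH i

/-- A multiplier μ i of the branch equation is the pair (μ i, 0) or (0, μ i), so the
vanishing-product condition is automatic. -/
theorem LocalRCPLD.branch_dependent (hL : S.LocalRCPLD x fun _ => {η | η 0 * η 1 = 0})
    {J : Finset (Fin m ⊕ S.indexG x ⊕ S.indexH x)}
    (hJ : IsBasisOfSpan (fun i => gradient (S.eqFun x i) x) J) (σ : S.indexGH x → Bool)
    {I : Finset (Fin n)} {lamg : Fin n → ℝ} {lame : Fin m ⊕ S.indexG x ⊕ S.indexH x → ℝ}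
    {μ : S.indexGH x → ℝ} {v : Fin n → EuclideanSpace ℝ (Fin d)}
    (hI : ∀ i ∈ I, S.g i x = 0 ∧ 0 ≤ lamg i ∧ v i ∈ limitingSubdiff (S.g i) x)
    (hne : (∃ i ∈ I, lamg i ≠ 0) ∨ ∃ i, μ i ≠ 0)
    (hsum : ∑ i ∈ I, lamg i • v i + ∑ i ∈ J, lame i • gradient (S.eqFun x i) x +
      ∑ i, μ i • gradient (S.branch x σ i) x = 0)
    {xs : ℕ → EuclideanSpace ℝ (Fin d)} {vs : ℕ → Fin n → EuclideanSpace ℝ (Fin d)}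
    (hxs : Tendsto xs atTop (𝓝 x)) (hxne : ∀ k, xs k ≠ x)
    (hvs : ∀ i ∈ I, (∀ k, vs k i ∈ limitingSubdiff (S.g i) (xs k)) ∧
      Tendsto (fun k => vs k i) atTop (𝓝 (v i))) :
    ∀ᶠ k in atTop, ¬ LinearIndependent ℝ (Sum.elim (fun i : I => vs k i)
      (Sum.elim (fun i : J => gradient (S.eqFun x i) (xs k))
        fun i : {i // μ i ≠ 0} => gradient (S.branch x σ i) (xs k))) := by
  classical
  obtain ⟨η, hη⟩ : ∃ η : S.indexGH x → EuclideanSpace ℝ (Fin 2), η = fun i =>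
      !₂[if σ i then μ i else 0, if σ i then 0 else μ i] := ⟨_, rfl⟩
  have hη0 : ∀ i, η i 0 = if σ i then μ i else 0 := fun i => by simp [hη]
  have hη1 : ∀ i, η i 1 = if σ i then 0 else μ i := fun i => by simp [hη]
  have key := hL.2 J hJ I lamg lame η v hI (fun i => by
      change η i 0 * η i 1 = 0
      rw [hη0, hη1]
      split_ifs <;> simp)
    (by
      rcases hne with h | ⟨i, h⟩
      · exact Or.inl h
      · refine Or.inr (Or.inr ⟨i, fun h0 => h ?_⟩)
        have h1 := hη0 i
        have h2 := hη1 i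
        rw [h0] at h1 h2
        by_cases hσ : σ i = true
        · simpa [hσ] using h1.symm
        · simpa [hσ] using h2.symm)
    (by
      rw [← hsum]
      congr 1
      refine Finset.sum_congr rfl fun i _ => ?_
      rw [hη0, hη1]
      unfold branch
      split_ifs <;> simp)
    xs vs hxs hxne hvs
  filter_upwards [key] with k hk hli
  have hσ0 : ∀ i, η i 0 ≠ 0 → σ i = true := fun i h => by
    by_contra hno
    simp [hη0, hno] at h
  have hσ1 : ∀ i, η i 1 ≠ 0 → ¬ σ i = true := fun i h hno => by
    simp [hη1, hno] at h
  refine hk ((linearIndependent_iff_of_range_eq (Θ := Fin n ⊕ (Fin m ⊕ S.indexG x ⊕ S.indexH x) ⊕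
      S.indexGH x)
    (Sum.elim (vs k) (Sum.elim (fun i => gradient (S.eqFun x i) (xs k))
      fun i => gradient (S.branch x σ i) (xs k)))
    (f := Sum.elim (fun i : I => Sum.inl (i : Fin n)) (Sum.elim (fun i : J => Sum.inr (Sum.inl i))
      (Sum.elim (fun i : {i // η i 0 ≠ 0} => Sum.inr (Sum.inr (i : S.indexGH x)))
        fun i : {i // η i 1 ≠ 0} => Sum.inr (Sum.inr (i : S.indexGH x)))))
    (f' := Sum.elim (fun i : I => Sum.inl (i : Fin n)) (Sum.elim (fun i : J => Sum.inr (Sum.inl i))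
      fun i : {i // μ i ≠ 0} => Sum.inr (Sum.inr (i : S.indexGH x))))
    ?_ ?_ ?_ ?_ ?_).2 hli)
  · rintro (i | i | i | i)
    · rfl
    · rfl
    · simp [branch, hσ0 i i.2]
    · simp [branch, hσ1 i i.2]
  · rintro (i | i | i) <;> rfl
  · rintro (i | i | i | i) (j | j | j | j) hij <;> first | (simp at hij; done) | skip
    · simpa using hij
    · simpa using hij
    · simpa [Subtype.coe_inj] using hij
    · refine absurd (hσ0 i i.2) ?_
      have : (i : S.indexGH x) = j := by simpa using hij
      rw [this]
      exact hσ1 j j.2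
    · refine absurd (hσ0 j j.2) ?_
      have : (i : S.indexGH x) = j := by simpa using hij
      rw [← this]
      exact hσ1 i i.2
    · simpa [Subtype.coe_inj] using hij
  · rintro (i | i | i) (j | j | j) hij <;> first | (simp at hij; done) | skip
    · simpa using hij
    · simpa using hij
    · simpa [Subtype.coe_inj] using hij
  · ext (i | i | i)
    · simp
    · simp
    · have : μ i ≠ 0 ↔ η i 0 ≠ 0 ∨ η i 1 ≠ 0 := by
        rw [hη0, hη1]
        split_ifs <;> simp
      simp only [Set.mem_range, Sum.exists, Sum.elim_inl, Sum.elim_inr, reduceCtorEq, exists_false,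
        false_or, Sum.inr.injEq, Subtype.exists, exists_prop, exists_eq_right]
      exact this.symm

/-- If the condition failed, subgradients along a sequence would have no nontrivial relation on the
support of lam modulo the gradients of J. With these gradients independent near x, the whole family
would be independent, against `branch_dependent`. -/
theorem LocalRCPLD.relaxedCPLD (hL : S.LocalRCPLD x fun _ => {η | η 0 * η 1 = 0})
    (hh : ∀ j, ContDiff ℝ 1 (S.eqFun x j))
    (hG : ∀ i, ContDiff ℝ 1 (S.G i)) (hH : ∀ i, ContDiff ℝ 1 (S.H i))
    {J : Finset (Fin m ⊕ S.indexG x ⊕ S.indexH x)}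
    (hJ : IsBasisOfSpan (fun i => gradient (S.eqFun x i) x) J) (σ : S.indexGH x → Bool) :
    RelaxedCPLD (S.branchFun x σ) (fun j : J => S.eqFun x j) x := by
  classical
  intro lam v hlam hne hv hrel
  by_contra hcon
  have hfr : ∃ᶠ q : EuclideanSpace ℝ (Fin d) × (S.activeG x ⊕ S.indexGH x ⊕ S.indexGH x →
      EuclideanSpace ℝ (Fin d)) in 𝓝 (x, v), q.1 ≠ x ∧
      (∀ a, q.2 a ∈ limitingSubdiff (S.branchFun x σ a) q.1) ∧
      ∀ α : S.activeG x ⊕ S.indexGH x ⊕ S.indexGH x → ℝ, (∀ a, lam a = 0 → α a = 0) →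
        ∑ a, α a • q.2 a ∈ gradSpan (fun j : J => S.eqFun x j) q.1 → α = 0 := by
    refine hcon.imp fun h => h.mono fun q hq h1 h2 => ?_
    by_contra hno
    push Not at hno
    exact hq ⟨h1, h2, fun α h3 h4 => by_contra fun h5 => hno α h5 h3 h4⟩
  obtain ⟨q, hq, hqp⟩ := exists_seq_forall_of_frequently hfr
  have hE := contDiff_branch hG hH σ
  have hgrad : ∀ {y : EuclideanSpace ℝ (Fin d)} {w : S.activeG x ⊕ S.indexGH x ⊕ S.indexGH x →
      EuclideanSpace ℝ (Fin d)}, (∀ a, w a ∈ limitingSubdiff (S.branchFun x σ a) y) →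
      (∀ i, w (Sum.inr (Sum.inl i)) = gradient (S.branch x σ i) y) ∧
      ∀ i, w (Sum.inr (Sum.inr i)) = -gradient (S.branch x σ i) y := fun {y w} hw =>
    ⟨fun i => by
      have := hw (Sum.inr (Sum.inl i))
      change _ ∈ limitingSubdiff (S.branch x σ i) y at this
      rwa [(hE i).limitingSubdiff_eq] at this,
    fun i => by
      have := hw (Sum.inr (Sum.inr i))
      change _ ∈ limitingSubdiff (fun y => -S.branch x σ i y) y at this
      rw [(hE i).neg.limitingSubdiff_eq] at this
      rw [Set.mem_singleton_iff.1 this]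
      exact gradient_neg' (hE i) y⟩
  -- The gradients of a branch function and of its negative cancel. If both carried multipliers,
  -- weights (1, 1) on this pair would be an excluded relation. Hence the difference μ i vanishes
  -- only if both multipliers do.
  have hex : ∀ i, lam (Sum.inr (Sum.inl i)) = 0 ∨ lam (Sum.inr (Sum.inr i)) = 0 := fun i => by
    by_contra hno
    push Not at hno
    have h1 := (hqp 0).2.2 (Sum.elim 0 (Sum.elim (Pi.single i 1) (Pi.single i 1))) (by
      rintro (j | j | j) hj
      · rfl
      · have : j ≠ i := fun h => hno.1 (h ▸ hj)
        simp [this]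
      · have : j ≠ i := fun h => hno.2 (h ▸ hj)
        simp [this]) (by
      simp [Fintype.sum_sum_type, Pi.single_apply, ite_smul, (hgrad (hqp 0).2.1).1,
        (hgrad (hqp 0).2.1).2])
    have := congrFun h1 (Sum.inr (Sum.inl i))
    simp at this
  obtain ⟨hv1, hv2⟩ := hgrad hv
  obtain ⟨lamg, hlamg, hlamg0⟩ := exists_extension_by_zero (p := fun i => i ∈ S.activeG x)
    fun i => lam (Sum.inl i)
  obtain ⟨v', hv', -⟩ := exists_extension_by_zero (p := fun i => i ∈ S.activeG x)
    fun i => v (Sum.inl i)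
  choose vs hvs hvs0 using fun k => exists_extension_by_zero (p := fun i => i ∈ S.activeG x)
    fun i => (q k).2 (Sum.inl i)
  obtain ⟨β, hβ⟩ := mem_span_range_iff_exists_fintype_sum.1 hrel
  obtain ⟨lame, hlame, hlame0⟩ := exists_extension_by_zero (p := fun j => j ∈ J) fun j => -β j
  obtain ⟨μ, hμ⟩ : ∃ μ : S.indexGH x → ℝ, μ = fun i =>
    lam (Sum.inr (Sum.inl i)) - lam (Sum.inr (Sum.inr i)) := ⟨_, rfl⟩
  obtain ⟨I, hI⟩ : ∃ I : Finset (Fin n), ∀ i, i ∈ I ↔ lamg i ≠ 0 :=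
    ⟨Finset.univ.filter fun i => lamg i ≠ 0, by simp⟩
  have hIact : ∀ i ∈ I, i ∈ S.activeG x := fun i hi => by
    by_contra h
    exact (hI i).1 hi (hlamg0 i h)
  have hsumlam : ∑ a, lam a • v a = ∑ i, lamg i • v' i +
      ∑ i, μ i • gradient (S.branch x σ i) x := by
    rw [Fintype.sum_sum_type, Fintype.sum_sum_type, ← Finset.sum_add_distrib]
    congr 1
    · rw [← sum_subtype_smul hlamg hlamg0 v']
      exact Finset.sum_congr rfl fun i _ => by rw [hv']
    · refine Finset.sum_congr rfl fun i _ => ?_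
      rw [hv1, hv2, hμ, sub_smul, smul_neg, sub_eq_add_neg]
  have key := LocalRCPLD.branch_dependent hL hJ σ (I := I) (lamg := lamg) (lame := lame) (μ := μ)
    (v := v') (xs := fun k => (q k).1) (vs := vs) (fun i hi => by
      have hact := hIact i hi
      refine ⟨by simpa [activeG] using hact, ?_, ?_⟩
      · rw [hlamg ⟨i, hact⟩]
        exact hlam _
      · rw [hv' ⟨i, hact⟩]
        exact hv (Sum.inl ⟨i, hact⟩))
    (by
      obtain ⟨a, ha⟩ := Function.ne_iff.1 hne
      have ha : lam a ≠ 0 := ha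
      rcases a with i | i | i
      · have h1 : lamg i ≠ 0 := by rwa [hlamg]
        exact Or.inl ⟨i, (hI i).2 h1, h1⟩
      · refine Or.inr ⟨i, ?_⟩
        simpa [hμ, (hex i).resolve_left ha] using ha
      · refine Or.inr ⟨i, ?_⟩
        simpa [hμ, (hex i).resolve_right ha] using ha)
    (by
      have h1 : ∑ i ∈ I, lamg i • v' i = ∑ i, lamg i • v' i :=
        Finset.sum_subset (Finset.subset_univ I) fun i _ hi => by
          rw [not_not.1 fun h => hi ((hI i).2 h), zero_smul]
      have h2 : ∑ j ∈ J, lame j • gradient (S.eqFun x j) x =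
          -∑ j : J, β j • gradient (S.eqFun x j) x := by
        rw [← Finset.sum_coe_sort J, ← Finset.sum_neg_distrib]
        exact Finset.sum_congr rfl fun j _ => by rw [hlame, neg_smul]
      rw [h1, h2, hβ, hsumlam]
      abel)
    ((continuous_fst.tendsto (x, v)).comp hq) (fun k => (hqp k).1) (fun i hi => by
      have hact := hIact i hi
      refine ⟨fun k => ?_, ?_⟩
      · rw [hvs k ⟨i, hact⟩]
        exact (hqp k).2.1 (Sum.inl ⟨i, hact⟩)
      · rw [hv' ⟨i, hact⟩]
        simp only [hvs _ ⟨i, hact⟩]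
        exact (((continuous_apply (Sum.inl ⟨i, hact⟩)).comp continuous_snd).tendsto (x, v)).comp hq)
  have hliJ := eventually_linearIndependent_gradients (x := x) (fun j : J => hh j) hJ.1
  obtain ⟨k, hk1, hk2⟩ := (key.and (((continuous_fst.tendsto (x, v)).comp hq).eventually
    hliJ)).exists
  refine hk1 (Fintype.linearIndependent_iff.2 fun γ hγ => ?_)
  rw [Fintype.sum_sum_type, Fintype.sum_sum_type] at hγ
  simp only [Sum.elim_inl, Sum.elim_inr] at hγ
  obtain ⟨γg, hγg, hγg0⟩ := exists_extension_by_zero (p := fun i => i ∈ I) fun i => γ (Sum.inl i)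
  obtain ⟨γμ, hγμ, hγμ0⟩ := exists_extension_by_zero (p := fun i => μ i ≠ 0)
    fun i => γ (Sum.inr (Sum.inr i))
  rw [sum_subtype_smul hγg hγg0 (vs k),
    sum_subtype_smul hγμ hγμ0 fun i => gradient (S.branch x σ i) (q k).1] at hγ
  obtain ⟨hw1, hw2⟩ := hgrad (hqp k).2.1
  have hα := (hqp k).2.2 (Sum.elim (fun i => γg i)
    (Sum.elim (fun i => if lam (Sum.inr (Sum.inl i)) = 0 then 0 else γμ i)
      fun i => if lam (Sum.inr (Sum.inr i)) = 0 then 0 else -γμ i)) (by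
      rintro (i | i | i) hi
      · refine hγg0 i fun h => (hI i).1 h ?_
        rw [hlamg]
        exact hi
      · simp [hi]
      · simp [hi]) (by
      have h1 : ∑ a, Sum.elim (fun i : S.activeG x => γg i)
          (Sum.elim (fun i => if lam (Sum.inr (Sum.inl i)) = 0 then 0 else γμ i)
            fun i => if lam (Sum.inr (Sum.inr i)) = 0 then 0 else -γμ i) a • (q k).2 a =
          ∑ i, γg i • vs k i + ∑ i, γμ i • gradient (S.branch x σ i) (q k).1 := by
        rw [Fintype.sum_sum_type, Fintype.sum_sum_type, ← Finset.sum_add_distrib]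
        congr 1
        · rw [← sum_subtype_smul (p := fun i => i ∈ S.activeG x) (γ := fun i => γg i)
            (fun _ => rfl) (fun i hi => hγg0 i fun h => hi (hIact i h)) (vs k)]
          exact Finset.sum_congr rfl fun i _ => by rw [hvs, Sum.elim_inl]
        · refine Finset.sum_congr rfl fun i _ => ?_
          simp only [Sum.elim_inl, Sum.elim_inr, hw1, hw2]
          by_cases k1 : lam (Sum.inr (Sum.inl i)) = 0 <;>
            by_cases k2 : lam (Sum.inr (Sum.inr i)) = 0
          · have : γμ i = 0 := hγμ0 i (by simp [hμ, k1, k2])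
            simp [k1, k2, this]
          · simp [k1, k2]
          · simp [k1, k2]
          · exact absurd (hex i) (by simp [k1, k2])
      rw [h1]
      have h2 : ∑ i, γg i • vs k i + ∑ i, γμ i • gradient (S.branch x σ i) (q k).1 =
          -∑ j : J, γ (Sum.inr (Sum.inl j)) • gradient (S.eqFun x j) (q k).1 := by
        rw [eq_neg_iff_add_eq_zero, ← hγ]
        abel
      rw [h2]
      exact Submodule.neg_mem _ (Submodule.sum_mem _ fun j _ => Submodule.smul_mem _ _
        (Submodule.subset_span ⟨j, rfl⟩)))
  have hγg' : ∀ i, γg i = 0 := fun i => by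
    by_cases hi : i ∈ I
    · exact congrFun hα (Sum.inl ⟨i, hIact i hi⟩)
    · exact hγg0 i hi
  have hγμ' : ∀ i, γμ i = 0 := fun i => by
    by_cases hi : μ i ≠ 0
    · have k1 := congrFun hα (Sum.inr (Sum.inl i))
      have k2 := congrFun hα (Sum.inr (Sum.inr i))
      simp only [Sum.elim_inl, Sum.elim_inr, Pi.zero_apply] at k1 k2
      by_cases k3 : lam (Sum.inr (Sum.inl i)) = 0
      · by_cases k4 : lam (Sum.inr (Sum.inr i)) = 0
        · exact absurd (by simp [hμ, k3, k4]) hi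
        · simpa [k4] using k2
      · simpa [k3] using k1
    · exact hγμ0 i hi
  simp only [hγg', hγμ', zero_smul, Finset.sum_const_zero, zero_add, add_zero] at hγ
  have := Fintype.linearIndependent_iff.1 hk2 _ hγ
  rintro (i | j | i)
  · rw [← hγg, hγg']
  · exact this j
  · rw [← hγμ, hγμ']

end SwitchingSystem

end Branches

/-! ### Constant rank, M-stationarity and the error bound -/

section MainResults

theorem exists_isBasisOfSpan {E κ : Type*} [NormedAddCommGroup E] [InnerProductSpace ℝ E]
    [Fintype κ] (u : κ → E) : ∃ J : Finset κ, IsBasisOfSpan u J := by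
  classical
  obtain ⟨κ', a, ha, hspan, hli⟩ := exists_linearIndependent' ℝ u
  have : Finite κ' := Finite.of_injective a ha
  have := Fintype.ofFinite κ'
  have hr : Set.range (fun j : (Finset.univ.image a) => (j : κ)) = Set.range a := by
    ext i
    simp
  refine ⟨Finset.univ.image a, ?_, ?_⟩
  · exact (linearIndependent_iff_of_range_eq u (fun _ => rfl) (fun _ => rfl)
      Subtype.val_injective ha hr).2 hli
  · rw [← hspan]
    congr 1
    rw [show (fun i : (Finset.univ.image a) => u i) =
        u ∘ fun j : (Finset.univ.image a) => (j : κ) from rfl,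
      Set.range_comp, hr, Set.range_comp]

/-- Under a constant rank condition, the functions whose gradients form a basis determine the zero
set of the whole family. -/
theorem eventually_forall_eq_zero_of_constant_rank {E κ : Type*} [NormedAddCommGroup E]
    [InnerProductSpace ℝ E] [CompleteSpace E] [FiniteDimensional ℝ E] [Fintype κ]
    {e : κ → E → ℝ} {x : E} (he : ∀ i, ContDiff ℝ 1 (e i)) (hex : ∀ i, e i x = 0)
    (hrank : ∀ᶠ y in 𝓝 x, Set.finrank ℝ (Set.range fun i => gradient (e i) y) =
      Set.finrank ℝ (Set.range fun i => gradient (e i) x))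
    {J : Finset κ} (hJ : IsBasisOfSpan (fun i => gradient (e i) x) J) :
    ∀ᶠ y in 𝓝 x, (∀ j : J, e j y = 0) → ∀ i, e i y = 0 := by
  have hspan : ∀ᶠ y in 𝓝 x, ∀ i, gradient (e i) y ∈ gradSpan (fun j : J => e j) y := by
    filter_upwards [hrank, eventually_linearIndependent_gradients (fun j : J => he j) hJ.1]
      with y h1 h2 i
    have hle : gradSpan (fun j : J => e j) y ≤
        Submodule.span ℝ (Set.range fun i => gradient (e i) y) := by
      refine Submodule.span_mono ?_
      rintro _ ⟨j, rfl⟩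
      exact ⟨j, rfl⟩
    -- The gradients indexed by J remain independent near x, so by constant rank their span already
    -- has full dimension.
    have heq : gradSpan (fun j : J => e j) y =
        Submodule.span ℝ (Set.range fun i => gradient (e i) y) := by
      refine Submodule.eq_of_le_of_finrank_eq hle ?_
      have k1 := finrank_span_eq_card h2
      have k2 := finrank_span_eq_card hJ.1
      rw [hJ.2] at k2
      exact k1.trans (k2.symm.trans h1.symm)
    rw [heq]
    exact Submodule.subset_span ⟨i, rfl⟩
  have h : ∀ i, ∀ᶠ y in 𝓝 x, (∀ j : J, e j y = 0) → e i y = 0 := fun i =>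
    eventually_eq_zero_of_gradient_mem_gradSpan (he i) (fun j : J => he j) (hex i)
      (fun j => hex j) hJ.1 (hspan.mono fun y hy => hy i)
  filter_upwards [eventually_all.2 h] with y hy hey i
  exact hy i hey

/-- A point of the cross has a zero coordinate, so its distance from (a, b) is at least |a| or at
least |b|, hence at least the smaller one. -/
theorem abs_apply_zero_le_infDist {a b : ℝ} (h : |a| ≤ |b|) :
    |a| ≤ Metric.infDist !₂[a, b] switchingSet := by
  refine (Metric.le_infDist ⟨0, by simp [switchingSet]⟩).2 fun z hz => ?_
  rw [dist_eq_norm]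
  rcases mul_eq_zero.1 (hz : z 0 * z 1 = 0) with h0 | h0
  · have := PiLp.norm_apply_le (!₂[a, b] - z) 0
    simpa [h0] using this
  · have := PiLp.norm_apply_le (!₂[a, b] - z) 1
    refine h.trans ?_
    simpa [h0] using this

theorem abs_apply_one_le_infDist {a b : ℝ} (h : |b| ≤ |a|) :
    |b| ≤ Metric.infDist !₂[a, b] switchingSet := by
  refine (Metric.le_infDist ⟨0, by simp [switchingSet]⟩).2 fun z hz => ?_
  rw [dist_eq_norm]
  rcases mul_eq_zero.1 (hz : z 0 * z 1 = 0) with h0 | h0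
  · have := PiLp.norm_apply_le (!₂[a, b] - z) 0
    refine h.trans ?_
    simpa [h0] using this
  · have := PiLp.norm_apply_le (!₂[a, b] - z) 1
    simpa [h0] using this

namespace SwitchingSystem

variable {d n m p : ℕ} {S : SwitchingSystem d n m p} {x : EuclideanSpace ℝ (Fin d)}

theorem mem_indexG {i : Fin p} : i ∈ S.indexG x ↔ S.G i x = 0 ∧ S.H i x ≠ 0 := by simp [indexG]

theorem mem_indexH {i : Fin p} : i ∈ S.indexH x ↔ S.G i x ≠ 0 ∧ S.H i x = 0 := by simp [indexH]

theorem mem_indexGH {i : Fin p} : i ∈ S.indexGH x ↔ S.G i x = 0 ∧ S.H i x = 0 := by simp [indexGH]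

theorem mem_activeG {i : Fin n} : i ∈ S.activeG x ↔ S.g i x = 0 := by simp [activeG]

theorem contDiff_eqFun (hh : ∀ i, ContDiff ℝ 1 (S.h i)) (hG : ∀ i, ContDiff ℝ 1 (S.G i))
    (hH : ∀ i, ContDiff ℝ 1 (S.H i)) (i) : ContDiff ℝ 1 (S.eqFun x i) := by
  rcases i with i | i | i
  · exact hh i
  · exact hG i
  · exact hH i

theorem eqFun_self (hx : x ∈ S.feasible) (i) : S.eqFun x i x = 0 := by
  rcases i with i | i | i
  · exact hx.2.1 i
  · exact (mem_indexG.1 i.2).1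
  · exact (mem_indexH.1 i.2).2

theorem branch_self (σ : S.indexGH x → Bool) (i) : S.branch x σ i x = 0 := by
  unfold branch
  split_ifs
  · exact (mem_indexGH.1 i.2).1
  · exact (mem_indexGH.1 i.2).2

theorem branchFun_self (σ : S.indexGH x → Bool) (a) : S.branchFun x σ a x = 0 := by
  rcases a with i | i | i
  · exact mem_activeG.1 i.2
  · exact branch_self σ i
  · change -S.branch x σ i x = 0
    rw [branch_self, neg_zero]

theorem lipNear_branchFun (hg : ∀ i, LocallyLipschitz (S.g i)) (hG : ∀ i, ContDiff ℝ 1 (S.G i))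
    (hH : ∀ i, ContDiff ℝ 1 (S.H i)) (σ : S.indexGH x → Bool) (z) (a) :
    LipNear (S.branchFun x σ a) z := by
  rcases a with i | i | i
  · exact (hg i).lipNear z
  · exact (contDiff_branch hG hH σ i).lipNear z
  · exact (contDiff_branch hG hH σ i).neg.lipNear z

theorem subdiffRegular_branchFun (hG : ∀ i, ContDiff ℝ 1 (S.G i))
    (hH : ∀ i, ContDiff ℝ 1 (S.H i)) (hreg : ∀ i, ∀ᶠ y in 𝓝 x, SubdiffRegularAt (S.g i) y)
    (σ : S.indexGH x → Bool) (a) : ∀ᶠ y in 𝓝 x, SubdiffRegularAt (S.branchFun x σ a) y := by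
  rcases a with i | i | i
  · exact hreg i
  · exact Eventually.of_forall fun y => (contDiff_branch hG hH σ i).subdiffRegularAt y
  · exact Eventually.of_forall fun y => (contDiff_branch hG hH σ i).neg.subdiffRegularAt y

/-- Near `x`, the points that satisfy the constraints of a branch are feasible. -/
theorem eventually_feasible_of_branch (hx : x ∈ S.feasible)
    (hg : ∀ i, LocallyLipschitz (S.g i)) (hh : ∀ i, ContDiff ℝ 1 (S.h i))
    (hG : ∀ i, ContDiff ℝ 1 (S.G i)) (hH : ∀ i, ContDiff ℝ 1 (S.H i))
    (hrank : ∀ᶠ y in 𝓝 x, Set.finrank ℝ (Set.range fun i => gradient (S.eqFun x i) y) =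
      Set.finrank ℝ (Set.range fun i => gradient (S.eqFun x i) x))
    {J : Finset (Fin m ⊕ S.indexG x ⊕ S.indexH x)}
    (hJ : IsBasisOfSpan (fun i => gradient (S.eqFun x i) x) J) :
    ∀ᶠ w in 𝓝 x, ∀ σ : S.indexGH x → Bool, (∀ a, S.branchFun x σ a w ≤ 0) →
      (∀ j : J, S.eqFun x j w = 0) → w ∈ S.feasible := by
  have h1 : ∀ᶠ w in 𝓝 x, ∀ i, i ∉ S.activeG x → S.g i w ≤ 0 := eventually_all.2 fun i => by
    by_cases hi : i ∈ S.activeG x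
    · exact Eventually.of_forall fun w h => absurd hi h
    · have : S.g i x < 0 := lt_of_le_of_ne (hx.1 i) fun h => hi (mem_activeG.2 h)
      exact ((hg i).continuous.continuousAt.eventually (gt_mem_nhds this)).mono fun w hw _ => hw.le
  filter_upwards [h1, eventually_forall_eq_zero_of_constant_rank
    (contDiff_eqFun hh hG hH) (eqFun_self hx) hrank hJ] with w h2 h3 σ h4 h5
  have h6 := h3 h5
  refine ⟨fun i => ?_, fun i => h6 (Sum.inl i), fun i => ?_⟩
  · by_cases hi : i ∈ S.activeG x
    · exact h4 (Sum.inl ⟨i, hi⟩)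
    · exact h2 i hi
  · by_cases k1 : S.G i x = 0 <;> by_cases k2 : S.H i x = 0
    · have hi : i ∈ S.indexGH x := mem_indexGH.2 ⟨k1, k2⟩
      have k3 : S.branch x σ ⟨i, hi⟩ w ≤ 0 := h4 (Sum.inr (Sum.inl ⟨i, hi⟩))
      have k4 : -S.branch x σ ⟨i, hi⟩ w ≤ 0 := h4 (Sum.inr (Sum.inr ⟨i, hi⟩))
      have k5 : S.branch x σ ⟨i, hi⟩ w = 0 := by linarith
      unfold branch at k5
      split_ifs at k5
      · simp only at k5
        rw [k5, zero_mul]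
      · simp only at k5
        rw [k5, mul_zero]
    · have k3 : S.G i w = 0 := h6 (Sum.inr (Sum.inl ⟨i, mem_indexG.2 ⟨k1, k2⟩⟩))
      rw [k3, zero_mul]
    · have k3 : S.H i w = 0 := h6 (Sum.inr (Sum.inr ⟨i, mem_indexH.2 ⟨k1, k2⟩⟩))
      rw [k3, mul_zero]
    · exact absurd (hx.2.2 i) (mul_ne_zero k1 k2)

theorem mStationary_of_RCPLD (hg : ∀ i, LocallyLipschitz (S.g i))
    (hh : ∀ i, ContDiff ℝ 1 (S.h i)) (hG : ∀ i, ContDiff ℝ 1 (S.G i))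
    (hH : ∀ i, ContDiff ℝ 1 (S.H i)) (hx : x ∈ S.feasible) (hR : S.RCPLD x)
    {f : EuclideanSpace ℝ (Fin d) → ℝ} (hf : LipNear f x) (hmin : IsLocalMinOn f S.feasible x) :
    S.MStationary x f := by
  classical
  have hL := S.localRCPLD_of_RCPLD x hR
  obtain ⟨J, hJ⟩ := exists_isBasisOfSpan fun i => gradient (S.eqFun x i) x
  -- One branch suffices: nearby points of it are feasible, so x is a local minimizer there too.
  -- With G_i = 0 on all biactive indices, the H-multipliers vanish there.
  obtain ⟨σ, hσ⟩ : ∃ σ : S.indexGH x → Bool, ∀ i, σ i = true := ⟨fun _ => true, fun _ => rfl⟩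
  have heq := contDiff_eqFun (x := x) hh hG hH
  obtain ⟨ξ, hξ, lam, v, hlam, hv, hrel⟩ :=
    (LocalRCPLD.relaxedCPLD hL heq hG hH hJ σ).exists_multipliers (f := f)
      (lipNear_branchFun hg hG hH σ) (branchFun_self σ) (fun j : J => heq j)
      (fun j => eqFun_self hx j) hJ.1 hf (by
        filter_upwards [eventually_nhdsWithin_iff.1 hmin,
          eventually_feasible_of_branch hx hg hh hG hH hR.1 hJ] with w h1 h2 h3 h4
        exact h1 (h2 σ h3 h4))
  obtain ⟨β, hβ⟩ := mem_span_range_iff_exists_fintype_sum.1 hrel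
  obtain ⟨lamg, hlamg, -⟩ := exists_extension_by_zero (p := fun i => i ∈ S.activeG x)
    fun i => lam (Sum.inl i)
  obtain ⟨v', hv', -⟩ := exists_extension_by_zero (p := fun i => i ∈ S.activeG x)
    fun i => v (Sum.inl i)
  obtain ⟨lame, hlame, hlame0⟩ := exists_extension_by_zero (p := fun j => j ∈ J) fun j => -β j
  obtain ⟨a, ha, ha0⟩ := exists_extension_by_zero (p := fun i => i ∈ S.indexG x)
    fun i => lame (Sum.inr (Sum.inl i))
  obtain ⟨b, hb, hb0⟩ := exists_extension_by_zero (p := fun i => i ∈ S.indexH x)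
    fun i => lame (Sum.inr (Sum.inr i))
  obtain ⟨c, hc, hc0⟩ := exists_extension_by_zero (p := fun i => i ∈ S.indexGH x)
    fun i => lam (Sum.inr (Sum.inl i)) - lam (Sum.inr (Sum.inr i))
  have hE : ∀ i, S.branch x σ i = S.G i := fun i => by simp [branch, hσ]
  -- Here a, b and c live on I^G, I^H and I^{GH}; c is the difference of the multipliers of the two
  -- inequalities encoding G_i = 0.
  refine ⟨hx, ξ, hξ, lamg, fun i => lame (Sum.inl i), fun i => !₂[a i + c i, b i], v',
    fun i hi => ?_, fun i => ?_, ?_⟩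
  · have hact := mem_activeG.2 hi
    rw [hlamg ⟨i, hact⟩, hv' ⟨i, hact⟩]
    exact ⟨hlam _, hv (Sum.inl ⟨i, hact⟩)⟩
  · by_cases k1 : S.G i x = 0 <;> by_cases k2 : S.H i x = 0
    · have hi : i ∈ S.indexGH x := mem_indexGH.2 ⟨k1, k2⟩
      rw [S.pair_eq_zero x ⟨i, hi⟩, limitingNormalCone_switchingSet_zero]
      have : b i = 0 := hb0 i fun h => (mem_indexH.1 h).1 k1
      simp [this]
    · have : b i = 0 := hb0 i fun h => (mem_indexH.1 h).1 k1
      exact regularNormalCone_subset_limitingNormalCone _ _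
        (mem_regularNormalCone_switchingSet_of_apply_one (by simpa [pair] using k1)
          (by simpa [pair] using k2) (by simpa using this))
    · have h1 : a i = 0 := ha0 i fun h => (mem_indexG.1 h).2 k2
      have h2 : c i = 0 := hc0 i fun h => k1 (mem_indexGH.1 h).1
      exact regularNormalCone_subset_limitingNormalCone _ _
        (mem_regularNormalCone_switchingSet_of_apply_zero (by simpa [pair] using k1)
          (by simpa [pair] using k2) (by simp [h1, h2]))
    · exact absurd (hx.2.2 i) (mul_ne_zero k1 k2)
  · have hsum1 : ∑ i with S.g i x = 0, lamg i • v' i =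
        ∑ i : S.activeG x, lam (Sum.inl i) • v (Sum.inl i) := by
      change ∑ i ∈ S.activeG x, lamg i • v' i = _
      rw [← Finset.sum_coe_sort (S.activeG x)]
      exact Finset.sum_congr rfl fun i _ => by rw [hlamg, hv']
    have hv2 : ∀ i, v (Sum.inr (Sum.inl i)) = gradient (S.G i) x := fun i => by
      have := hv (Sum.inr (Sum.inl i))
      change _ ∈ limitingSubdiff (S.branch x σ i) x at this
      rw [hE, (hG i).limitingSubdiff_eq] at this
      exact this
    have hv3 : ∀ i, v (Sum.inr (Sum.inr i)) = -gradient (S.G i) x := fun i => by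
      have := hv (Sum.inr (Sum.inr i))
      change _ ∈ limitingSubdiff (fun y => -S.branch x σ i y) x at this
      rw [hE, (hG i).neg.limitingSubdiff_eq] at this
      rw [Set.mem_singleton_iff.1 this]
      exact gradient_neg' (hG i) x
    have hsum2 : ∑ a, lam a • v a = ∑ i with S.g i x = 0, lamg i • v' i +
        ∑ i, c i • gradient (S.G i) x := by
      rw [Fintype.sum_sum_type, Fintype.sum_sum_type, ← Finset.sum_add_distrib, hsum1,
        ← sum_subtype_smul hc hc0 fun i => gradient (S.G i) x]
      congr 1
      refine Finset.sum_congr rfl fun i _ => ?_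
      rw [hv2, hv3, smul_neg, sub_smul, sub_eq_add_neg]
    have hsum3 : -∑ j : J, β j • gradient (S.eqFun x j) x =
        ∑ i, lame (Sum.inl i) • gradient (S.h i) x + ∑ i, a i • gradient (S.G i) x +
          ∑ i, b i • gradient (S.H i) x := by
      rw [← Finset.sum_neg_distrib, ← sum_subtype_smul ha ha0 fun i => gradient (S.G i) x,
        ← sum_subtype_smul hb hb0 fun i => gradient (S.H i) x]
      have := sum_subtype_smul hlame hlame0 fun i => gradient (S.eqFun x i) x
      simp only [neg_smul] at this
      rw [this, Fintype.sum_sum_type, Fintype.sum_sum_type, ← add_assoc]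
      rfl
    rw [hβ, hsum2] at hsum3
    have hsum4 : ∑ i, ((!₂[a i + c i, b i] : EuclideanSpace ℝ (Fin 2)) 0 • gradient (S.G i) x +
        (!₂[a i + c i, b i] : EuclideanSpace ℝ (Fin 2)) 1 • gradient (S.H i) x) =
        ∑ i, a i • gradient (S.G i) x + ∑ i, c i • gradient (S.G i) x +
          ∑ i, b i • gradient (S.H i) x := by
      rw [← Finset.sum_add_distrib, ← Finset.sum_add_distrib]
      refine Finset.sum_congr rfl fun i _ => ?_
      rw [← add_smul]
      simp
    rw [hsum4]
    have hsum5 := neg_eq_iff_add_eq_zero.1 hsum3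
    rw [← hsum5]
    abel

theorem errorBound_of_RCPLD (hg : ∀ i, LocallyLipschitz (S.g i))
    (hh : ∀ i, ContDiff ℝ 1 (S.h i)) (hG : ∀ i, ContDiff ℝ 1 (S.G i))
    (hH : ∀ i, ContDiff ℝ 1 (S.H i)) (hx : x ∈ S.feasible) (hR : S.RCPLD x)
    (hreg : ∀ i, ∀ᶠ y in 𝓝 x, SubdiffRegularAt (S.g i) y) : S.ErrorBound x := by
  classical
  have hL := S.localRCPLD_of_RCPLD x hR
  obtain ⟨J, hJ⟩ := exists_isBasisOfSpan fun i => gradient (S.eqFun x i) x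
  have heq := contDiff_eqFun (x := x) hh hG hH
  choose C hC0 hC using fun σ : S.indexGH x → Bool =>
    (LocalRCPLD.relaxedCPLD hL heq hG hH hJ σ).error_bound
      (lipNear_branchFun hg hG hH σ) (branchFun_self σ) (fun j : J => heq j)
      (fun j => eqFun_self hx j) hJ.1 (subdiffRegular_branchFun hG hH hreg σ)
      (eventually_feasible_of_branch hx hg hh hG hH hR.1 hJ)
  have hdomG : ∀ᶠ y in 𝓝 x, ∀ i : S.indexG x, |S.G i y| ≤ |S.H i y| := eventually_all.2 fun i => by
    have h1 : |S.G i x| < |S.H i x| := by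
      rw [(mem_indexG.1 i.2).1, abs_zero]
      exact abs_pos.2 (mem_indexG.1 i.2).2
    exact ((hG i).continuous.abs.continuousAt.eventually_lt (hH i).continuous.abs.continuousAt
      h1).mono fun y hy => hy.le
  have hdomH : ∀ᶠ y in 𝓝 x, ∀ i : S.indexH x, |S.H i y| ≤ |S.G i y| := eventually_all.2 fun i => by
    have h1 : |S.H i x| < |S.G i x| := by
      rw [(mem_indexH.1 i.2).2, abs_zero]
      exact abs_pos.2 (mem_indexH.1 i.2).1
    exact ((hH i).continuous.abs.continuousAt.eventually_lt (hG i).continuous.abs.continuousAt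
      h1).mono fun y hy => hy.le
  obtain ⟨ε, hε, hball⟩ := Metric.eventually_nhds_iff_ball.1
    ((eventually_all.2 hC).and (hdomG.and hdomH))
  have hCs : 0 ≤ ∑ σ, C σ := Finset.sum_nonneg fun σ _ => hC0 σ
  -- Summing over branches gives one constant for all of them. The factor collects n and m from
  -- comparing entries with norms, and 3 from using the distances to the cross once each on I^G, I^H
  -- and I^{GH}.
  refine ⟨(∑ σ, C σ) * (n + m + 3), by positivity, ε, hε, fun y hy => ?_⟩
  obtain ⟨h1, h2, h3⟩ := hball y hy
  obtain ⟨D, hD⟩ : ∃ D : Fin p → ℝ, D = fun i => Metric.infDist (S.pair y i) switchingSet :=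
    ⟨_, rfl⟩
  have hD0 : ∀ i, 0 ≤ D i := fun i => hD ▸ Metric.infDist_nonneg
  -- The branch depends on y: the smaller of |G_i(y)| and |H_i(y)| is bounded by the distance of the
  -- pair to the cross.
  obtain ⟨σ, hσ⟩ : ∃ σ : S.indexGH x → Bool, σ = fun i : S.indexGH x =>
      decide (|S.G i y| ≤ |S.H i y|) :=
    ⟨_, rfl⟩
  obtain ⟨w, hw1, hw2, hw3, hw4⟩ := h1 σ
  have hwf := hw3 σ hw1 hw2
  have hsub : ∀ T : Finset (Fin p), ∀ t : T → ℝ, (∀ i, t i ≤ D i) → ∑ i, t i ≤ ∑ i, D i :=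
    fun T t ht => by
      refine (Finset.sum_le_sum fun i _ => ht i).trans ?_
      rw [Finset.sum_coe_sort T D]
      exact Finset.sum_le_sum_of_subset_of_nonneg (Finset.subset_univ T) fun i _ _ => hD0 i
  have hbG : ∑ i : S.indexG x, |S.G i y| ≤ ∑ i, D i := hsub _ _ fun i => by
    rw [hD]
    exact abs_apply_zero_le_infDist (h2 i)
  have hbH : ∑ i : S.indexH x, |S.H i y| ≤ ∑ i, D i := hsub _ _ fun i => by
    rw [hD]
    exact abs_apply_one_le_infDist (h3 i)
  have hbGH : ∑ i : S.indexGH x, |S.branch x σ i y| ≤ ∑ i, D i := hsub _ _ fun i => by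
    rw [hD]
    by_cases hi : |S.G i y| ≤ |S.H i y|
    · have : S.branch x σ i = S.G i := by simp [branch, hσ, hi]
      rw [this]
      exact abs_apply_zero_le_infDist hi
    · have : S.branch x σ i = S.H i := by simp [branch, hσ, hi]
      rw [this]
      exact abs_apply_one_le_infDist (not_le.1 hi).le
  obtain ⟨Ng, hNg⟩ : ∃ N : ℝ, N = ‖WithLp.toLp 2 fun i => max 0 (S.g i y)‖ := ⟨_, rfl⟩
  obtain ⟨Nh, hNh⟩ : ∃ N : ℝ, N = ‖WithLp.toLp 2 fun i => S.h i y‖ := ⟨_, rfl⟩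
  have hNg0 : 0 ≤ Ng := hNg ▸ norm_nonneg _
  have hNh0 : 0 ≤ Nh := hNh ▸ norm_nonneg _
  have hbg : ∑ i : S.activeG x, max (S.g i y) 0 ≤ n * Ng := by
    rw [Finset.sum_coe_sort (S.activeG x) fun i => max (S.g i y) 0]
    refine (Finset.sum_le_sum_of_subset_of_nonneg (Finset.subset_univ _)
      fun i _ _ => le_max_right _ _).trans ?_
    refine (Finset.sum_le_card_nsmul _ _ Ng fun i _ => ?_).trans (by simp)
    have := PiLp.norm_apply_le (WithLp.toLp 2 fun i => max 0 (S.g i y)) i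
    rw [← hNg] at this
    rw [max_comm]
    exact (le_abs_self _).trans this
  have hbh : ∑ i, |S.h i y| ≤ m * Nh := by
    refine (Finset.sum_le_card_nsmul _ _ Nh fun i _ => ?_).trans (by simp)
    have := PiLp.norm_apply_le (WithLp.toLp 2 fun i => S.h i y) i
    rwa [← hNh] at this
  have hsumφ : ∑ a, max (S.branchFun x σ a y) 0 ≤ n * Ng + ∑ i, D i := by
    rw [Fintype.sum_sum_type, Fintype.sum_sum_type, ← Finset.sum_add_distrib]
    refine add_le_add hbg ((Finset.sum_le_sum fun i _ => ?_).trans hbGH)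
    change max (S.branch x σ i y) 0 + max (-S.branch x σ i y) 0 ≤ _
    rcases le_total 0 (S.branch x σ i y) with h | h
    · rw [max_eq_left h, max_eq_right (by linarith), abs_of_nonneg h, add_zero]
    · rw [max_eq_right h, max_eq_left (by linarith), abs_of_nonpos h, zero_add]
  have hsume : ∑ j : J, |S.eqFun x j y| ≤ m * Nh + (∑ i, D i + ∑ i, D i) := by
    rw [Finset.sum_coe_sort J fun j => |S.eqFun x j y|]
    refine (Finset.sum_le_sum_of_subset_of_nonneg (Finset.subset_univ _)
      fun i _ _ => abs_nonneg _).trans ?_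
    rw [Fintype.sum_sum_type, Fintype.sum_sum_type]
    exact add_le_add hbh (add_le_add hbG hbH)
  rw [← hNg, ← hNh]
  have hDsum : ∑ i, Metric.infDist (S.pair y i) switchingSet = ∑ i, D i := by rw [hD]
  rw [hDsum]
  have hDs : 0 ≤ ∑ i, D i := Finset.sum_nonneg fun i _ => hD0 i
  calc Metric.infDist y S.feasible ≤ dist y w := Metric.infDist_le_dist_of_mem hwf
    _ = ‖w - y‖ := by rw [dist_comm, dist_eq_norm]
    _ ≤ C σ * (∑ a, max (S.branchFun x σ a y) 0 + ∑ j : J, |S.eqFun x j y|) := hw4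
    _ ≤ C σ * ((n + m + 3) * (Ng + Nh + ∑ i, D i)) := by
        refine mul_le_mul_of_nonneg_left ?_ (hC0 σ)
        have k1 : (0 : ℝ) ≤ n := Nat.cast_nonneg _
        have k2 : (0 : ℝ) ≤ m := Nat.cast_nonneg _
        have k3 : 0 ≤ n * (Nh + ∑ i, D i) + m * (Ng + ∑ i, D i) + 3 * (Ng + Nh) := by positivity
        linarith
    _ ≤ (∑ σ, C σ) * ((n + m + 3) * (Ng + Nh + ∑ i, D i)) :=
        mul_le_mul_of_nonneg_right
          (Finset.single_le_sum (fun σ _ => hC0 σ) (Finset.mem_univ σ)) (by positivity)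
    _ = (∑ σ, C σ) * (n + m + 3) * (Ng + Nh + ∑ i, D i) := by ring

end SwitchingSystem

end MainResults

theorem mainTheorem6 (d n m p : ℕ) (S : SwitchingSystem d n m p)
    (hg : ∀ i, LocallyLipschitz (S.g i)) (hh : ∀ i, ContDiff ℝ 1 (S.h i))
    (hG : ∀ i, ContDiff ℝ 1 (S.G i)) (hH : ∀ i, ContDiff ℝ 1 (S.H i))
    (x : EuclideanSpace ℝ (Fin d)) (hx : x ∈ S.feasible) :
    -- the limiting normal cone of the switching set at the origin
    ((limitingNormalCone switchingSet 0 = ⋃ y, regularNormalCone switchingSet y) ∧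
      limitingNormalCone switchingSet 0 = {η | η 0 * η 1 = 0} ∧
      limitingNormalCone switchingSet 0 =
        regularNormalCone axisOne 0 ∪ regularNormalCone axisTwo 0) ∧
    -- MPSC-RCPLD is RCPLD for the local reformulation, and it coincides with the piecewise RCPLD
    (S.RCPLD x ↔
      S.LocalRCPLD x fun i => limitingNormalCone switchingSet (S.pair x i)) ∧
    (S.RCPLD x ↔ S.PiecewiseRCPLD x) ∧
    (S.RCPLD x ↔
      S.LocalRCPLD x fun i =>
        regularNormalCone axisOne (S.pair x i) ∪ regularNormalCone axisTwo (S.pair x i)) ∧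
    -- MPSC-RCPLD is a constraint qualification for M-stationarity
    (S.RCPLD x → ∀ f : EuclideanSpace ℝ (Fin d) → ℝ,
      (∃ K, ∃ U ∈ 𝓝 x, LipschitzOnWith K f U) → IsLocalMinOn f S.feasible x →
      S.MStationary x f) ∧
    -- MPSC-RCPLD is sufficient for the error bound when `g` is subdifferentially regular
    (S.RCPLD x → (∀ i, ∀ᶠ y in 𝓝 x, SubdiffRegularAt (S.g i) y) → S.ErrorBound x) := by
  refine ⟨⟨limitingNormalCone_switchingSet_zero_eq_iUnion, limitingNormalCone_switchingSet_zero,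
    limitingNormalCone_switchingSet_zero.trans regularNormalCone_axes_zero.symm⟩,
    S.RCPLD_iff_localRCPLD_switchingSet x, S.RCPLD_iff_piecewiseRCPLD x,
    S.RCPLD_iff_localRCPLD_axes x, fun hR f hf hmin => ?_, fun hR hreg => ?_⟩
  · exact SwitchingSystem.mStationary_of_RCPLD hg hh hG hH hx hR hf hmin
  · exact SwitchingSystem.errorBound_of_RCPLD hg hh hG hH hx hR hreg
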